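/- Let $n\ge 2$ be an integer, $p>n$ a prime, $q=p^{e}$ with $e\ge 1$, and let $\mathrm{ord}_p$ be the valuation of $\mathbb{C}_p$ with $\mathrm{ord}_p(p)=1$. Let $\mathbb{Q}_q\subset\mathbb{C}_p$ be the unramified extension of $\mathbb{Q}_p$ of degree $e$, $\mathbb{Z}_q$ its ring of integers, $\zeta_p\in\mathbb{C}_p$ a primitive $p$-th root of unity, $\gamma\in\mathbb{Q}_p(\zeta_p)$ a zero of $\sum_{k\ge0}x^{p^k}/p^k$ with $\mathrm{ord}_p\gamma=\frac1{p-1}$, and $\tilde\gamma\in\mathbb{C}_p$ with $\tilde\gamma^n=\gamma$. Let $R=\mathbb{Z}_q[\tilde\gamma]$ be the ring of integers of $\mathbb{Q}_q(\zeta_p,\tilde\gamma)$, let $\sigma$ be the automorphism of $\mathbb{Q}_q(\zeta_p,\tilde\gamma)$ that fixes $\zeta_p$ and $\tilde\gamma$ and restricts to the Frobenius of $\mathbb{Q}_q/\mathbb{Q}_p$, and let $\bar t\in\mathbb{Z}_q$ be the Teichmüller representative of some $t\in\mathbb{F}_q^*$ (i.e. $\bar t^{\,q-1}=1$). For $(a,b)\in\mathbb{Z}^2$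 put $\omega(a,b)=\frac an+b+\frac{2n+1}{n}\max\{0,-a,-b\}$ and $(\widetilde{a,b})=\tilde\gamma^{\,n\omega(a,b)}x^ay^b$. Let $$\mathcal{C}_0=\Big\{\sum_{(a,b)\in\mathbb{Z}^2}\xi(a,b)(\widetilde{a,b})\ :\ \xi(a,b)\in R,\ \xi(a,b)\to0\text{ as }\omega(a,b)\to\infty\Big\}.$$ With $\gamma_i=\sum_{k=0}^{i}\gamma^{p^k}/p^k$ define on $\mathcal{C}_0$ the operators $$D_x=x\tfrac{\partial}{\partial x}+\sum_{i\ge0}\gamma_ip^i\Big(nx^{np^i}-\tfrac{\sigma^i(\bar t)}{x^{p^i}y^{p^i}}\Big),\qquad D_y=y\tfrac{\partial}{\partial y}+\sum_{i\ge0}\gamma_ip^i\Big(y^{p^i}-\tfrac{\sigma^i(\bar t)}{x^{p^i}y^{p^i}}\Big),$$ and let $H^2=\mathcal{C}_0/(D_x\mathcal{C}_0+D_y\mathcal{C}_0)$. Let $\Theta_\infty(x)=\exp\big(\sum_{k\ge0}(\gamma x)^{p^k}/p^k\big)$, $F_t(x,y)=\Theta_\infty(x^n)\,\Theta_\infty(y)\,\Theta_\infty(\bar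 t/(xy))$, and $\alpha_1=\sigma^{-1}\circ\psi_p\circ F_t$, where $F_t$ acts by multiplication, $\psi_p\big(\sum\eta(a,b)x^ay^b\big)=\sum\eta(pa,pb)x^ay^b$, and $\sigma^{-1}$ acts on coefficients. Let $\varepsilon_i=(i,0)$ for $0\le i\le n$ and $\varepsilon_i=(i-n,1)$ for $n+1\le i\le2n$. Let $0<\varpi<n$ be the integer with $p\varpi\equiv1\pmod n$, and put $$g(i)=\begin{cases}i,& i\in\{0,n,2n\},\\ \varpi i+n\lceil-\varpi i/n\rceil,&1\le i\le n-1,\\ n+\varpi i+n\lceil-\varpi i/n\rceil,&n+1\le i\le2n-1,\end{cases}\qquad \alpha_{i,j}=i-pj+n\Big\lceil\frac{pj-i}{n}\Big\rceil .$$ Then there are unique elements $\tilde A(\tilde\varepsilon_j,\tilde\varepsilon_i)\in R$ $(0\le i,j\le 2n)$ with $\alpha_1(\tilde\varepsilon_i)=\sum_{j=0}^{2n}\tilde A(\tilde\varepsilon_j,\tilde\varepsilon_i)\,\tilde\varepsilon_j$ in $H^2$ for all $0\le i\le 2n$, and they satisfy the following. (a) For all $0\le i,j\le2n$, $\mathrm{ord}_p\tilde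 A(\tilde\varepsilon_j,\tilde\varepsilon_i)\ge\frac jn$. (b) For all $0\le i\le2n$ and $0\le j<g(i)$, $\mathrm{ord}_p\tilde A(\tilde\varepsilon_j,\tilde\varepsilon_i)>\frac jn$; moreover $0\le g(i)\le 2n$ and $\mathrm{ord}_p\tilde A(\tilde\varepsilon_{g(i)},\tilde\varepsilon_i)=\frac{g(i)}n$. (c) If moreover $p>2n^2-n$, then for all $0\le i\le n$ and $0\le j\le n-1$ with $(i,j)\ne(n,0)$, $$\mathrm{ord}_p\tilde A(\tilde\varepsilon_j,\tilde\varepsilon_i)=\frac jn+\frac{(2n+1)\,\alpha_{i,j}}{n(p-1)}.$$ -/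

import Mathlib

open Filter Topology

noncomputable section

namespace Dwork

/-! ### Combinatorics of the Newton triangle with vertices `(-1,-1)`, `(n,0)`, `(0,1)` -/

/-- `n ω(a,b)`, where `ω(a,b) = a/n + b + ((2n+1)/n) max {0,-a,-b}` is the weight function. -/
def nwt (n : ℕ) (u : ℤ × ℤ) : ℤ :=
  u.1 + n * u.2 + (2 * n + 1) * max 0 (max (-u.1) (-u.2))

/-- Exponent vector of the monomial `ε_i`: `x^i` for `0 ≤ i ≤ n`, `x^(i-n) y` for
`n+1 ≤ i ≤ 2n`. -/
def eps (n i : ℕ) : ℤ × ℤ :=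
  if i ≤ n then ((i : ℤ), 0) else ((i : ℤ) - n, 1)

/-- `α_{i,j} = i - p j + n ⌈(p j - i)/n⌉`. -/
def alphaCoef (p n : ℕ) (i j : ℤ) : ℤ :=
  i - p * j + n * ⌈((p * j - i : ℤ) : ℚ) / (n : ℚ)⌉

/-- The integer `0 < ϖ < n` with `p ϖ ≡ 1 mod n` (for `n ≥ 2` prime to `p`). -/
def varpi (p n : ℕ) : ℕ := ((p : ZMod n)⁻¹).val

theorem varpi_spec {p n : ℕ} (hn : 2 ≤ n) (h : Nat.Coprime p n) :
    0 < varpi p n ∧ varpi p n < n ∧ p * varpi p n ≡ 1 [MOD n] := by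
  have : NeZero n := ⟨by omega⟩
  have : Fact (1 < n) := ⟨by omega⟩
  have h1 : (p : ZMod n) * ((varpi p n : ℕ) : ZMod n) = 1 := by
    rw [varpi, ZMod.natCast_val, ZMod.cast_id', id]
    exact ZMod.coe_mul_inv_eq_one p h
  refine ⟨Nat.pos_of_ne_zero fun h0 => ?_, ZMod.val_lt _, ?_⟩
  · rw [h0] at h1
    simp at h1
  · rw [← ZMod.natCast_eq_natCast_iff]
    push_cast
    exact h1

/-- The permutation `g` of `{0, …, 2n}`. -/
def g (p n i : ℕ) : ℤ :=
  if i = 0 ∨ i = n ∨ i = 2 * n then (i : ℤ)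
  else if i < n then
    varpi p n * i + n * ⌈(-(varpi p n * i : ℚ)) / (n : ℚ)⌉
  else
    n + varpi p n * i + n * ⌈(-(varpi p n * i : ℚ)) / (n : ℚ)⌉

/-! ### The Artin–Hasse series -/

/-- `∑_k x^(p^k) / p^k`, as a formal power series. -/
def logAH (p : ℕ) : PowerSeries ℚ :=
  open Classical in PowerSeries.mk fun m => if ∃ k : ℕ, m = p ^ k then 1 / (m : ℚ) else 0

/-- The Artin–Hasse series `exp (∑_k x^(p^k) / p^k)`. -/
def artinHasse (p : ℕ) : PowerSeries ℚ := (PowerSeries.exp ℚ).subst (logAH p)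

/-! ### The coefficient field -/

/-- The valuation `ord_p` attached to an absolute value with `|p| = 1/p`; `ord_p 0 = ∞`. -/
def ordp (p : ℕ) {K : Type*} [NormedField K] (x : K) : EReal :=
  open Classical in if x = 0 then ⊤ else ((-Real.logb p ‖x‖ : ℝ) : EReal)

/-- `γ` is a zero of `∑_k x^(p^k)/p^k` in `ℚ_p(ζ)` with `ord_p γ = 1/(p-1)`. -/
def IsDworkRoot (p : ℕ) [Fact p.Prime] (ζ γ : ℂ_[p]) : Prop :=
  γ ∈ IntermediateField.adjoin ℚ_[p] {ζ} ∧
  HasSum (fun k : ℕ => γ ^ p ^ k / (p : ℂ_[p]) ^ k) 0 ∧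
  ordp p γ = ((1 / ((p : ℝ) - 1) : ℝ) : EReal)

/-- The field `Ω₀(γ̃) = ℚ_q(ζ_p, γ̃)`, `q = p^a`. Here `ℚ_q`, the unramified extension of `ℚ_p`
of degree `a`, is generated by the solutions of `z^q = z`. -/
def Omega (p : ℕ) [Fact p.Prime] (a : ℕ) (ζ γt : ℂ_[p]) : IntermediateField ℚ_[p] ℂ_[p] :=
  IntermediateField.adjoin ℚ_[p] ({z | z ^ p ^ a = z} ∪ {ζ, γt})

/-- `ζ` as an element of `Ω₀(γ̃)`. -/
def zetaIn (p : ℕ) [Fact p.Prime] (a : ℕ) (ζ γt : ℂ_[p]) : Omega p a ζ γt :=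
  ⟨ζ, IntermediateField.subset_adjoin _ _ (by simp)⟩

/-- `γ̃` as an element of `Ω₀(γ̃)`. -/
def gammaIn (p : ℕ) [Fact p.Prime] (a : ℕ) (ζ γt : ℂ_[p]) : Omega p a ζ γt :=
  ⟨γt, IntermediateField.subset_adjoin _ _ (by simp)⟩

/-- The automorphism `σ` of `Ω₀(γ̃)` that restricts to the Frobenius automorphism of `ℚ_q` (the
`p`-th power map on Teichmüller representatives) and fixes `ζ_p` and `γ̃`. As these elements
generate `Ω₀(γ̃)`, there is only one such automorphism. -/
def IsFrobenius {p : ℕ} [Fact p.Prime] {a : ℕ} {ζ γt : ℂ_[p]}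
    (σ : Omega p a ζ γt ≃ₐ[ℚ_[p]] Omega p a ζ γt) : Prop :=
  (∀ z : Omega p a ζ γt, z ^ p ^ a = z → σ z = z ^ p) ∧
  σ (zetaIn p a ζ γt) = zetaIn p a ζ γt ∧ σ (gammaIn p a ζ γt) = gammaIn p a ζ γt

/-! ### Spaces of series and operators

In this section `γt` stands for `γ̃` (so that `γ = γt ^ n`) and `tb` for the Teichmüller
representative of `t`. A Laurent series `∑ ξ(a,b) x^a y^b` is given by its coefficient function
`ℤ × ℤ → K`. -/

section

variable {K : Type*} [NormedField K]

/-- Coefficients of the splitting function `Θ_∞(x) = E(γ x) = ∑ a_k x^k`. -/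
def thetaCoeff (p : ℕ) (γ : K) (k : ℕ) : K :=
  ((PowerSeries.coeff k (artinHasse p) : ℚ) : K) * γ ^ k

/-- The coefficient `B(a,b)` of `x^a y^b` in
`F_t(x,y) = Θ_∞(x^n) Θ_∞(y) Θ_∞(tb/(xy))`; the triple is `(k,l,m)`, for the term
`(tb/(xy))^k (x^n)^l y^m`. -/
def Bcoeff (p n : ℕ) (γt tb : K) (u : ℤ × ℤ) : K :=
  ∑' s : ℕ × ℕ × ℕ,
    if (n : ℤ) * s.2.1 - s.1 = u.1 ∧ (s.2.2 : ℤ) - s.1 = u.2 then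
      thetaCoeff p (γt ^ n) s.1 * tb ^ s.1 * thetaCoeff p (γt ^ n) s.2.1
        * thetaCoeff p (γt ^ n) s.2.2
    else 0

/-- The space `C₀` of series `∑ ξ(a,b) γ̃^(n ω(a,b)) x^a y^b` with integral `ξ(a,b)` that tend to
`0` as `ω(a,b) → ∞` (equivalently along the cofinite filter, since only finitely many lattice
points have bounded weight). -/
def C0 (n : ℕ) (γt : K) : Set (ℤ × ℤ → K) :=
  {η | ∃ ξ : ℤ × ℤ → K, (∀ u, ‖ξ u‖ ≤ 1) ∧ Tendsto ξ cofinite (𝓝 0) ∧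
    ∀ u, η u = ξ u * γt ^ nwt n u}

/-- The element `γ̃^(n ω(u)) x^(u.1) y^(u.2)` of `C₀`. -/
def mono (n : ℕ) (γt : K) (u : ℤ × ℤ) : ℤ × ℤ → K :=
  Pi.single u (γt ^ nwt n u)

/-- Multiplication by `F_t`. -/
def mulF (p n : ℕ) (γt tb : K) (η : ℤ × ℤ → K) (u : ℤ × ℤ) : K :=
  ∑' v : ℤ × ℤ, Bcoeff p n γt tb (u - v) * η v

/-- `ψ_p : ∑ η(a,b) x^a y^b ↦ ∑ η(pa,pb) x^a y^b`. -/
def psi (p : ℕ) (η : ℤ × ℤ → K) (u : ℤ × ℤ) : K := η (p * u.1, p * u.2)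

/-- `α₁ = σ⁻¹ ∘ ψ_p ∘ F_t`. -/
def alpha1 (p n : ℕ) (γt tb : K) (σ : K ≃+* K) (η : ℤ × ℤ → K) (u : ℤ × ℤ) : K :=
  σ.symm (psi p (mulF p n γt tb η) u)

/-- `γ_i = ∑_{k=0}^i γ^(p^k) / p^k`. -/
def gammaSeq (p : ℕ) (γ : K) (i : ℕ) : K :=
  ∑ k ∈ Finset.range (i + 1), γ ^ p ^ k / (p : K) ^ k

/-- `D_x = x ∂/∂x + ∑_i γ_i p^i (n x^(n p^i) - σ^i(tb) / (x^(p^i) y^(p^i)))`. -/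
def Dx (p n : ℕ) (γt tb : K) (σ : K ≃+* K) (η : ℤ × ℤ → K) (u : ℤ × ℤ) : K :=
  (u.1 : K) * η u + ∑' i : ℕ, gammaSeq p (γt ^ n) i * (p : K) ^ i *
    ((n : K) * η (u.1 - n * p ^ i, u.2) - σ^[i] tb * η (u.1 + p ^ i, u.2 + p ^ i))

/-- `D_y = y ∂/∂y + ∑_i γ_i p^i (y^(p^i) - σ^i(tb) / (x^(p^i) y^(p^i)))`. -/
def Dy (p n : ℕ) (γt tb : K) (σ : K ≃+* K) (η : ℤ × ℤ → K) (u : ℤ × ℤ) : K :=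
  (u.2 : K) * η u + ∑' i : ℕ, gammaSeq p (γt ^ n) i * (p : K) ^ i *
    (η (u.1, u.2 - p ^ i) - σ^[i] tb * η (u.1 + p ^ i, u.2 + p ^ i))

/-- `β` and `β'` have the same class in the top cohomology
`H² = C₀ / (D_x C₀ + D_y C₀)` of the complex `C₀ → C₀ ⊕ C₀ → C₀` built from `D_x`, `D_y`. -/
def EqInH2 (p n : ℕ) (γt tb : K) (σ : K ≃+* K) (β β' : ℤ × ℤ → K) : Prop :=
  ∃ ζx ∈ C0 n γt, ∃ ζy ∈ C0 n γt,
    β - β' = Dx p n γt tb σ ζx + Dy p n γt tb σ ζy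

/-- `A j i` is the coefficient `Ã(ε̃_j, ε̃_i)`: the matrix `A` has entries in the ring of integers
and `α₁(ε̃_i) = ∑_j A j i • ε̃_j` in `H²` for `0 ≤ i ≤ 2n`. -/
def IsFrobeniusMatrix (p n : ℕ) (γt tb : K) (σ : K ≃+* K)
    (A : Matrix (Fin (2 * n + 1)) (Fin (2 * n + 1)) K) : Prop :=
  (∀ j i, ‖A j i‖ ≤ 1) ∧
  ∀ i : Fin (2 * n + 1), EqInH2 p n γt tb σ
    (alpha1 p n γt tb σ (mono n γt (eps n i)))
    (∑ j : Fin (2 * n + 1), A j i • mono n γt (eps n j))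

end

end Dwork

end

/-!
By Dwork's lemma the Artin–Hasse series has `p`-integral coefficients, so the coefficients `a_k` of
`Θ_∞` satisfy `|a_k| ≤ |γ|^k`, with equality for `k < p`; hence `|α₁(ε̃_i)_w| ≤ |γ̃|^(p n ω(w))`.
The leading parts `γ (n x^n - t/(xy))` and `γ (y - t/(xy))` of `D_x` and `D_y` form a regular
sequence, modulo which every monomial is a multiple of some `ε_j`. Each reduction modulo them costs
an error smaller by the factor `|γ̃|^n`, so iterating expresses any series with the above decay
through the `ε_j`. Exactness of the Koszul complex of the leading parts, together with
`D_x D_y = D_y D_x`, shows that the `ε_j` are independent in `H²`.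

The reduction changes the coefficient at `ε_j` by terms of higher order only, so the size of `A j i`
is governed by the terms `(t/(xy))^k (x^n)^l y^m` of `F_t` that carry `ε_i` to the `p`-th power of a
monomial reducing to `ε_j`. The one of least degree `k + l + m` dominates: it reaches the bound
`p n ω(w) ≤ i + n (k + l + m)` for `w = ε_{g(i)}`, and in (c) it is the term with `k = α_{i,j}`.
-/

noncomputable section

namespace Dwork

/-! ### Integrality of the Artin–Hasse series -/

section Ultrametric

variable {K : Type*} [SeminormedAddCommGroup K] [IsUltrametricDist K] {x y : K} {C : ℝ}

theorem norm_add_le_of_norm_le (hx : ‖x‖ ≤ C) (hy : ‖y‖ ≤ C) : ‖x + y‖ ≤ C :=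
  (IsUltrametricDist.norm_add_le_max x y).trans (max_le hx hy)

theorem norm_sub_le_of_norm_le (hx : ‖x‖ ≤ C) (hy : ‖y‖ ≤ C) : ‖x - y‖ ≤ C := by
  rw [sub_eq_add_neg]
  exact norm_add_le_of_norm_le hx (by rwa [norm_neg])

theorem norm_eq_of_norm_sub_lt (h : ‖x - y‖ < ‖y‖) : ‖x‖ = ‖y‖ := by
  rw [sub_eq_add_neg] at h
  exact (IsUltrametricDist.norm_eq_of_add_norm_lt_max
    (h.trans_le ((norm_neg y).symm.trans_le (le_max_right _ _)))).trans (norm_neg y)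

end Ultrametric

section DworkLemma

open PowerSeries

theorem norm_coeff_pow_sub_expand_le {p : ℕ} [hp : Fact p.Prime] {Q : Polynomial ℚ_[p]}
    (hQ : ∀ i, ‖Q.coeff i‖ ≤ 1) (k : ℕ) :
    ‖(Q ^ p - Polynomial.expand _ p Q).coeff k‖ ≤ (p : ℝ)⁻¹ := by
  obtain ⟨P, rfl⟩ : ∃ P : Polynomial ℤ_[p], P.map PadicInt.Coe.ringHom = Q :=
    (Polynomial.lifts_iff_coeff_lifts Q).2 fun i => ⟨⟨Q.coeff i, hQ i⟩, rfl⟩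
  have hmod : PadicInt.toZMod ((P ^ p - Polynomial.expand _ p P).coeff k) = 0 := by
    rw [← Polynomial.coeff_map, Polynomial.map_sub, Polynomial.map_pow, Polynomial.map_expand,
      ZMod.expand_card, sub_self, Polynomial.coeff_zero]
  have hmem := (RingHom.mem_ker (f := PadicInt.toZMod (p := p))).2 hmod
  rw [PadicInt.ker_toZMod, PadicInt.maximalIdeal_eq_span_p, ← pow_one ((p : ℤ_[p])),
    ← PadicInt.norm_le_pow_iff_mem_span_pow] at hmem
  rw [← Polynomial.map_pow, ← Polynomial.map_expand, ← Polynomial.map_sub, Polynomial.coeff_map]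
  change ‖((_ : ℤ_[p]) : ℚ_[p])‖ ≤ _
  rw [← PadicInt.norm_def]
  simpa only [Nat.cast_one, zpow_neg, zpow_one] using hmem

theorem coeff_pow_eq_coeff_trunc_pow_add {R : Type*} [CommRing R] {F : PowerSeries R}
    (hF : constantCoeff F = 1) {k : ℕ} (hk : 0 < k) (m : ℕ) :
    coeff k (F ^ m) = coeff k ((trunc k F : PowerSeries R) ^ m) + m * coeff k F := by
  set Q : PowerSeries R := ↑(trunc k F) with hQ
  obtain ⟨S, hS⟩ : ∃ S, F - Q = X ^ k * S := by
    rw [← dvd_iff_exists_eq_mul_right, X_pow_dvd_iff]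
    intro i hi
    simp [Q, coeff_trunc, hi]
  have hS0 : constantCoeff S = coeff k F := by
    simpa [Q, coeff_trunc, coeff_X_pow_mul'] using (congrArg (coeff k) hS).symm
  have hQ0 : constantCoeff Q = 1 := by
    rw [← coeff_zero_eq_constantCoeff_apply, hQ, Polynomial.coeff_coe, coeff_trunc, if_pos hk,
      coeff_zero_eq_constantCoeff_apply, hF]
  obtain ⟨z, hz⟩ := Polynomial.powAddExpansion Q (X ^ k * S) m
  have hexp : F ^ m = Q ^ m + X ^ k * ((m : PowerSeries R) * Q ^ (m - 1) * S)
      + X ^ (k + k) * (z * S ^ 2) := by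
    rw [sub_eq_iff_eq_add'.1 hS, hz]
    ring
  rw [hexp, map_add, map_add, coeff_X_pow_mul', if_pos le_rfl, coeff_X_pow_mul',
    if_neg (by omega), Nat.sub_self, coeff_zero_eq_constantCoeff_apply]
  simp [hQ0, hS0]

theorem norm_coeff_mul_sub_coeff_le {K : Type*} [NormedField K] [IsUltrametricDist K]
    {G U : PowerSeries K} {k : ℕ} {r : ℝ} (hr : 0 ≤ r) (hG : ∀ i < k, ‖coeff i G‖ ≤ 1)
    (hU : constantCoeff U = 1) (hUr : ∀ j, j ≠ 0 → ‖coeff j U‖ ≤ r) :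
    ‖coeff k (G * U) - coeff k G‖ ≤ r := by
  rw [coeff_mul, ← Finset.add_sum_erase _ _ (a := (k, 0)) (by simp),
    coeff_zero_eq_constantCoeff_apply, hU, mul_one, add_sub_cancel_left]
  refine IsUltrametricDist.norm_sum_le_of_forall_le_of_nonneg hr ?_
  rintro ⟨i, j⟩ hij
  simp only [Finset.mem_erase, Finset.HasAntidiagonal.mem_antidiagonal, ne_eq,
    Prod.mk.injEq, not_and] at hij
  have hj : j ≠ 0 := fun h0 => hij.1 (by omega) h0
  rw [norm_mul]
  exact (mul_le_mul (hG i (by omega)) (hUr j hj) (norm_nonneg _) zero_le_one).trans_eq (one_mul r)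

/-- **Dwork's lemma** -/
theorem norm_coeff_le_one_of_pow_eq_expand_mul {p : ℕ} [hp : Fact p.Prime] {F U : PowerSeries ℚ_[p]}
    (hF : constantCoeff F = 1) (hU : constantCoeff U = 1)
    (hUp : ∀ j, j ≠ 0 → ‖coeff j U‖ ≤ (p : ℝ)⁻¹)
    (h : F ^ p = expand p hp.out.ne_zero F * U) (k : ℕ) : ‖coeff k F‖ ≤ 1 := by
  induction k using Nat.strong_induction_on with
  | _ k ih =>
  rcases Nat.eq_zero_or_pos k with rfl | hk
  · simp [coeff_zero_eq_constantCoeff_apply, hF]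
  have hQ : ∀ i, ‖(trunc k F).coeff i‖ ≤ 1 := fun i => by
    rw [coeff_trunc]
    split_ifs with hi
    · exact ih i hi
    · simp
  have hexpandQ : (Polynomial.expand _ p (trunc k F)).coeff k
      = coeff k (expand p hp.out.ne_zero F) := by
    rw [Polynomial.coeff_expand hp.out.pos, PowerSeries.coeff_expand, coeff_trunc,
      if_pos (Nat.div_lt_self hk hp.out.one_lt)]
  have hfrobenius := norm_coeff_pow_sub_expand_le hQ k
  rw [Polynomial.coeff_sub, hexpandQ, ← Polynomial.coeff_coe, Polynomial.coe_pow] at hfrobenius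
  have hunit : ‖coeff k (expand p hp.out.ne_zero F * U) - coeff k (expand p hp.out.ne_zero F)‖
      ≤ (p : ℝ)⁻¹ := by
    refine norm_coeff_mul_sub_coeff_le (by positivity) (fun i hi => ?_) hU hUp
    rw [PowerSeries.coeff_expand]
    split_ifs
    · exact ih _ ((Nat.div_le_self _ _).trans_lt hi)
    · simp
  have hpF : ‖(p : ℚ_[p]) * coeff k F‖ ≤ (p : ℝ)⁻¹ := by
    have hsub := norm_sub_le_of_norm_le hunit hfrobenius
    rwa [← h, coeff_pow_eq_coeff_trunc_pow_add hF hk, sub_sub_sub_cancel_right,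
      add_sub_cancel_left] at hsub
  rw [norm_mul, Padic.norm_p] at hpF
  exact (mul_le_iff_le_one_right (inv_pos.2 (by exact_mod_cast hp.out.pos))).1 hpF

end DworkLemma

theorem norm_pow_div_factorial_le {p : ℕ} [hp : Fact p.Prime] {j : ℕ} (hj : j ≠ 0) :
    ‖(p : ℚ_[p]) ^ j / (j.factorial : ℚ_[p])‖ ≤ (p : ℝ)⁻¹ := by
  have hp1 : (1 : ℝ) < p := by exact_mod_cast hp.out.one_lt
  have hv : padicValNat p j.factorial + 1 ≤ j := by
    have hlt := sub_one_mul_padicValNat_factorial_lt_of_ne_zero p hj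
    have hle : padicValNat p j.factorial ≤ (p - 1) * padicValNat p j.factorial :=
      Nat.le_mul_of_pos_left _ (Nat.sub_pos_of_lt hp.out.one_lt)
    omega
  have hf : ‖(j.factorial : ℚ_[p])‖ = (p : ℝ) ^ (-(padicValNat p j.factorial : ℤ)) := by
    rw [Padic.norm_eq_zpow_neg_valuation (by exact_mod_cast j.factorial_ne_zero),
      Padic.valuation_natCast]
  rw [norm_div, norm_pow, Padic.norm_p, hf, zpow_neg, zpow_natCast, div_inv_eq_mul, inv_pow,
    inv_mul_le_iff₀ (by positivity), ← div_eq_mul_inv, le_div_iff₀ (by positivity), ← pow_succ]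
  exact pow_le_pow_right₀ hp1.le hv

section ArtinHasse

open PowerSeries

theorem eq_of_derivative_eq_mul {k : Type*} [Field k] [CharZero k] {F H A : PowerSeries k}
    (hF : derivative k F = A * F) (hH : derivative k H = A * H)
    (hF0 : constantCoeff F = 1) (hH0 : constantCoeff H = 1) : F = H := by
  have hHi : H * H⁻¹ = 1 := PowerSeries.mul_inv_cancel _ (by simp [hH0])
  have hquot : F * H⁻¹ = 1 := by
    refine derivative.ext ?_ (by simp [hF0, hH0])
    rw [Derivation.leibniz, derivative_inv', hF, hH, derivative_one, smul_eq_mul, smul_eq_mul]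
    linear_combination (-F * A * H⁻¹) * hHi
  linear_combination H * hquot - F * hHi

theorem derivative_expand {p : ℕ} (hp : p ≠ 0) (f : PowerSeries ℚ) :
    derivative ℚ (expand p hp f)
      = expand p hp (derivative ℚ f) * derivative ℚ (X ^ p : PowerSeries ℚ) := by
  rw [expand_apply, expand_apply, derivative_subst (HasSubst.X_pow hp)]

theorem coeff_logAH (p m : ℕ) [Decidable (∃ k : ℕ, m = p ^ k)] :
    coeff m (logAH p) = if ∃ k : ℕ, m = p ^ k then 1 / (m : ℚ) else 0 := by
  rw [logAH, coeff_mk]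
  congr

theorem constantCoeff_logAH (p : ℕ) : constantCoeff (logAH p) = 0 := by
  classical
  rw [← coeff_zero_eq_constantCoeff_apply, coeff_logAH]
  split_ifs <;> simp

theorem hasSubst_logAH (p : ℕ) : HasSubst (logAH p) :=
  HasSubst.of_constantCoeff_zero' (constantCoeff_logAH p)

theorem constantCoeff_artinHasse (p : ℕ) : constantCoeff (artinHasse p) = 1 := by
  have hsub := PowerSeries.constantCoeff_subst_eq_zero (R := ℚ) (constantCoeff_logAH p)
    (exp ℚ - 1) (by simp)
  rw [subst_sub (hasSubst_logAH p), ← coe_substAlgHom (hasSubst_logAH p), map_one, map_sub,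
    coe_substAlgHom, sub_eq_zero] at hsub
  exact hsub.trans (map_one _)

theorem derivative_artinHasse (p : ℕ) :
    derivative ℚ (artinHasse p) = derivative ℚ (logAH p) * artinHasse p := by
  rw [artinHasse, derivative_subst (hasSubst_logAH p), derivative_exp, mul_comm]

theorem exists_mul_eq_pow_iff {p : ℕ} (hp : 0 < p) {l : ℕ} (hl : p * l ≠ 1) :
    (∃ k, p * l = p ^ k) ↔ ∃ k, l = p ^ k := by
  constructor
  · rintro ⟨_ | k, hk⟩
    · exact absurd hk hl
    · exact ⟨k, Nat.eq_of_mul_eq_mul_left hp (by rw [hk, pow_succ'])⟩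
  · rintro ⟨k, rfl⟩
    exact ⟨k + 1, by rw [pow_succ']⟩

theorem natCast_mul_logAH {p : ℕ} (hp : p.Prime) :
    (p : PowerSeries ℚ) * logAH p = (p : PowerSeries ℚ) * X + expand p hp.ne_zero (logAH p) := by
  classical
  have hp0 : (p : ℚ) ≠ 0 := by exact_mod_cast hp.ne_zero
  ext m
  rw [map_add, PowerSeries.coeff_expand, ← map_natCast (C (R := ℚ)), coeff_C_mul, coeff_C_mul,
    coeff_X, coeff_logAH, coeff_logAH]
  rcases eq_or_ne m 1 with rfl | h1
  · rw [if_pos ⟨0, by simp⟩, if_neg (Nat.dvd_one.not.2 hp.ne_one)]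
    simp
  rw [if_neg h1, mul_zero, zero_add]
  by_cases hd : p ∣ m
  · obtain ⟨l, rfl⟩ := hd
    rw [if_pos (dvd_mul_right _ _), Nat.mul_div_cancel_left _ hp.pos]
    simp only [exists_mul_eq_pow_iff hp.pos h1]
    split_ifs
    · push_cast
      field_simp
    · simp
  · rw [if_neg hd, if_neg, mul_zero]
    rintro ⟨_ | k, rfl⟩
    · exact h1 rfl
    · exact hd (dvd_pow_self _ k.succ_ne_zero)

theorem artinHasse_pow {p : ℕ} (hp : p.Prime) :
    artinHasse p ^ p = expand p hp.ne_zero (artinHasse p) * rescale (p : ℚ) (exp ℚ) := by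
  have hderivExp : derivative ℚ (rescale (p : ℚ) (exp ℚ)) = p * rescale (p : ℚ) (exp ℚ) := by
    rw [← exp_pow_eq_rescale_exp, derivative_pow, derivative_exp, mul_assoc, ← pow_succ,
      Nat.sub_add_cancel hp.one_le]
  have hderivLog := congrArg (derivative ℚ) (natCast_mul_logAH hp)
  have hderivP : derivative ℚ (p : PowerSeries ℚ) = 0 := by
    rw [← map_natCast (C (R := ℚ)), derivative_C]
  rw [map_add, Derivation.leibniz, Derivation.leibniz, derivative_expand, hderivP, derivative_X]
    at hderivLog
  simp only [smul_eq_mul, mul_zero, add_zero, mul_one] at hderivLog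
  refine eq_of_derivative_eq_mul (A := p * derivative ℚ (logAH p)) ?_ ?_ ?_ ?_
  · rw [derivative_pow, derivative_artinHasse p]
    linear_combination (p * derivative ℚ (logAH p)) *
      pow_sub_one_mul hp.ne_zero (artinHasse p)
  · rw [Derivation.leibniz, derivative_expand, hderivExp, derivative_artinHasse p, map_mul,
      hderivLog]
    simp only [smul_eq_mul]
    ring
  · simp [constantCoeff_artinHasse p]
  · rw [map_mul, constantCoeff_expand, constantCoeff_artinHasse p,
      ← coeff_zero_eq_constantCoeff_apply, coeff_rescale]
    simp

theorem norm_coeff_artinHasse_le {p : ℕ} [hp : Fact p.Prime] (k : ℕ) :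
    ‖((coeff k (artinHasse p) : ℚ) : ℚ_[p])‖ ≤ 1 := by
  let ι : ℚ →+* ℚ_[p] := Rat.castHom _
  have hpow := congrArg (PowerSeries.map ι) (artinHasse_pow hp.out)
  rw [map_pow, map_mul, map_expand] at hpow
  have hcoeff := norm_coeff_le_one_of_pow_eq_expand_mul ?_ ?_ ?_ hpow k
  · simpa [ι] using hcoeff
  · rw [← coeff_zero_eq_constantCoeff_apply, coeff_map, coeff_zero_eq_constantCoeff_apply,
      constantCoeff_artinHasse p, map_one]
  · rw [← coeff_zero_eq_constantCoeff_apply, coeff_map, coeff_rescale]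
    simp
  · intro j hj
    rw [coeff_map, coeff_rescale, coeff_exp]
    simpa [ι, div_eq_mul_inv] using norm_pow_div_factorial_le (p := p) hj

theorem coeff_artinHasse_of_lt {p k : ℕ} (hk : k < p) :
    coeff k (artinHasse p) = 1 / (k.factorial : ℚ) := by
  classical
  induction k with
  | zero => simp [coeff_zero_eq_constantCoeff_apply, constantCoeff_artinHasse p]
  | succ k ih =>
    have hderiv := congrArg (coeff k) (derivative_artinHasse p)
    rw [coeff_derivative, coeff_mul, Finset.sum_eq_single (0, k)] at hderiv
    · rw [coeff_derivative, zero_add, coeff_logAH, if_pos ⟨0, by simp⟩, ih (by omega)] at hderiv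
      rw [eq_div_of_mul_eq (by positivity) hderiv, Nat.factorial_succ]
      push_cast
      field_simp
      simp
    · rintro ⟨i, j⟩ hij hne
      rw [Finset.HasAntidiagonal.mem_antidiagonal] at hij
      have hi : i ≠ 0 := by
        rintro rfl
        exact hne (by simpa using hij)
      rw [coeff_derivative, coeff_logAH, if_neg, zero_mul, zero_mul]
      rintro ⟨_ | l, hl⟩
      · exact hi (by simpa using hl)
      · have : p ≤ p ^ (l + 1) := Nat.le_self_pow l.succ_ne_zero p
        omega
    · simp

end ArtinHasse

/-! ### The weight function -/

section Weight

variable {n : ℕ} {u : ℤ × ℤ}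

theorem nwt_eq_max (n : ℕ) (u : ℤ × ℤ) :
    nwt n u = max (u.1 + n * u.2) (max (n * u.2 - 2 * n * u.1) (u.1 - (n + 1) * u.2)) := by
  have hn : (0 : ℤ) ≤ 2 * n + 1 := by positivity
  rw [nwt, mul_max_of_nonneg _ _ hn, mul_max_of_nonneg _ _ hn, ← max_add_add_left,
    ← max_add_add_left]
  ring_nf

theorem nwt_nonneg (n : ℕ) (u : ℤ × ℤ) : 0 ≤ nwt n u := by
  rw [nwt_eq_max]
  by_contra! h
  obtain ⟨h₁, h₂, h₃⟩ : _ ∧ _ ∧ _ := by simpa only [max_lt_iff] using h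
  -- The three linear forms satisfy `n L₁ + L₂ + n L₃ = 0`.
  nlinarith

/-- The weight `n ω(u)` as a natural number. -/
def wt (n : ℕ) (u : ℤ × ℤ) : ℕ := (nwt n u).toNat

theorem coe_wt (n : ℕ) (u : ℤ × ℤ) : (wt n u : ℤ) = nwt n u := Int.toNat_of_nonneg (nwt_nonneg n u)

theorem wt_le_iff {m : ℕ} : wt n u ≤ m ↔ u.1 + n * u.2 ≤ m ∧
    n * u.2 - 2 * n * u.1 ≤ m ∧ u.1 - (n + 1) * u.2 ≤ m := by
  rw [← Int.ofNat_le, coe_wt, nwt_eq_max, max_le_iff, max_le_iff]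

theorem le_wt (n : ℕ) (u : ℤ × ℤ) : u.1 + n * u.2 ≤ wt n u ∧ n * u.2 - 2 * n * u.1 ≤ wt n u ∧
    u.1 - (n + 1) * u.2 ≤ wt n u := wt_le_iff.1 le_rfl

theorem wt_of_nonneg (h1 : 0 ≤ u.1) (h2 : 0 ≤ u.2) : (wt n u : ℤ) = u.1 + n * u.2 := by
  rw [coe_wt, nwt, max_eq_left (max_le (by linarith) (by linarith))]
  ring

theorem wt_of_fst_nonpos (h1 : u.1 ≤ 0) (h2 : u.1 ≤ u.2) :
    (wt n u : ℤ) = n * u.2 - 2 * n * u.1 := by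
  rw [coe_wt, nwt, max_eq_left (a := -u.1) (by linarith), max_eq_right (by linarith)]
  ring

theorem wt_of_snd_nonpos (h1 : u.2 ≤ 0) (h2 : u.2 ≤ u.1) :
    (wt n u : ℤ) = u.1 - (n + 1) * u.2 := by
  rw [coe_wt, nwt, max_eq_right (a := -u.1) (by linarith), max_eq_right (by linarith)]
  ring

theorem wt_cases (n : ℕ) (u : ℤ × ℤ) :
    ((wt n u : ℤ) = u.1 + n * u.2 ∧ 0 ≤ u.1 ∧ 0 ≤ u.2) ∨
    ((wt n u : ℤ) = n * u.2 - 2 * n * u.1 ∧ u.1 ≤ 0 ∧ u.1 ≤ u.2) ∨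
    ((wt n u : ℤ) = u.1 - (n + 1) * u.2 ∧ u.2 ≤ 0 ∧ u.2 ≤ u.1) := by
  obtain ⟨h1, h2⟩ | ⟨h1, h2⟩ | ⟨h1, h2⟩ :
      (0 ≤ u.1 ∧ 0 ≤ u.2) ∨ (u.1 ≤ 0 ∧ u.1 ≤ u.2) ∨ (u.2 ≤ 0 ∧ u.2 ≤ u.1) := by omega
  · exact .inl ⟨wt_of_nonneg h1 h2, h1, h2⟩
  · exact .inr (.inl ⟨wt_of_fst_nonpos h1 h2, h1, h2⟩)
  · exact .inr (.inr ⟨wt_of_snd_nonpos h1 h2, h1, h2⟩)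

theorem wt_add_le (n : ℕ) (u v : ℤ × ℤ) : wt n (u + v) ≤ wt n u + wt n v := by
  obtain ⟨hu₁, hu₂, hu₃⟩ := le_wt n u
  obtain ⟨hv₁, hv₂, hv₃⟩ := le_wt n v
  rw [wt_le_iff, Prod.fst_add, Prod.snd_add]
  push_cast
  exact ⟨by linarith, by linarith, by linarith⟩

theorem wt_nsmul (n m : ℕ) (u : ℤ × ℤ) : wt n (m • u) = m * wt n u := by
  have hm : (0 : ℤ) ≤ m := by positivity
  rw [← Int.natCast_inj, Nat.cast_mul, coe_wt, coe_wt, nwt_eq_max, nwt_eq_max,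
    mul_max_of_nonneg _ _ hm, mul_max_of_nonneg _ _ hm]
  rw [Prod.smul_fst, Prod.smul_snd, nsmul_eq_mul, nsmul_eq_mul]
  ring_nf

theorem abs_le_wt (hn : 1 ≤ n) (u : ℤ × ℤ) : |u.1| ≤ wt n u ∧ |u.2| ≤ wt n u := by
  have hn' : (1 : ℤ) ≤ n := by exact_mod_cast hn
  rw [abs_le, abs_le]
  rcases wt_cases n u with ⟨h, h1, h2⟩ | ⟨h, h1, h2⟩ | ⟨h, h1, h2⟩ <;> rw [h] <;>
    exact ⟨⟨by nlinarith [hn'], by nlinarith [hn']⟩, by nlinarith [hn'], by nlinarith [hn']⟩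

theorem finite_wt_le (hn : 1 ≤ n) (N : ℕ) : {u | wt n u ≤ N}.Finite := by
  refine (Set.finite_Icc (-(N : ℤ), -(N : ℤ)) (N, N)).subset fun u hu => ?_
  obtain ⟨h1, h2⟩ := abs_le_wt hn u
  have hu' : (wt n u : ℤ) ≤ N := by exact_mod_cast hu
  rw [abs_le] at h1 h2
  exact ⟨⟨by linarith, by linarith⟩, by simp only; linarith, by simp only; linarith⟩

theorem tendsto_wt (hn : 1 ≤ n) : Tendsto (wt n) cofinite atTop :=
  tendsto_atTop.2 fun N => eventually_cofinite.2 <|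
    (finite_wt_le hn N).subset fun _ hu => (not_le.1 hu).le

theorem tendsto_pow_wt (hn : 1 ≤ n) {r : ℝ} (h0 : 0 ≤ r) (h1 : r < 1) :
    Tendsto (fun u => r ^ wt n u) cofinite (𝓝 0) :=
  (tendsto_pow_atTop_nhds_zero_of_lt_one h0 h1).comp (tendsto_wt hn)

theorem wt_add_le_wt_add_line (hu : 0 ≤ u.2) (l : ℕ) :
    wt n u + n ≤ wt n (u + (0, 1) + l • (1, 2)) := by
  obtain ⟨h1, h2, h3⟩ := le_wt n (u + (0, 1) + l • (1, 2))
  generalize wt n (u + (0, 1) + l • (1, 2)) = W at *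
  simp only [Prod.smul_mk, Prod.fst_add, Prod.snd_add, nsmul_eq_mul] at h1 h2 h3
  have hnl : (0 : ℤ) ≤ n * l := by positivity
  zify
  rcases wt_cases n u with ⟨h, h4, h5⟩ | ⟨h, h4, h5⟩ | ⟨h, h4, h5⟩ <;> nlinarith [h4, h5]

theorem wt_add_le_wt_sub_line (hu : u.2 ≤ 0) (l : ℕ) :
    wt n u + n ≤ wt n (u + (0, 1) - (l + 1) • (1, 2)) := by
  obtain ⟨h1, h2, h3⟩ := le_wt n (u + (0, 1) - (l + 1) • (1, 2))
  generalize wt n (u + (0, 1) - (l + 1) • (1, 2)) = W at *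
  simp only [Prod.smul_mk, Prod.fst_add, Prod.snd_add, Prod.fst_sub, Prod.snd_sub,
    nsmul_eq_mul, Nat.cast_add, Nat.cast_one] at h1 h2 h3
  have hnl : (0 : ℤ) ≤ n * l := by positivity
  zify
  rcases wt_cases n u with ⟨h, h4, h5⟩ | ⟨h, h4, h5⟩ | ⟨h, h4, h5⟩ <;> nlinarith [h4, h5]

end Weight

theorem wt_eps (n i : ℕ) : wt n (eps n i) = i := by
  rw [← Int.natCast_inj, eps]
  split_ifs with h
  · rw [wt_of_nonneg (by simp) (by simp)]
    simp
  · rw [wt_of_nonneg (by simp only; omega) (by simp)]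
    simp

theorem eps_injective (n : ℕ) : Function.Injective (eps n) :=
  (Function.LeftInverse.injective (g := wt n)) (wt_eps n)

theorem eps_fst_nonneg (n i : ℕ) : 0 ≤ (eps n i).1 := by
  unfold eps
  split_ifs with h <;> simp only <;> omega

theorem eps_snd_nonneg (n i : ℕ) : 0 ≤ (eps n i).2 := by
  unfold eps
  split_ifs with h <;> simp

theorem eps_fst_add (n i : ℕ) : (eps n i).1 + n * (eps n i).2 = i := by
  rw [← wt_of_nonneg (eps_fst_nonneg n i) (eps_snd_nonneg n i), wt_eps]

/-- The vertices `(n,0)`, `(0,1)`, `(-1,-1)` of the Newton triangle of `x^n + y + t/(xy)`. -/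
def vertex (n : ℕ) : Fin 3 → ℤ × ℤ := ![((n : ℤ), 0), (0, 1), (-1, -1)]

theorem wt_vertex (n : ℕ) (k : Fin 3) : wt n (vertex n k) = n := by
  rw [← Int.natCast_inj]
  fin_cases k
  · exact (wt_of_nonneg (by simp [vertex]) (by simp [vertex])).trans (by simp [vertex])
  · exact (wt_of_nonneg (by simp [vertex]) (by simp [vertex])).trans (by simp [vertex])
  · exact (wt_of_fst_nonpos (by simp [vertex]) (by simp [vertex])).trans (by simp [vertex]; ring)

theorem wt_le_wt_sub_nsmul_vertex_add (n m : ℕ) (k : Fin 3) (u : ℤ × ℤ) :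
    wt n u ≤ wt n (u - m • vertex n k) + n * m := by
  calc wt n u = wt n ((u - m • vertex n k) + m • vertex n k) := by rw [sub_add_cancel]
    _ ≤ wt n (u - m • vertex n k) + wt n (m • vertex n k) := wt_add_le n _ _
    _ = wt n (u - m • vertex n k) + n * m := by rw [wt_nsmul, wt_vertex, mul_comm]

/-! ### Reduction of monomials modulo the leading parts -/

section VertexDiff

variable {K : Type*} [NormedField K]

/-- The coefficients `n`, `1`, `t` of the terms `x^n`, `y`, `1/(xy)` in the symbols of the
differential operators. -/
def vertexCoeff (n : ℕ) (t : K) : Fin 3 → K := ![(n : K), 1, t]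

/-- Multiplication by `g (κ_k x^(m d_k) - t / (xy)^m)`, where `κ_k` and `d_k` are the coefficient
and the exponent vector belonging to the `k`-th vertex. For `k = 0`, `1` these are the terms of
`D_x` and `D_y`. -/
def vertexDiff (n : ℕ) (g t : K) (m : ℕ) (k : Fin 3) : (ℤ × ℤ → K) →ₗ[K] (ℤ × ℤ → K) where
  toFun η u := g * (vertexCoeff n t k * η (u - m • vertex n k) - t * η (u - m • vertex n 2))
  map_add' η η' := by
    funext u
    simp only [Pi.add_apply]
    ring
  map_smul' c η := by
    funext u
    simp only [Pi.smul_apply, smul_eq_mul, RingHom.id_apply]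
    ring

/-- The leading parts `γ (n x^n - t/(xy))` and `γ (y - t/(xy))` of `D_x` and `D_y`, as
multiplication operators. -/
abbrev lead (n : ℕ) (g t : K) (k : Fin 2) : (ℤ × ℤ → K) →ₗ[K] (ℤ × ℤ → K) :=
  vertexDiff n g t 1 k.castSucc

theorem vertexDiff_apply (n : ℕ) (g t : K) (m : ℕ) (k : Fin 3) (η : ℤ × ℤ → K) (u : ℤ × ℤ) :
    vertexDiff n g t m k η u
      = g * (vertexCoeff n t k * η (u - m • vertex n k) - t * η (u - m • vertex n 2)) := rfl

theorem lead_apply (n : ℕ) (g t : K) (k : Fin 2) (η : ℤ × ℤ → K) (u : ℤ × ℤ) :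
    lead n g t k η u = g * (vertexCoeff n t k.castSucc * η (u - vertex n k.castSucc)
      - t * η (u - vertex n 2)) := by
  rw [vertexDiff_apply, one_smul, one_smul]

theorem vertexDiff_comm (n : ℕ) (g g' t t' : K) (m m' : ℕ) (k k' : Fin 3) (η : ℤ × ℤ → K) :
    vertexDiff n g t m k (vertexDiff n g' t' m' k' η)
      = vertexDiff n g' t' m' k' (vertexDiff n g t m k η) := by
  funext u
  simp only [vertexDiff_apply, sub_right_comm u (m' • vertex n _) (m • vertex n _)]
  ring

theorem vertexDiff_single (n : ℕ) (g t : K) (m : ℕ) (k : Fin 3) (v : ℤ × ℤ) :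
    vertexDiff n g t m k (Pi.single v 1) = g • (vertexCoeff n t k •
      Pi.single (v + m • vertex n k) (1 : K) - t • Pi.single (v + m • vertex n 2) (1 : K)) := by
  funext u
  simp only [vertexDiff_apply, Pi.single_apply, Pi.sub_apply, Pi.smul_apply, smul_eq_mul,
    sub_eq_iff_eq_add]

theorem hasSum_vertexDiff {ι : Type*} {F : ι → ℤ × ℤ → K} {S : ℤ × ℤ → K}
    (hS : ∀ u, HasSum (fun i => F i u) (S u)) (n : ℕ) (g t : K) (m : ℕ) (k : Fin 3) (u : ℤ × ℤ) :
    HasSum (fun i => vertexDiff n g t m k (F i) u) (vertexDiff n g t m k S u) :=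
  (((hS _).mul_left _).sub ((hS _).mul_left _)).mul_left g

theorem exists_vertexCoeff_smul_single_sub_eq_sum_lead (n : ℕ) {g : K} (hg : g ≠ 0) (t : K)
    (v : ℤ × ℤ) (i k : Fin 3) : ∃ a : Fin 2 → K, (∀ l, ‖a l‖ ≤ 1) ∧
      vertexCoeff n t i • Pi.single (v + vertex n i) (1 : K)
        - vertexCoeff n t k • Pi.single (v + vertex n k) (1 : K)
        = ∑ l, (g⁻¹ * a l) • lead n g t l (Pi.single v 1) := by
  have hsymbol : ∀ i : Fin 3, ∑ l : Fin 2, (g⁻¹ * if l.castSucc = i then 1 else 0) •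
      lead n g t l (Pi.single v 1) = vertexCoeff n t i • Pi.single (v + vertex n i) (1 : K)
        - t • Pi.single (v + vertex n 2) (1 : K) := by
    intro i
    simp only [vertexDiff_single, one_smul, smul_smul]
    fin_cases i <;> simp [Fin.sum_univ_two, hg, vertexCoeff]
  refine ⟨fun l => (if l.castSucc = i then 1 else 0) - if l.castSucc = k then 1 else 0,
    fun l => ?_, ?_⟩
  · dsimp only
    split_ifs <;> simp
  · simp only [mul_sub, sub_smul, Finset.sum_sub_distrib, hsymbol, sub_sub_sub_cancel_right]

end VertexDiff

/-- The hypotheses on the constants that enter the leading parts of the operators. -/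
structure LeadingData {K : Type*} [NormedField K] (n : ℕ) (γt t : K) : Prop where
  two_le : 2 ≤ n
  norm_pos : 0 < ‖γt‖
  norm_lt_one : ‖γt‖ < 1
  norm_natCast : ‖(n : K)‖ = 1
  norm_t : ‖t‖ = 1

namespace LeadingData

variable {K : Type*} [NormedField K] {n : ℕ} {γt t : K}

theorem gt_ne_zero (h : LeadingData n γt t) : γt ≠ 0 := norm_pos_iff.1 h.norm_pos

theorem norm_vertexCoeff (h : LeadingData n γt t) (k : Fin 3) : ‖vertexCoeff n t k‖ = 1 := by
  fin_cases k
  · exact h.norm_natCast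
  · exact norm_one
  · exact h.norm_t

theorem vertexCoeff_ne_zero (h : LeadingData n γt t) (k : Fin 3) : vertexCoeff n t k ≠ 0 :=
  norm_pos_iff.1 (by rw [h.norm_vertexCoeff]; exact one_pos)

theorem t_ne_zero (h : LeadingData n γt t) : t ≠ 0 := h.vertexCoeff_ne_zero 2

end LeadingData

/-- A measure of how far `w` lies outside the open first quadrant. It orders monomials of equal
weight in the reduction modulo the leading parts. -/
def quadrantDefect (w : ℤ × ℤ) : ℕ := (1 - min w.1 w.2).toNat + (1 - w.1).toNat

/-- `w'` is smaller than `w` in the lexicographic order by weight and `quadrantDefect`. -/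
def ReductionLT (n : ℕ) (w' w : ℤ × ℤ) : Prop :=
  toLex (wt n w', quadrantDefect w') < toLex (wt n w, quadrantDefect w)

theorem wellFounded_reductionLT (n : ℕ) : WellFounded (ReductionLT n) :=
  InvImage.wf (fun w => toLex (wt n w, quadrantDefect w)) wellFounded_lt

theorem reductionLT_iff {n : ℕ} {w' w : ℤ × ℤ} : ReductionLT n w' w ↔
    wt n w' < wt n w ∨ wt n w' = wt n w ∧ quadrantDefect w' < quadrantDefect w :=
  Prod.Lex.toLex_lt_toLex

theorem ReductionLT.wt_le {n : ℕ} {w' w : ℤ × ℤ} (h : ReductionLT n w' w) : wt n w' ≤ wt n w :=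
  (reductionLT_iff.1 h).elim le_of_lt fun h => h.1.le

theorem exists_vertex_exchange_of_nonneg {n : ℕ} (hn : 2 ≤ n) {w : ℤ × ℤ} (h1 : 0 ≤ w.1)
    (h2 : 0 ≤ w.2) : (∃ j ≤ 2 * n, w = eps n j) ∨
      ∃ v i k, w = v + vertex n i ∧ wt n v + n ≤ wt n w ∧ ReductionLT n (v + vertex n k) w := by
  obtain ⟨a, b⟩ := w
  simp only at h1 h2
  have hwt : ∀ x y : ℤ, 0 ≤ x → 0 ≤ y → (wt n (x, y) : ℤ) = x + n * y :=
    fun x y => wt_of_nonneg (u := (x, y))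
  have hw := hwt a b h1 h2
  simp only [reductionLT_iff, quadrantDefect]
  obtain ⟨rfl, han⟩ | ⟨rfl, han⟩ | ⟨rfl, ha, han⟩ | ⟨rfl, han⟩ | ⟨rfl, hb⟩ | ⟨ha, hb⟩ :
      (b = 0 ∧ a ≤ n) ∨ (b = 0 ∧ n < a) ∨ (b = 1 ∧ 1 ≤ a ∧ a ≤ n) ∨ (b = 1 ∧ n < a) ∨
        (a = 0 ∧ 1 ≤ b) ∨ (1 ≤ a ∧ 2 ≤ b) := by omega
  · refine .inl ⟨a.toNat, by omega, ?_⟩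
    rw [eps, if_pos (by omega), Int.toNat_of_nonneg h1]
  · have hv := hwt (a - n) 0 (by omega) le_rfl
    have hw' := hwt (a - n) 1 (by omega) zero_le_one
    refine .inr ⟨(a - n, 0), 0, 1, by simp [vertex], by lia, ?_⟩
    simp only [vertex, Matrix.cons_val, Prod.mk_add_mk, add_zero, zero_add]
    lia
  · refine .inl ⟨n + a.toNat, by omega, ?_⟩
    rw [eps, if_neg (by omega), Nat.cast_add, Int.toNat_of_nonneg h1, add_sub_cancel_left]
  · have hv := hwt (a - n) 1 (by omega) zero_le_one
    have hw' := hwt (a - n - 1) 0 (by omega) le_rfl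
    refine .inr ⟨(a - n, 1), 0, 2, by simp [vertex], by lia, ?_⟩
    simp only [vertex, Matrix.cons_val, Prod.mk_add_mk, ← sub_eq_add_neg, sub_self]
    lia
  · have hv := hwt 0 (b - 1) le_rfl (by omega)
    have hw' := hwt n (b - 1) (by omega) (by omega)
    refine .inr ⟨(0, b - 1), 1, 0, by simp [vertex], by lia, ?_⟩
    simp only [vertex, Matrix.cons_val, Prod.mk_add_mk, add_zero, zero_add]
    lia
  · have hv := hwt a (b - 1) h1 (by omega)
    have hw' := hwt (a - 1) (b - 1 - 1) (by omega) (by omega)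
    refine .inr ⟨(a, b - 1), 1, 2, by simp [vertex], by lia, ?_⟩
    simp only [vertex, Matrix.cons_val, Prod.mk_add_mk, ← sub_eq_add_neg]
    lia

theorem exists_vertex_exchange {n : ℕ} (hn : 2 ≤ n) (w : ℤ × ℤ) :
    (∃ j ≤ 2 * n, w = eps n j) ∨
      ∃ v i k, w = v + vertex n i ∧ wt n v + n ≤ wt n w ∧ ReductionLT n (v + vertex n k) w := by
  obtain ⟨h1, h2⟩ | ⟨h1, h2⟩ | ⟨h1, h2⟩ :
      (0 ≤ w.1 ∧ 0 ≤ w.2) ∨ (w.1 < 0 ∧ w.1 ≤ w.2) ∨ (w.2 < 0 ∧ w.2 ≤ w.1) := by omega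
  · exact exists_vertex_exchange_of_nonneg hn h1 h2
  all_goals
    right
    obtain ⟨a, b⟩ := w
    simp only at h1 h2
    simp only [reductionLT_iff, quadrantDefect]
  · have hw := wt_of_fst_nonpos (n := n) (u := (a, b)) h1.le h2
    have hv := wt_of_fst_nonpos (n := n) (u := (a + 1, b + 1)) (by simp only; omega) (by simpa)
    have hw' := wt_of_fst_nonpos (n := n) (u := (a + 1, b + 1 + 1)) (by simp only; omega)
      (by simp only; omega)
    refine ⟨(a + 1, b + 1), 2, 1, by simp [vertex], by lia, .inr ?_⟩
    simp only [vertex, Matrix.cons_val, Prod.mk_add_mk, add_zero]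
    lia
  · have hw := wt_of_snd_nonpos (n := n) (u := (a, b)) h1.le h2
    have hv := wt_of_snd_nonpos (n := n) (u := (a + 1, b + 1)) (by simp only; omega) (by simpa)
    have hw' := wt_of_snd_nonpos (n := n) (u := (a + 1 + n, b + 1)) (by simp only; omega)
      (by simp only; omega)
    refine ⟨(a + 1, b + 1), 2, 0, by simp [vertex], by lia, .inr ?_⟩
    simp only [vertex, Matrix.cons_val, Prod.mk_add_mk, add_zero]
    lia

section ReducesTo

variable {K : Type*} [NormedField K]

/-- The monomial with exponent `w` is, modulo the leading parts of the operators, a multiple of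
the basis monomial `ε_j`, and the cofactors `H` have weight at most `wt w - n`. -/
structure ReducesTo (n : ℕ) (γt t : K) (w : ℤ × ℤ) (j : ℕ) (c : K) (H : Fin 2 → ℤ × ℤ → K) :
    Prop where
  index_le : j ≤ 2 * n
  index_le_wt : j ≤ wt n w
  norm_coeff_le : ‖c‖ ≤ 1
  single_eq : Pi.single w 1
    = c • Pi.single (eps n j) (1 : K) + ∑ l, lead n (γt ^ n) t l (H l)
  wt_cofactor_add_le : ∀ l u, H l u ≠ 0 → wt n u + n ≤ wt n w
  norm_cofactor_le : ∀ l u, ‖H l u‖ * ‖γt‖ ^ n ≤ 1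

theorem reducesTo_eps {n j : ℕ} (γt t : K) (hj : j ≤ 2 * n) : ReducesTo n γt t (eps n j) j 1 0 where
  index_le := hj
  index_le_wt := (wt_eps n j).ge
  norm_coeff_le := norm_one.le
  single_eq := by simp
  wt_cofactor_add_le := by simp
  norm_cofactor_le := by simp

variable [IsUltrametricDist K] {n : ℕ} {γt t : K}

theorem ReducesTo.of_eq_add {w w' v : ℤ × ℤ} {j : ℕ} {c c' : K} {H : Fin 2 → ℤ × ℤ → K}
    (h : ReducesTo n γt t w' j c H) (hw : wt n w' ≤ wt n w) (hv : wt n v + n ≤ wt n w)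
    (hc' : ‖c'‖ ≤ 1) {b : Fin 2 → K} (hb : ∀ l, ‖b l‖ * ‖γt‖ ^ n ≤ 1)
    (heq : Pi.single w 1 = c' • Pi.single w' (1 : K)
      + ∑ l, b l • lead n (γt ^ n) t l (Pi.single v 1)) :
    ReducesTo n γt t w j (c' * c) fun l => c' • H l + b l • Pi.single v 1 where
  index_le := h.index_le
  index_le_wt := h.index_le_wt.trans hw
  norm_coeff_le := by
    rw [norm_mul]
    exact mul_le_one₀ hc' (norm_nonneg _) h.norm_coeff_le
  single_eq := by
    simp only [heq, h.single_eq, map_add, map_smul, Finset.sum_add_distrib, smul_add,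
      Finset.smul_sum, mul_smul, add_assoc]
  wt_cofactor_add_le l u hu := by
    rcases eq_or_ne u v with rfl | huv
    · exact hv
    · refine (h.wt_cofactor_add_le l u fun h0 => hu ?_).trans hw
      simp [h0, huv]
  norm_cofactor_le l u := by
    rw [← norm_pow, ← norm_mul, Pi.add_apply, add_mul]
    refine norm_add_le_of_norm_le ?_ ?_
    · rw [Pi.smul_apply, smul_eq_mul, mul_assoc, norm_mul, norm_mul, norm_pow]
      exact mul_le_one₀ hc' (by positivity) (h.norm_cofactor_le l u)
    · rw [Pi.smul_apply, smul_eq_mul, Pi.single_apply]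
      split_ifs
      · rw [mul_one, norm_mul, norm_pow]
        exact hb l
      · simp

theorem ReducesTo.exists_of_exchange (hd : LeadingData n γt t) {v : ℤ × ℤ} {i k : Fin 3} {j : ℕ}
    {c : K} {H : Fin 2 → ℤ × ℤ → K} (h : ReducesTo n γt t (v + vertex n k) j c H)
    (hw : wt n (v + vertex n k) ≤ wt n (v + vertex n i))
    (hv : wt n v + n ≤ wt n (v + vertex n i)) :
    ∃ c' H', ReducesTo n γt t (v + vertex n i) j c' H' := by
  have hg : γt ^ n ≠ 0 := pow_ne_zero n hd.gt_ne_zero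
  obtain ⟨a, ha, hexchange⟩ := exists_vertexCoeff_smul_single_sub_eq_sum_lead n hg t v i k
  refine ⟨_, _, h.of_eq_add hw hv (c' := (vertexCoeff n t i)⁻¹ * vertexCoeff n t k)
    (b := fun l => (vertexCoeff n t i)⁻¹ * ((γt ^ n)⁻¹ * a l)) ?_ (fun l => ?_) ?_⟩
  · rw [norm_mul, norm_inv, hd.norm_vertexCoeff, hd.norm_vertexCoeff, inv_one, one_mul]
  · rw [norm_mul, norm_inv, hd.norm_vertexCoeff, inv_one, one_mul, norm_mul, norm_inv,
      mul_right_comm, norm_pow, inv_mul_cancel₀ (pow_pos hd.norm_pos n).ne', one_mul]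
    exact ha l
  · simp only [mul_smul _ (_ * _), ← Finset.smul_sum, ← hexchange]
    rw [mul_smul, smul_sub, inv_smul_smul₀ (hd.vertexCoeff_ne_zero i), add_sub_cancel]

theorem exists_reducesTo (hd : LeadingData n γt t) (w : ℤ × ℤ) :
    ∃ j c H, ReducesTo n γt t w j c H := by
  induction w using (wellFounded_reductionLT n).induction with
  | _ w ih =>
  rcases exists_vertex_exchange hd.two_le w with ⟨j, hj, rfl⟩ | ⟨v, i, k, rfl, hv, hlt⟩
  · exact ⟨j, 1, 0, reducesTo_eps γt t hj⟩
  · obtain ⟨j, c, H, h⟩ := ih _ hlt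
    exact ⟨j, h.exists_of_exchange hd hlt.wt_le hv⟩

end ReducesTo

/-! ### Series with coefficients bounded in terms of the weight -/

section WtBound

variable {K : Type*} [NormedField K]

/-- `‖η u‖ ≤ C ‖γ̃‖ ^ (k n ω(u))` for all `u`. The image of a monomial under `α₁` satisfies such a
bound with exponent `k = p`, elements of `C₀` satisfy it with `k = 1`, and the reduction modulo the
operators is carried out on series with `k = 2`. -/
def WtBound (n : ℕ) (γt : K) (k : ℕ) (C : ℝ) (η : ℤ × ℤ → K) : Prop :=
  ∀ u, ‖η u‖ ≤ C * ‖γt‖ ^ (k * wt n u)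

namespace WtBound

variable {n k : ℕ} {γt : K} {C : ℝ} {η η' : ℤ × ℤ → K}

theorem nonneg (hη : WtBound n γt k C η) (hγ : 0 < ‖γt‖) : 0 ≤ C :=
  nonneg_of_mul_nonneg_left ((norm_nonneg _).trans (hη 0)) (by positivity)

theorem mono (hη : WtBound n γt k C η) {D : ℝ} (h : C ≤ D) : WtBound n γt k D η :=
  fun u => (hη u).trans (by gcongr)

theorem norm_le (hη : WtBound n γt k C η) (hγ : ‖γt‖ ≤ 1) (hC : 0 ≤ C) (u : ℤ × ℤ) : ‖η u‖ ≤ C :=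
  (hη u).trans (mul_le_of_le_one_right hC (pow_le_one₀ (norm_nonneg _) hγ))

theorem neg (hη : WtBound n γt k C η) : WtBound n γt k C (-η) := fun u => by
  rw [Pi.neg_apply, norm_neg]
  exact hη u

variable [IsUltrametricDist K]

theorem add (hη : WtBound n γt k C η) (hη' : WtBound n γt k C η') : WtBound n γt k C (η + η') :=
  fun u => norm_add_le_of_norm_le (hη u) (hη' u)

theorem sub (hη : WtBound n γt k C η) (hη' : WtBound n γt k C η') : WtBound n γt k C (η - η') :=
  fun u => norm_sub_le_of_norm_le (hη u) (hη' u)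

end WtBound

theorem summable_of_norm_le_pow_wt [IsUltrametricDist K] [CompleteSpace K] {ι : Type*} {n : ℕ}
    (hn : 1 ≤ n) {r D : ℝ} (h0 : 0 ≤ r) (h1 : r < 1) {e : ι → ℤ × ℤ} (he : Function.Injective e)
    {f : ι → K} (hf : ∀ i, ‖f i‖ ≤ D * r ^ wt n (e i)) : Summable f := by
  refine NonarchimedeanAddGroup.summable_of_tendsto_cofinite_zero (squeeze_zero_norm hf ?_)
  simpa only [Function.comp_def, mul_zero] using
    ((tendsto_pow_wt hn h0 h1).comp he.tendsto_cofinite).const_mul D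

theorem WtBound.summable_mul [IsUltrametricDist K] [CompleteSpace K] {n k : ℕ} {γt t : K} {C D : ℝ}
    {β f : ℤ × ℤ → K} (hβ : WtBound n γt k C β) (hd : LeadingData n γt t) (hk : k ≠ 0)
    (hf : ∀ w, ‖f w‖ ≤ D) : Summable fun w => β w * f w := by
  have hC := hβ.nonneg hd.norm_pos
  refine summable_of_norm_le_pow_wt (D := C * D) (one_le_two.trans hd.two_le)
    (pow_nonneg (norm_nonneg γt) k) (pow_lt_one₀ (norm_nonneg _) hd.norm_lt_one hk)
    Function.injective_id fun w => ?_
  rw [norm_mul, mul_right_comm, ← pow_mul]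
  exact mul_le_mul (hβ w) (hf w) (norm_nonneg _) (by positivity)

end WtBound

section LeadingReduction

variable {K : Type*} [NormedField K] {n : ℕ} {γt t : K} {β : ℤ × ℤ → K}

/-- The combination `∑ v_j ε_j` of the basis monomials. -/
def basisSum (n : ℕ) : (Fin (2 * n + 1) → K) →ₗ[K] (ℤ × ℤ → K) :=
  Fintype.linearCombination K fun j : Fin (2 * n + 1) => Pi.single (eps n j) (1 : K)

theorem basisSum_apply (n : ℕ) (v : Fin (2 * n + 1) → K) (u : ℤ × ℤ) :
    basisSum n v u = ∑ j, v j * (Pi.single (eps n j) 1 : ℤ × ℤ → K) u := by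
  simp only [basisSum, Fintype.linearCombination_apply, Finset.sum_apply, Pi.smul_apply,
    smul_eq_mul]

theorem exists_reducesTo_extending_basis [IsUltrametricDist K] (hd : LeadingData n γt t)
    (w : ℤ × ℤ) : ∃ j c H, ReducesTo n γt t w j c H ∧ ∀ i ≤ 2 * n, w = eps n i → j = i ∧ c = 1 := by
  by_cases hw : ∃ i ≤ 2 * n, w = eps n i
  · obtain ⟨i, hi, rfl⟩ := hw
    exact ⟨i, 1, 0, reducesTo_eps γt t hi, fun i' _ hi' => ⟨eps_injective n hi', rfl⟩⟩
  · obtain ⟨j, c, H, hr⟩ := exists_reducesTo hd w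
    exact ⟨j, c, H, hr, fun i hi hi' => absurd ⟨i, hi, hi'⟩ hw⟩

variable [IsUltrametricDist K]

theorem wtBound_tsum_mul_cofactor {k : ℕ} {D : ℝ} {H : ℤ × ℤ → ℤ × ℤ → K} (h0 : 0 < ‖γt‖)
    (h1 : ‖γt‖ ≤ 1) (hβ : WtBound n γt (k + 1) D β) (hH : ∀ w u, ‖H w u‖ * ‖γt‖ ^ n ≤ 1)
    (hwt : ∀ w u, H w u ≠ 0 → wt n u + n ≤ wt n w) :
    WtBound n γt (k + 1) (D * ‖γt‖ ^ (k * n)) fun u => ∑' w, β w * H w u := by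
  have hD := hβ.nonneg h0
  have hpos : 0 < ‖γt‖ ^ n := by positivity
  intro u
  refine IsUltrametricDist.norm_tsum_le_of_forall_le fun w => ?_
  by_cases hHw : H w u = 0
  · rw [hHw, mul_zero, norm_zero]
    positivity
  refine le_of_mul_le_mul_right ?_ hpos
  calc ‖β w * H w u‖ * ‖γt‖ ^ n = ‖β w‖ * (‖H w u‖ * ‖γt‖ ^ n) := by rw [norm_mul, mul_assoc]
    _ ≤ ‖β w‖ := mul_le_of_le_one_right (norm_nonneg _) (hH w u)
    _ ≤ D * ‖γt‖ ^ ((k + 1) * wt n w) := hβ w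
    _ ≤ D * ‖γt‖ ^ ((k + 1) * (wt n u + n)) := by
      exact mul_le_mul_of_nonneg_left
        (pow_le_pow_of_le_one h0.le h1 (Nat.mul_le_mul_left _ (hwt w u hHw))) hD
    _ = D * ‖γt‖ ^ (k * n) * ‖γt‖ ^ ((k + 1) * wt n u) * ‖γt‖ ^ n := by ring

variable [CompleteSpace K] {j : ℤ × ℤ → ℕ} {c : ℤ × ℤ → K} {H : ℤ × ℤ → Fin 2 → ℤ × ℤ → K} {C : ℝ}

theorem summable_mul_coeff (hd : LeadingData n γt t) (hβ : WtBound n γt 2 C β)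
    (hr : ∀ w, ReducesTo n γt t w (j w) (c w) (H w)) (i : ℕ) :
    Summable fun w => β w * if j w = i then c w else 0 :=
  hβ.summable_mul hd two_ne_zero (D := 1) fun w => by
    split_ifs
    · exact (hr w).norm_coeff_le
    · simp

theorem eq_basisSum_add_sum_lead (hd : LeadingData n γt t) (hβ : WtBound n γt 2 C β)
    (hr : ∀ w, ReducesTo n γt t w (j w) (c w) (H w)) :
    β = basisSum n (fun i => ∑' w, β w * if j w = i then c w else 0)
      + ∑ l, lead n (γt ^ n) t l fun u => ∑' w, β w * H w l u := by
  have hcofactor : ∀ l u, HasSum (fun w => β w * H w l u) (∑' w, β w * H w l u) := fun l u =>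
    (hβ.summable_mul hd two_ne_zero (D := 1 / ‖γt‖ ^ n) fun w =>
      (le_div_iff₀ (pow_pos hd.norm_pos n)).2 ((hr w).norm_cofactor_le l u)).hasSum
  funext u
  have hleft : HasSum (fun w => β w * (Pi.single w 1 : ℤ × ℤ → K) u) (β u) := by
    simpa using hasSum_single (f := fun w => β w * (Pi.single w 1 : ℤ × ℤ → K) u) u
      fun w hw => by simp [hw.symm]
  have hright := (hasSum_sum (s := Finset.univ) fun (i : Fin (2 * n + 1)) _ =>
      (summable_mul_coeff hd hβ hr i).hasSum.mul_right ((Pi.single (eps n i) 1 : ℤ × ℤ → K) u)).add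
    (hasSum_sum (s := Finset.univ) fun l _ =>
      hasSum_vertexDiff (F := fun w => β w • H w l) (hcofactor l) n (γt ^ n) t 1 l.castSucc u)
  rw [Pi.add_apply, basisSum_apply, Finset.sum_apply]
  refine hleft.unique (hright.congr_fun fun w => ?_)
  have hcollapse : ∑ i : Fin (2 * n + 1), (β w * if j w = i then c w else 0)
      * (Pi.single (eps n i) 1 : ℤ × ℤ → K) u
      = β w * (c w * (Pi.single (eps n (j w)) 1 : ℤ × ℤ → K) u) := by
    rw [Finset.sum_eq_single ⟨j w, Nat.lt_succ_of_le (hr w).index_le⟩]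
    · simp only [if_true, mul_assoc]
    · exact fun i _ hi => by rw [if_neg fun h => hi (Fin.ext h.symm), mul_zero, zero_mul]
    · exact fun h => absurd (Finset.mem_univ _) h
  simp only [(hr w).single_eq, hcollapse, Pi.add_apply, Finset.sum_apply, mul_add, Finset.mul_sum,
    Pi.smul_apply, smul_eq_mul, map_smul]

theorem norm_tsum_mul_coeff_sub_le (hd : LeadingData n γt t) (hβ : WtBound n γt 2 C β)
    (hr : ∀ w, ReducesTo n γt t w (j w) (c w) (H w)) {i : ℕ}
    (hi : j (eps n i) = i ∧ c (eps n i) = 1) {E : ℝ} (hE : 0 ≤ E)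
    (hβE : ∀ w, i ≤ wt n w → w ≠ eps n i → ‖β w‖ ≤ E) :
    ‖(∑' w, β w * if j w = i then c w else 0) - β (eps n i)‖ ≤ E := by
  rw [(summable_mul_coeff hd hβ hr i).tsum_eq_add_tsum_ite (eps n i), if_pos hi.1, hi.2, mul_one,
    add_sub_cancel_left]
  refine IsUltrametricDist.norm_tsum_le_of_forall_le_of_nonneg hE fun w => ?_
  split_ifs with hw hjw
  · simpa using hE
  · rw [norm_mul]
    refine (mul_le_of_le_one_right (norm_nonneg _) (hr w).norm_coeff_le).trans (hβE w ?_ hw)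
    exact hjw ▸ (hr w).index_le_wt
  · simpa using hE

theorem exists_leading_reduction (hd : LeadingData n γt t) (hβ : WtBound n γt 2 C β) :
    ∃ (v : Fin (2 * n + 1) → K) (η : Fin 2 → ℤ × ℤ → K),
      β = basisSum n v + ∑ l, lead n (γt ^ n) t l (η l) ∧
      (∀ (k : ℕ) (D : ℝ), WtBound n γt (k + 1) D β →
        ∀ l, WtBound n γt (k + 1) (D * ‖γt‖ ^ (k * n)) (η l)) ∧
      ∀ (i : Fin (2 * n + 1)) (E : ℝ), 0 ≤ E →
        (∀ w, (i : ℕ) ≤ wt n w → w ≠ eps n i → ‖β w‖ ≤ E) → ‖v i - β (eps n i)‖ ≤ E := by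
  choose j c H hr hbasis using exists_reducesTo_extending_basis hd
  exact ⟨_, _, eq_basisSum_add_sum_lead hd hβ hr,
    fun k D hD l => wtBound_tsum_mul_cofactor hd.norm_pos hd.norm_lt_one.le hD
      (fun w => (hr w).norm_cofactor_le l) fun w => (hr w).wt_cofactor_add_le l,
    fun i E hE => norm_tsum_mul_coeff_sub_le hd hβ hr
      (hbasis _ i (Nat.le_of_lt_succ i.2) rfl) hE⟩

end LeadingReduction

/-! ### The leading parts form a regular sequence -/

section LeadBound

variable {K : Type*} [NormedField K] [IsUltrametricDist K] {n : ℕ} {γt t : K}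
  {η : ℤ × ℤ → K}

theorem LeadingData.norm_vertexDiff_le (hd : LeadingData n γt t) {g : K} {m : ℕ} {u : ℤ × ℤ}
    {E : ℝ} (h : ∀ k, ‖g‖ * ‖η (u - m • vertex n k)‖ ≤ E) (l : Fin 3) :
    ‖vertexDiff n g t m l η u‖ ≤ E := by
  rw [vertexDiff_apply, mul_sub]
  refine norm_sub_le_of_norm_le ?_ ?_
  · rw [norm_mul, norm_mul, hd.norm_vertexCoeff, one_mul]
    exact h l
  · rw [norm_mul, norm_mul, hd.norm_t, one_mul]
    exact h 2

theorem LeadingData.norm_vertexDiff_le_of_wtBound (hd : LeadingData n γt t) {g : K}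
    {m k r s d e : ℕ} {C : ℝ} (hη : WtBound n γt k (C * ‖γt‖ ^ d) η) (hC : 0 ≤ C)
    (hg : ‖g‖ * ‖γt‖ ^ s ≤ ‖γt‖ ^ r) {u : ℤ × ℤ}
    (he : ∀ w, wt n u ≤ w + n * m → s + e ≤ r + d + k * w) (l : Fin 3) :
    ‖vertexDiff n g t m l η u‖ ≤ C * ‖γt‖ ^ e := by
  have hγ := hd.norm_pos
  refine hd.norm_vertexDiff_le (fun i => ?_) l
  set w := u - m • vertex n i
  refine le_of_mul_le_mul_right ?_ (pow_pos hγ s)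
  calc ‖g‖ * ‖η w‖ * ‖γt‖ ^ s = ‖g‖ * ‖γt‖ ^ s * ‖η w‖ := mul_right_comm _ _ _
    _ ≤ ‖γt‖ ^ r * (C * ‖γt‖ ^ d * ‖γt‖ ^ (k * wt n w)) := by
      gcongr
      exact hη w
    _ = C * ‖γt‖ ^ (r + d + k * wt n w) := by ring
    _ ≤ C * ‖γt‖ ^ (s + e) := mul_le_mul_of_nonneg_left
      (pow_le_pow_of_le_one hγ.le hd.norm_lt_one.le
        (he _ (wt_le_wt_sub_nsmul_vertex_add n m i u))) hC
    _ = C * ‖γt‖ ^ e * ‖γt‖ ^ s := by ring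

theorem LeadingData.lead_wtBound (hd : LeadingData n γt t) {k : ℕ} {C : ℝ}
    (hη : WtBound n γt (k + 1) (C * ‖γt‖ ^ (k * n)) η) (l : Fin 2) :
    WtBound n γt (k + 1) C (lead n (γt ^ n) t l η) := by
  have hC : 0 ≤ C :=
    nonneg_of_mul_nonneg_left (hη.nonneg hd.norm_pos) (pow_pos hd.norm_pos _)
  exact fun u => hd.norm_vertexDiff_le_of_wtBound (r := n) (s := 0) hη hC
    (by rw [pow_zero, mul_one, norm_pow]) (fun w hw => by nlinarith) _

end LeadBound

theorem eq_zero_of_norm_add_eq {G E : Type*} [AddMonoid G] [NormedAddCommGroup E] {f : G → E}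
    {e : G} (hf : ∀ w, ‖f (w + e)‖ = ‖f w‖)
    (hlim : ∀ w, Tendsto (fun m : ℕ => f (w + m • e)) atTop (𝓝 0)) : f = 0 := by
  have hiter : ∀ w (m : ℕ), ‖f (w + m • e)‖ = ‖f w‖ := fun w m => by
    induction m with
    | zero => simp
    | succ m ih => rw [succ_nsmul, ← add_assoc, hf, ih]
  funext w
  have h := (hlim w).norm
  simp only [hiter, norm_zero] at h
  exact norm_eq_zero.1 (tendsto_nhds_unique tendsto_const_nhds h)

theorem hasSum_sub_add_right {G E : Type*} [AddGroup G] [AddCommGroup E] [TopologicalSpace E]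
    [IsTopologicalAddGroup E] {F : G → E} {s : E} (hF : HasSum F s) (e : G) :
    HasSum (fun q => F q - F (q + e)) 0 := by
  simpa using hF.sub ((Equiv.addRight e).hasSum_iff.2 hF)

/-- The edges of the Newton triangle at the vertex `(-1,-1)`. -/
def edge (n : ℕ) : Fin 2 → ℤ × ℤ := ![((n : ℤ) + 1, 1), (1, 2)]

theorem vertex_two_add_edge (n : ℕ) (l : Fin 2) : vertex n 2 + edge n l = vertex n l.castSucc := by
  fin_cases l <;> simp [vertex, edge]

/-- Points of the sublattice spanned by the edges at `(-1,-1)`, in terms of their coordinates. -/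
def edgePoint (n : ℕ) : (Fin 2 → ℤ) →ₗ[ℤ] ℤ × ℤ := Fintype.linearCombination ℤ (edge n)

theorem edgePoint_eq (n : ℕ) (q : Fin 2 → ℤ) :
    edgePoint n q = (q 0 * (n + 1) + q 1, q 0 + q 1 * 2) := by
  ext <;> simp [edgePoint, Fintype.linearCombination_apply, edge, -zsmul_eq_mul]

theorem edgePoint_single (n : ℕ) (l : Fin 2) : edgePoint n (Pi.single l 1) = edge n l := by
  simp [edgePoint]

theorem edgePoint_injective (n : ℕ) : Function.Injective (edgePoint n) := by
  refine (injective_iff_map_eq_zero _).2 fun q hq => ?_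
  rw [edgePoint_eq, Prod.mk_eq_zero] at hq
  have h : (2 * (n : ℤ) + 1) * q 0 = 0 := by linear_combination 2 * hq.1 - hq.2
  have h0 : q 0 = 0 := (mul_eq_zero.1 h).resolve_left (by omega)
  funext l
  fin_cases l
  · exact h0
  · simpa [h0] using hq.2

/-- The basis monomials lie in different cosets of the lattice spanned by the edges: the linear
form `(a, b) ↦ a + n b` takes the value `i` at `ε_i` and maps the lattice to `(2 n + 1) ℤ`. -/
theorem eq_zero_of_eps_add_edgePoint {n i j : ℕ} (hi : i ≤ 2 * n) (hj : j ≤ 2 * n)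
    {q : Fin 2 → ℤ} (h : eps n j + edgePoint n q = eps n i) : q = 0 := by
  have hmod : (2 * (n : ℤ) + 1) * (q 0 + q 1) = i - j := by
    have h' := h
    rw [edgePoint_eq] at h'
    have h1 := congrArg Prod.fst h'
    have h2 := congrArg Prod.snd h'
    simp only [Prod.fst_add, Prod.snd_add] at h1 h2
    linear_combination h1 + n * h2 + eps_fst_add n i - eps_fst_add n j
  have hq : q 0 + q 1 = 0 := by
    by_contra h0
    rcases lt_or_gt_of_ne h0 with h0 | h0 <;> nlinarith
  obtain rfl : i = j := by
    rw [hq] at hmod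
    omega
  exact edgePoint_injective n (by rw [map_zero]; exact add_eq_left.1 h)

section Functional

variable {K : Type*} [NormedField K] {n : ℕ} {γt t : K}

theorem WtBound.tendsto_cofinite {k : ℕ} {C : ℝ} {η : ℤ × ℤ → K} (hη : WtBound n γt k C η)
    (hn : 1 ≤ n) (h1 : ‖γt‖ < 1) (hk : k ≠ 0) : Tendsto η cofinite (𝓝 0) := by
  refine squeeze_zero_norm hη ?_
  simpa only [pow_mul, mul_zero] using
    (tendsto_pow_wt hn (pow_nonneg (norm_nonneg γt) k)
      (pow_lt_one₀ (norm_nonneg _) h1 hk)).const_mul C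

theorem LeadingData.eq_zero_of_lead_eq_zero (hd : LeadingData n γt t) {k : ℕ} (hk : k ≠ 0) {C : ℝ}
    {η : ℤ × ℤ → K} (hη : WtBound n γt k C η) {l : Fin 2} (h0 : lead n (γt ^ n) t l η = 0) :
    η = 0 := by
  have hedge : edge n l ≠ 0 := by fin_cases l <;> simp [edge]
  refine eq_zero_of_norm_add_eq (e := edge n l) (fun w => ?_) fun w => ?_
  · have h := congrFun h0 (w + vertex n l.castSucc)
    rw [lead_apply, Pi.zero_apply, mul_eq_zero, or_iff_right (pow_ne_zero n hd.gt_ne_zero),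
      sub_eq_zero, add_sub_cancel_right, ← vertex_two_add_edge, ← add_assoc, add_right_comm,
      add_sub_cancel_right] at h
    simpa only [norm_mul, hd.norm_vertexCoeff, hd.norm_t, one_mul] using (congrArg norm h).symm
  · refine (hη.tendsto_cofinite (one_le_two.trans hd.two_le) hd.norm_lt_one hk).comp ?_
    rw [← Nat.cofinite_eq_atTop]
    exact ((add_right_injective w).comp
      ((IsAddLeftRegular.all _).nsmul_injective hedge)).tendsto_cofinite

theorem basisSum_apply_eps (v : Fin (2 * n + 1) → K) (j : Fin (2 * n + 1)) :
    basisSum n v (eps n j) = v j := by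
  simp [basisSum_apply, Pi.single_apply, (eps_injective n).eq_iff, Fin.val_inj]

theorem basisSum_apply_of_ne (v : Fin (2 * n + 1) → K) {u : ℤ × ℤ}
    (hu : ∀ j : Fin (2 * n + 1), u ≠ eps n j) : basisSum n v u = 0 := by
  simp [basisSum_apply, hu]

/-- A character of the lattice spanned by the edges. The functional
`η ↦ ∑ q, edgeChar n t q * η (w + edgePoint n q)` vanishes on the images of the leading parts. -/
def edgeChar (n : ℕ) (t : K) (q : Fin 2 → ℤ) : K :=
  ∏ l : Fin 2, (t / vertexCoeff n t l.castSucc) ^ q l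

theorem LeadingData.norm_edgeChar (hd : LeadingData n γt t) (q : Fin 2 → ℤ) :
    ‖edgeChar n t q‖ = 1 := by
  simp [edgeChar, hd.norm_vertexCoeff, hd.norm_t]

theorem LeadingData.edgeChar_add_single (hd : LeadingData n γt t) (q : Fin 2 → ℤ) (l : Fin 2) :
    edgeChar n t (q + Pi.single l 1) = edgeChar n t q * (t / vertexCoeff n t l.castSucc) := by
  have hsingle : ∏ k : Fin 2, (t / vertexCoeff n t k.castSucc) ^ (Pi.single l 1 : Fin 2 → ℤ) k
      = t / vertexCoeff n t l.castSucc := by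
    rw [Fintype.prod_eq_single l fun k hk => by simp [hk]]
    simp
  simp only [edgeChar, Pi.add_apply, Finset.prod_mul_distrib, hsingle,
    zpow_add₀ (div_ne_zero hd.t_ne_zero (hd.vertexCoeff_ne_zero _))]

variable [IsUltrametricDist K] [CompleteSpace K] {k : ℕ} {C : ℝ}

theorem LeadingData.hasSum_edgeChar_mul_lead (hd : LeadingData n γt t) (hk : k ≠ 0)
    {η : ℤ × ℤ → K} (hη : WtBound n γt k C η) (g : K) (l : Fin 2) (w : ℤ × ℤ) :
    HasSum (fun q => edgeChar n t q * lead n g t l η (w + edgePoint n q)) 0 := by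
  have hsum : Summable fun q =>
      edgeChar n t q * η (w - vertex n l.castSucc + edgePoint n q) := by
    refine summable_of_norm_le_pow_wt (D := C) (one_le_two.trans hd.two_le)
      (pow_nonneg (norm_nonneg γt) k) (pow_lt_one₀ (norm_nonneg _) hd.norm_lt_one hk)
      ((add_right_injective (w - vertex n l.castSucc)).comp (edgePoint_injective n)) fun q => ?_
    rw [norm_mul, hd.norm_edgeChar, one_mul, ← pow_mul]
    exact hη _
  have htelescope := (hasSum_sub_add_right hsum.hasSum (Pi.single l 1)).mul_left
    (g * vertexCoeff n t l.castSucc)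
  rw [mul_zero] at htelescope
  refine htelescope.congr_fun fun q => ?_
  have hpoint : w - vertex n l.castSucc + edgePoint n (q + Pi.single l 1)
      = w + edgePoint n q - vertex n 2 := by
    rw [map_add, edgePoint_single, ← vertex_two_add_edge]
    abel
  rw [lead_apply, hpoint, hd.edgeChar_add_single, add_sub_right_comm w]
  field_simp [hd.vertexCoeff_ne_zero l.castSucc]

theorem LeadingData.eq_zero_of_basisSum_eq_sum_lead (hd : LeadingData n γt t) (hk : k ≠ 0)
    {η : Fin 2 → ℤ × ℤ → K} (hη : ∀ l, WtBound n γt k C (η l)) {g : K}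
    {v : Fin (2 * n + 1) → K} (heq : basisSum n v = ∑ l, lead n g t l (η l)) : v = 0 := by
  funext j
  have hleft : HasSum (fun q => edgeChar n t q * basisSum n v (eps n j + edgePoint n q)) (v j) := by
    convert hasSum_single (f := fun q => edgeChar n t q * basisSum n v (eps n j + edgePoint n q))
      0 fun q hq => ?_ using 1
    · simp [basisSum_apply_eps, edgeChar]
    · rw [basisSum_apply_of_ne, mul_zero]
      exact fun i hi => hq (eq_zero_of_eps_add_edgePoint (Nat.le_of_lt_succ i.2)
        (Nat.le_of_lt_succ j.2) hi)
  have hright := hasSum_sum (s := Finset.univ) fun l _ =>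
    hd.hasSum_edgeChar_mul_lead hk (hη l) g l (eps n j)
  rw [Finset.sum_const_zero] at hright
  refine hleft.unique (hright.congr_fun fun q => ?_)
  rw [heq, Finset.sum_apply, Finset.mul_sum]

end Functional

section LineSum

variable {K : Type*} [NormedField K] {n : ℕ} {γt t : K} {a : ℤ × ℤ → K} {C : ℝ}

/-- The series `g⁻¹ y ∑ l, t ^ l / (x y ^ 2) ^ l • a`, a formal inverse image of `a` under the
multiplication by `g (y - t / (x y))`. -/
def edgeSum (n : ℕ) (g t : K) (a : ℤ × ℤ → K) (u : ℤ × ℤ) : K :=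
  g⁻¹ * ∑' l : ℕ, t ^ l * a (u + vertex n 1 + l • edge n 1)

variable [IsUltrametricDist K]

/-- The sum of `a` over the lines in the direction of the edge `(1,2)` decays in the direction of
the other edge, because the linear form `(a, b) ↦ 2 a - b` is constant on these lines. -/
theorem LeadingData.tendsto_tsum_line (hd : LeadingData n γt t) (ha : WtBound n γt 2 C a)
    (w : ℤ × ℤ) : Tendsto (fun m : ℕ => ∑' l : ℤ, t ^ l * a (w + m • edge n 0 + l • edge n 1))
      atTop (𝓝 0) := by
  have hC := ha.nonneg hd.norm_pos
  have hlim : Tendsto (fun m : ℕ => C * ‖γt‖ ^ (m - (2 * w.1 - w.2).natAbs)) atTop (𝓝 0) := by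
    simpa using ((tendsto_pow_atTop_nhds_zero_of_lt_one (norm_nonneg _) hd.norm_lt_one).comp
      (tendsto_sub_atTop_nat _)).const_mul C
  refine squeeze_zero_norm (fun m => IsUltrametricDist.norm_tsum_le_of_forall_le fun l => ?_) hlim
  rw [norm_mul, norm_zpow, hd.norm_t, one_zpow, one_mul]
  refine (ha _).trans (mul_le_mul_of_nonneg_left (pow_le_pow_of_le_one (norm_nonneg _)
    hd.norm_lt_one.le ?_) hC)
  obtain ⟨h1, -, h3⟩ := le_wt n (w + m • edge n 0 + l • edge n 1)
  generalize wt n (w + m • edge n 0 + l • edge n 1) = W at *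
  simp only [edge, Matrix.cons_val, Prod.smul_mk, Prod.fst_add, Prod.snd_add, nsmul_eq_mul,
    zsmul_eq_mul, Int.cast_id, mul_one] at h1 h3
  have hmn : (0 : ℤ) ≤ m * n := by positivity
  have hform : 2 * w.1 - w.2 + m ≤ 2 * W := by nlinarith
  omega

variable [CompleteSpace K]

theorem LeadingData.summable_line (hd : LeadingData n γt t) {k : ℕ} (hk : k ≠ 0)
    (ha : WtBound n γt k C a) (w : ℤ × ℤ) : Summable fun l : ℤ => t ^ l * a (w + l • edge n 1) := by
  refine summable_of_norm_le_pow_wt (D := C) (one_le_two.trans hd.two_le)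
    (pow_nonneg (norm_nonneg γt) k) (pow_lt_one₀ (norm_nonneg _) hd.norm_lt_one hk)
    (e := fun l : ℤ => w + l • edge n 1) (fun l l' h => ?_) fun l => ?_
  · simpa [edge] using h
  · rw [norm_mul, norm_zpow, hd.norm_t, one_zpow, one_mul, ← pow_mul]
    exact ha _

theorem LeadingData.natCast_mul_tsum_line_eq (hd : LeadingData n γt t) {k : ℕ} (hk : k ≠ 0)
    {η : Fin 2 → ℤ × ℤ → K} (hη : ∀ l, WtBound n γt k C (η l))
    (heq : ∑ l, lead n (γt ^ n) t l (η l) = 0) (w : ℤ × ℤ) :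
    n * ∑' l : ℤ, t ^ l * η 0 (w + l • edge n 1)
      = t * ∑' l : ℤ, t ^ l * η 0 (w + edge n 0 + l • edge n 1) := by
  have hzero := ((hd.summable_line hk (hη 0) w).hasSum.mul_left (n : K)).sub
    ((hd.summable_line hk (hη 0) (w + edge n 0)).hasSum.mul_left t)
  have htelescope := hasSum_sub_add_right
    (hd.summable_line hk (hη 1) (w + vertex n 0 - vertex n 1)).hasSum 1
  rw [← sub_eq_zero]
  refine (hzero.unique (htelescope.neg.congr_fun fun l => ?_)).trans neg_zero
  have h := congrFun heq (w + vertex n 0 + l • edge n 1)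
  have h0 : vertex n 0 = vertex n 2 + edge n 0 := (vertex_two_add_edge n 0).symm
  have h1 : vertex n 1 = vertex n 2 + edge n 1 := (vertex_two_add_edge n 1).symm
  simp only [Fin.sum_univ_two, Pi.add_apply, Pi.zero_apply, lead_apply, Fin.castSucc_zero,
    Fin.castSucc_one, ← mul_add, mul_eq_zero, pow_ne_zero n hd.gt_ne_zero, false_or] at h
  rw [show w + vertex n 0 + l • edge n 1 - vertex n 0 = w + l • edge n 1 by abel,
    show w + vertex n 0 + l • edge n 1 - vertex n 2 = w + edge n 0 + l • edge n 1 by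
      rw [h0]; abel,
    show w + vertex n 0 + l • edge n 1 - vertex n 1
      = w + vertex n 0 - vertex n 1 + l • edge n 1 by abel] at h
  rw [show w + vertex n 0 - vertex n 1 + (l + 1) • edge n 1 = w + edge n 0 + l • edge n 1 by
      rw [h0, h1, add_smul, one_smul]; abel, zpow_add_one₀ hd.t_ne_zero]
  simp only [vertexCoeff, Matrix.cons_val, one_mul] at h
  linear_combination t ^ l * h

theorem LeadingData.tsum_line_eq_zero (hd : LeadingData n γt t) {η : Fin 2 → ℤ × ℤ → K}
    (hη : ∀ l, WtBound n γt 2 C (η l)) (heq : ∑ l, lead n (γt ^ n) t l (η l) = 0) (w : ℤ × ℤ) :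
    ∑' l : ℤ, t ^ l * η 0 (w + l • edge n 1) = 0 := by
  refine congrFun (eq_zero_of_norm_add_eq
    (f := fun w => ∑' l : ℤ, t ^ l * η 0 (w + l • edge n 1)) (e := edge n 0) (fun w => ?_)
    (hd.tendsto_tsum_line (hη 0))) w
  have h := congrArg norm (hd.natCast_mul_tsum_line_eq two_ne_zero hη heq w)
  rw [norm_mul, norm_mul, hd.norm_natCast, hd.norm_t, one_mul, one_mul] at h
  exact h.symm

theorem LeadingData.lead_edgeSum (hd : LeadingData n γt t) {k : ℕ} (hk : k ≠ 0)
    (ha : WtBound n γt k C a) : lead n (γt ^ n) t 1 (edgeSum n (γt ^ n) t a) = a := by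
  funext u
  have hsum : Summable fun l : ℕ => t ^ l * a (u + l • edge n 1) := by
    simpa [Function.comp_def] using
      (hd.summable_line hk ha u).comp_injective Nat.cast_injective
  have hshift : ∀ l : ℕ, u - vertex n 2 + vertex n 1 + l • edge n 1 = u + (l + 1) • edge n 1 := by
    intro l
    rw [show vertex n 1 = vertex n 2 + edge n 1 from (vertex_two_add_edge n 1).symm, add_smul,
      one_smul]
    abel
  have hpeel : ∑' l : ℕ, t ^ l * a (u + l • edge n 1)
      = a u + t * ∑' l : ℕ, t ^ l * a (u + (l + 1) • edge n 1) := by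
    rw [hsum.tsum_eq_zero_add, ← tsum_mul_left]
    simp only [pow_zero, one_mul, zero_smul, add_zero, pow_succ', mul_assoc]
  rw [lead_apply, edgeSum, edgeSum, Fin.castSucc_one, sub_add_cancel]
  simp only [hshift]
  rw [hpeel]
  simp only [vertexCoeff, Matrix.cons_val, one_mul]
  field_simp [hd.gt_ne_zero]
  ring

theorem LeadingData.edgeSum_eq_neg (hd : LeadingData n γt t) {k : ℕ} (hk : k ≠ 0)
    (ha : WtBound n γt k C a) {u : ℤ × ℤ}
    (hline : ∑' l : ℤ, t ^ l * a (u + vertex n 1 + l • edge n 1) = 0) (g : K) :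
    edgeSum n g t a u
      = -(g⁻¹ * ∑' l : ℕ, (t ^ (l + 1))⁻¹ * a (u + vertex n 1 - (l + 1) • edge n 1)) := by
  have hsum := hd.summable_line hk ha (u + vertex n 1)
  have hsplit := tsum_of_nat_of_neg_add_one
    (f := fun l : ℤ => t ^ l * a (u + vertex n 1 + l • edge n 1))
    (hsum.comp_injective Nat.cast_injective)
    (hsum.comp_injective (i := fun l : ℕ => -((l : ℤ) + 1)) fun l l' h => by simpa using h)
  have hterm : ∀ l : ℕ, t ^ (-((l : ℤ) + 1)) * a (u + vertex n 1 + (-((l : ℤ) + 1)) • edge n 1)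
      = (t ^ (l + 1))⁻¹ * a (u + vertex n 1 - (l + 1) • edge n 1) := fun l => by
    rw [neg_smul, ← sub_eq_add_neg, zpow_neg, ← Nat.cast_succ, zpow_natCast, natCast_zsmul]
  simp only [hterm, zpow_natCast, natCast_zsmul] at hsplit
  rw [edgeSum, ← mul_neg, eq_neg_of_add_eq_zero_left (hsplit.symm.trans hline)]

theorem LeadingData.edgeSum_wtBound (hd : LeadingData n γt t) {k : ℕ}
    (ha : WtBound n γt (k + 1) C a)
    (hline : ∀ w, ∑' l : ℤ, t ^ l * a (w + l • edge n 1) = 0) :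
    WtBound n γt (k + 1) (C * ‖γt‖ ^ (k * n)) (edgeSum n (γt ^ n) t a) := by
  have hγ := hd.norm_pos
  have hC := ha.nonneg hγ
  intro u
  have hbound : ∀ (f : ℕ → K) (e : ℕ → ℤ × ℤ), (∀ l, ‖f l‖ = 1) →
      (∀ l, wt n u + n ≤ wt n (e l)) → ‖(γt ^ n)⁻¹ * ∑' l, f l * a (e l)‖
        ≤ C * ‖γt‖ ^ (k * n) * ‖γt‖ ^ ((k + 1) * wt n u) := by
    intro f e hf he
    rw [norm_mul, norm_inv, norm_pow, inv_mul_le_iff₀ (by positivity)]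
    calc ‖∑' l, f l * a (e l)‖ ≤ C * ‖γt‖ ^ ((k + 1) * (wt n u + n)) := by
          refine IsUltrametricDist.norm_tsum_le_of_forall_le fun l => ?_
          rw [norm_mul, hf, one_mul]
          exact (ha _).trans (mul_le_mul_of_nonneg_left (pow_le_pow_of_le_one hγ.le
            hd.norm_lt_one.le (Nat.mul_le_mul_left _ (he l))) hC)
      _ = _ := by ring
  -- In the lower half plane the sum is replaced by the complementary half of the line.
  rcases le_total 0 u.2 with hu | hu
  · exact hbound _ _ (fun l => by rw [norm_pow, hd.norm_t, one_pow]) (wt_add_le_wt_add_line hu)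
  · rw [hd.edgeSum_eq_neg k.succ_ne_zero ha (hline _), norm_neg]
    exact hbound _ _ (fun l => by rw [norm_inv, norm_pow, hd.norm_t, one_pow, inv_one])
      (wt_add_le_wt_sub_line hu)

/-- Exactness of the Koszul complex of the leading parts. -/
theorem LeadingData.exists_of_sum_lead_eq_zero (hd : LeadingData n γt t) {η : Fin 2 → ℤ × ℤ → K}
    (hη : ∀ l, WtBound n γt 2 C (η l)) (heq : ∑ l, lead n (γt ^ n) t l (η l) = 0) :
    ∃ c, WtBound n γt 2 (C * ‖γt‖ ^ n) c ∧ η 0 = lead n (γt ^ n) t 1 c ∧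
      η 1 = -lead n (γt ^ n) t 0 c := by
  set c := edgeSum n (γt ^ n) t (η 0)
  have hc : WtBound n γt 2 (C * ‖γt‖ ^ n) c := by
    simpa using hd.edgeSum_wtBound (hη 0) (hd.tsum_line_eq_zero hη heq)
  have h0 : lead n (γt ^ n) t 1 c = η 0 := hd.lead_edgeSum two_ne_zero (hη 0)
  have h1 : lead n (γt ^ n) t 1 (η 1 + lead n (γt ^ n) t 0 c) = 0 := by
    rw [map_add, vertexDiff_comm, h0, add_comm, ← heq, Fin.sum_univ_two]
  exact ⟨c, hc, h0.symm, eq_neg_of_add_eq_zero_left <| hd.eq_zero_of_lead_eq_zero two_ne_zero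
    ((hη 1).add (hd.lead_wtBound (k := 1) (by simpa using hc) 0)) h1⟩

end LineSum

/-! ### The operators `D_x` and `D_y` -/

section Operators

variable {K : Type*} [NormedField K]

theorem gammaSeq_zero (p : ℕ) (γ : K) : gammaSeq p γ 0 = γ := by
  simp [gammaSeq]

/-- The Euler operators `x ∂/∂x` and `y ∂/∂y`. -/
def euler (l : Fin 2) : (ℤ × ℤ → K) →ₗ[K] (ℤ × ℤ → K) where
  toFun η u := (![u.1, u.2] l : ℤ) * η u
  map_add' η η' := funext fun u => mul_add _ (η u) (η' u)
  map_smul' c η := funext fun u => mul_left_comm _ c (η u)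

theorem euler_apply (l : Fin 2) (η : ℤ × ℤ → K) (u : ℤ × ℤ) :
    euler l η u = (![u.1, u.2] l : ℤ) * η u := rfl

/-- The `i`-th term of the series in `D_x` (for `l = 0`) and `D_y` (for `l = 1`). -/
def opTerm (p n : ℕ) (γt tb : K) (σ : K ≃+* K) (l : Fin 2) (i : ℕ) :
    (ℤ × ℤ → K) →ₗ[K] (ℤ × ℤ → K) :=
  vertexDiff n (gammaSeq p (γt ^ n) i * (p : K) ^ i) (σ^[i] tb) (p ^ i) l.castSucc

/-- The operators `D_x` (for `l = 0`) and `D_y` (for `l = 1`). -/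
def diffOp (p n : ℕ) (γt tb : K) (σ : K ≃+* K) (l : Fin 2) (η : ℤ × ℤ → K) (u : ℤ × ℤ) : K :=
  euler l η u + ∑' i, opTerm p n γt tb σ l i η u

/-- The operators `D_x` and `D_y` without their leading parts. -/
def tailOp (p n : ℕ) (γt tb : K) (σ : K ≃+* K) (l : Fin 2) (η : ℤ × ℤ → K) (u : ℤ × ℤ) : K :=
  euler l η u + ∑' i, opTerm p n γt tb σ l (i + 1) η u

variable {p n : ℕ} {γt tb : K} {σ : K ≃+* K}

theorem Dx_eq_diffOp : Dx p n γt tb σ = diffOp p n γt tb σ 0 := by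
  funext η u
  simp [Dx, diffOp, euler_apply, opTerm, vertexDiff_apply, vertexCoeff, vertex, mul_comm (n : ℤ),
    Prod.sub_def]

theorem Dy_eq_diffOp : Dy p n γt tb σ = diffOp p n γt tb σ 1 := by
  funext η u
  simp [Dy, diffOp, euler_apply, opTerm, vertexDiff_apply, vertexCoeff, vertex, Prod.sub_def]

theorem opTerm_zero (l : Fin 2) : opTerm p n γt tb σ l 0 = lead n (γt ^ n) tb l := by
  rw [opTerm, gammaSeq_zero, pow_zero, pow_zero, mul_one, Function.iterate_zero, id]

theorem euler_opTerm_add_opTerm_euler (l l' : Fin 2) (i : ℕ) (η : ℤ × ℤ → K) (u : ℤ × ℤ) :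
    euler l (opTerm p n γt tb σ l' i η) u + opTerm p n γt tb σ l i (euler l' η) u
      = euler l' (opTerm p n γt tb σ l i η) u + opTerm p n γt tb σ l' i (euler l η) u := by
  fin_cases l <;> fin_cases l' <;>
    simp [euler_apply, opTerm, vertexDiff_apply, vertexCoeff, vertex] <;> ring

/-- The hypotheses on the constants that enter the operators `D_x` and `D_y`. -/
structure OperatorData (p n : ℕ) (γt tb : K) (σ : K ≃+* K) : Prop extends
    LeadingData n γt tb where
  lt : n < p
  norm_iterate : ∀ i, ‖σ^[i] tb‖ = 1
  norm_gammaSeq : ∀ i, ‖gammaSeq p (γt ^ n) i * (p : K) ^ i‖ * ‖γt‖ ^ (n * (p - 1)) ≤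
    ‖γt‖ ^ (n * p ^ (i + 1))

namespace OperatorData

theorem three_le (h : OperatorData p n γt tb σ) : 3 ≤ p :=
  h.two_le.trans_lt h.lt

theorem leadingData_iterate (h : OperatorData p n γt tb σ) (i : ℕ) :
    LeadingData n γt (σ^[i] tb) :=
  { h.toLeadingData with norm_t := h.norm_iterate i }

theorem norm_gammaSeq_le_pow (h : OperatorData p n γt tb σ) (i : ℕ) :
    ‖gammaSeq p (γt ^ n) i * (p : K) ^ i‖ ≤ ‖γt‖ ^ i := by
  have hγ := h.norm_pos
  have hexp : i + n * (p - 1) ≤ n * p ^ (i + 1) := by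
    obtain ⟨r, rfl⟩ : ∃ r, p = r + 1 := ⟨p - 1, by have := h.three_le; omega⟩
    have hi : i + 1 ≤ (r + 1) ^ i := Nat.lt_pow_self (by have := h.three_le; omega)
    have hn : 1 ≤ n := one_le_two.trans h.two_le
    rw [Nat.add_sub_cancel, pow_succ]
    calc i + n * r ≤ n * ((i + 1) * (r + 1)) := by nlinarith [Nat.zero_le (n * i * r)]
      _ ≤ n * ((r + 1) ^ i * (r + 1)) := by gcongr
  refine le_of_mul_le_mul_right ((h.norm_gammaSeq i).trans ?_) (pow_pos hγ (n * (p - 1)))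
  rw [← pow_add]
  exact pow_le_pow_of_le_one hγ.le h.norm_lt_one.le hexp

end OperatorData

variable [IsUltrametricDist K] {C : ℝ} {η η' : ℤ × ℤ → K}

theorem norm_euler_le {u : ℤ × ℤ} (hη : ‖η u‖ ≤ C) (l : Fin 2) : ‖euler l η u‖ ≤ C := by
  rw [euler_apply, norm_mul]
  exact (mul_le_of_le_one_left (norm_nonneg _) (IsUltrametricDist.norm_intCast_le_one K _)).trans hη

namespace OperatorData

theorem norm_opTerm_le (h : OperatorData p n γt tb σ) (hη : ∀ u, ‖η u‖ ≤ C) (l : Fin 2) (i : ℕ)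
    (u : ℤ × ℤ) : ‖opTerm p n γt tb σ l i η u‖ ≤ ‖γt‖ ^ i * C :=
  (h.leadingData_iterate i).norm_vertexDiff_le
    (fun _ => mul_le_mul (h.norm_gammaSeq_le_pow i) (hη _) (norm_nonneg _) (by positivity)) _

theorem norm_opTerm_le_self (h : OperatorData p n γt tb σ) (hη : ∀ u, ‖η u‖ ≤ C) (l : Fin 2)
    (i : ℕ) (u : ℤ × ℤ) : ‖opTerm p n γt tb σ l i η u‖ ≤ C :=
  (h.norm_opTerm_le hη l i u).trans (mul_le_of_le_one_left ((norm_nonneg _).trans (hη 0))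
    (pow_le_one₀ (norm_nonneg _) h.norm_lt_one.le))

theorem norm_diffOp_le (h : OperatorData p n γt tb σ) (hη : ∀ u, ‖η u‖ ≤ C) (l : Fin 2)
    (u : ℤ × ℤ) : ‖diffOp p n γt tb σ l η u‖ ≤ C :=
  norm_add_le_of_norm_le (norm_euler_le (hη u) l)
    (IsUltrametricDist.norm_tsum_le_of_forall_le fun i => h.norm_opTerm_le_self hη l i u)

theorem norm_opTerm_le_of_wtBound (h : OperatorData p n γt tb σ) {k d e i : ℕ} (hC : 0 ≤ C)
    (hη : WtBound n γt k (C * ‖γt‖ ^ d) η) {u : ℤ × ℤ}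
    (he : ∀ w, wt n u ≤ w + n * p ^ i → n * (p - 1) + e ≤ n * p ^ (i + 1) + d + k * w)
    (l : Fin 2) : ‖opTerm p n γt tb σ l i η u‖ ≤ C * ‖γt‖ ^ e :=
  (h.leadingData_iterate i).norm_vertexDiff_le_of_wtBound hη hC (h.norm_gammaSeq i) he _

theorem norm_opTerm_le_wt (h : OperatorData p n γt tb σ) {k : ℕ} (hk : k + 1 ≤ p) (hC : 0 ≤ C)
    (hη : WtBound n γt (k + 1) (C * ‖γt‖ ^ (k * n)) η) (l : Fin 2) (i : ℕ) (u : ℤ × ℤ) :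
    ‖opTerm p n γt tb σ l i η u‖ ≤ C * ‖γt‖ ^ ((k + 1) * wt n u) := by
  refine h.norm_opTerm_le_of_wtBound hC hη (fun w hw => ?_) l
  obtain ⟨r, rfl⟩ : ∃ r, p = k + 1 + r := ⟨p - (k + 1), by omega⟩
  have hP : 1 ≤ (k + 1 + r) ^ i := Nat.one_le_pow _ _ (by omega)
  rw [pow_succ, show k + 1 + r - 1 = k + r by omega]
  generalize (k + 1 + r) ^ i = P at *
  nlinarith [Nat.mul_le_mul_left (k + 1) hw, Nat.mul_le_mul_left (n * r) hP]

theorem tailOp_wtBound (h : OperatorData p n γt tb σ) {k : ℕ} (hk : k + 1 ≤ p) (hC : 0 ≤ C)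
    (hη : WtBound n γt (k + 1) (C * ‖γt‖ ^ (k * n)) η) (l : Fin 2) :
    WtBound n γt (k + 1) C (tailOp p n γt tb σ l η) := fun u =>
  norm_add_le_of_norm_le (norm_euler_le (hη.mono (mul_le_of_le_one_right hC
      (pow_le_one₀ (norm_nonneg _) h.norm_lt_one.le)) u) l)
    (IsUltrametricDist.norm_tsum_le_of_forall_le fun i => h.norm_opTerm_le_wt hk hC hη l (i + 1) u)

theorem diffOp_wtBound (h : OperatorData p n γt tb σ) {k : ℕ} (hk : k + 1 ≤ p) (hC : 0 ≤ C)
    (hη : WtBound n γt (k + 1) (C * ‖γt‖ ^ (k * n)) η) (l : Fin 2) :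
    WtBound n γt (k + 1) C (diffOp p n γt tb σ l η) := fun u =>
  norm_add_le_of_norm_le (norm_euler_le (hη.mono (mul_le_of_le_one_right hC
      (pow_le_one₀ (norm_nonneg _) h.norm_lt_one.le)) u) l)
    (IsUltrametricDist.norm_tsum_le_of_forall_le fun i => h.norm_opTerm_le_wt hk hC hη l i u)

theorem tailOp_wtBound_two (h : OperatorData p n γt tb σ) (hC : 0 ≤ C)
    (hη : WtBound n γt 2 (C * ‖γt‖ ^ n) η) (l : Fin 2) :
    WtBound n γt 2 (C * ‖γt‖ ^ n) (tailOp p n γt tb σ l η) := by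
  intro u
  refine norm_add_le_of_norm_le (norm_euler_le (hη u) l) ?_
  rw [mul_assoc, ← pow_add]
  refine IsUltrametricDist.norm_tsum_le_of_forall_le fun i =>
    h.norm_opTerm_le_of_wtBound hC hη (fun w hw => ?_) l
  obtain ⟨r, rfl⟩ : ∃ r, p = 3 + r := ⟨p - 3, by have := h.three_le; omega⟩
  have hP : 3 + r ≤ (3 + r) ^ (i + 1) := Nat.le_self_pow i.succ_ne_zero _
  rw [pow_succ _ (i + 1), show 3 + r - 1 = 2 + r by omega]
  generalize (3 + r) ^ (i + 1) = P at *
  nlinarith [Nat.mul_le_mul_left (n * (r + 1)) hP, Nat.zero_le (n * r), Nat.zero_le (n * r * r)]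

theorem norm_tailOp_le_of_wt_le (h : OperatorData p n γt tb σ) (hC : 0 ≤ C)
    (hη : WtBound n γt p (C * ‖γt‖ ^ ((p - 1) * n)) η) {u : ℤ × ℤ} (hu : wt n u ≤ 2 * n)
    (l : Fin 2) : ‖tailOp p n γt tb σ l η u‖ ≤ C * ‖γt‖ ^ (p * wt n u + (p - 1)) := by
  obtain ⟨r, hr⟩ : ∃ r, p = r + 1 := ⟨p - 1, by have := h.three_le; omega⟩
  have hn : 1 ≤ n := one_le_two.trans h.two_le
  rw [hr, Nat.add_sub_cancel, ← hr] at hη ⊢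
  refine norm_add_le_of_norm_le (norm_euler_le ((hη u).trans ?_) l) ?_
  · rw [mul_assoc, ← pow_add]
    exact mul_le_mul_of_nonneg_left (pow_le_pow_of_le_one (norm_nonneg _) h.norm_lt_one.le
      (by nlinarith)) hC
  · refine IsUltrametricDist.norm_tsum_le_of_forall_le fun i =>
      h.norm_opTerm_le_of_wtBound hC hη (fun w _ => ?_) l
    have hP : p ≤ p ^ (i + 1) := Nat.le_self_pow i.succ_ne_zero p
    have hexp : r + p * wt n u ≤ n * p ^ (i + 1 + 1) := by
      calc r + p * wt n u ≤ p * (2 * n) + p * n := by nlinarith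
        _ = p * (n * 3) := by ring
        _ ≤ p * (n * p ^ (i + 1)) := by gcongr; exact h.three_le.trans hP
        _ = n * p ^ (i + 1 + 1) := by ring
    rw [hr, Nat.add_sub_cancel, ← hr]
    nlinarith

variable [CompleteSpace K]

theorem summable_opTerm (h : OperatorData p n γt tb σ) (hη : ∀ u, ‖η u‖ ≤ C) (l : Fin 2)
    (u : ℤ × ℤ) : Summable fun i => opTerm p n γt tb σ l i η u :=
  Summable.of_norm_bounded
    ((summable_geometric_of_lt_one (norm_nonneg _) h.norm_lt_one).mul_right C)
    fun i => h.norm_opTerm_le hη l i u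

theorem diffOp_add (h : OperatorData p n γt tb σ) (hη : ∀ u, ‖η u‖ ≤ C) (hη' : ∀ u, ‖η' u‖ ≤ C)
    (l : Fin 2) :
    diffOp p n γt tb σ l (η + η') = diffOp p n γt tb σ l η + diffOp p n γt tb σ l η' := by
  funext u
  simp only [diffOp, map_add, Pi.add_apply]
  rw [(h.summable_opTerm hη l u).tsum_add (h.summable_opTerm hη' l u), add_add_add_comm]

theorem diffOp_sub (h : OperatorData p n γt tb σ) (hη : ∀ u, ‖η u‖ ≤ C) (hη' : ∀ u, ‖η' u‖ ≤ C)
    (l : Fin 2) :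
    diffOp p n γt tb σ l (η - η') = diffOp p n γt tb σ l η - diffOp p n γt tb σ l η' := by
  funext u
  simp only [diffOp, map_sub, Pi.sub_apply]
  rw [(h.summable_opTerm hη l u).tsum_sub (h.summable_opTerm hη' l u), add_sub_add_comm]

theorem diffOp_eq_lead_add_tailOp (h : OperatorData p n γt tb σ) (hη : ∀ u, ‖η u‖ ≤ C)
    (l : Fin 2) :
    diffOp p n γt tb σ l η = lead n (γt ^ n) tb l η + tailOp p n γt tb σ l η := by
  funext u
  rw [diffOp, (h.summable_opTerm hη l u).tsum_eq_zero_add, opTerm_zero, Pi.add_apply, tailOp,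
    add_left_comm]

theorem diffOp_diffOp (h : OperatorData p n γt tb σ) (hη : ∀ u, ‖η u‖ ≤ C) (l l' : Fin 2)
    (u : ℤ × ℤ) :
    diffOp p n γt tb σ l (diffOp p n γt tb σ l' η) u = euler l (euler l' η) u
      + ∑' i, (euler l (opTerm p n γt tb σ l' i η) u + opTerm p n γt tb σ l i (euler l' η) u)
      + ∑' i, ∑' j, opTerm p n γt tb σ l i (opTerm p n γt tb σ l' j η) u := by
  have hη' : ∀ w, ‖euler l' η w‖ ≤ C := fun w => norm_euler_le (hη w) l'
  have hsum := h.summable_opTerm hη l'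
  have hdouble : ∀ i, HasSum (fun j => opTerm p n γt tb σ l i (opTerm p n γt tb σ l' j η) u)
      (opTerm p n γt tb σ l i (fun w => ∑' j, opTerm p n γt tb σ l' j η w) u) := fun i =>
    hasSum_vertexDiff (fun w => (hsum w).hasSum) _ _ _ _ _ u
  have hfun : diffOp p n γt tb σ l' η
      = euler l' η + fun w => ∑' j, opTerm p n γt tb σ l' j η w := rfl
  rw [hfun, h.diffOp_add hη'
    fun w => IsUltrametricDist.norm_tsum_le_of_forall_le fun j => h.norm_opTerm_le_self hη l' j w]
  simp only [diffOp, Pi.add_apply, euler_apply l, (hdouble _).tsum_eq]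
  rw [(((hsum u).mul_left _).tsum_add (h.summable_opTerm hη' l u)), tsum_mul_left]
  ring

theorem diffOp_comm (h : OperatorData p n γt tb σ) (hη : ∀ u, ‖η u‖ ≤ C) (l l' : Fin 2) :
    diffOp p n γt tb σ l (diffOp p n γt tb σ l' η)
      = diffOp p n γt tb σ l' (diffOp p n γt tb σ l η) := by
  have hgeom := summable_geometric_of_lt_one (norm_nonneg γt) h.norm_lt_one
  have hsum : ∀ u, Summable fun i : ℕ × ℕ =>
      opTerm p n γt tb σ l i.1 (opTerm p n γt tb σ l' i.2 η) u := fun u =>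
    Summable.of_norm_bounded ((hgeom.mul_of_nonneg hgeom (fun _ => by positivity)
      fun _ => by positivity).mul_right C) fun i => by
        rw [mul_assoc]
        exact h.norm_opTerm_le (fun w => h.norm_opTerm_le hη l' i.2 w) l i.1 u
  funext u
  simp only [h.diffOp_diffOp hη, euler_opTerm_add_opTerm_euler l l']
  rw [← (hsum u).tsum_comm (f := fun i j => opTerm p n γt tb σ l i (opTerm p n γt tb σ l' j η) u)]
  congr 2
  · simp only [euler_apply, mul_left_comm]
  · simp only [opTerm, vertexDiff_comm n _ _ _ _ _ _ l.castSucc l'.castSucc]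

end OperatorData

end Operators

/-! ### Reduction to the basis in cohomology -/

section Reduction

variable {K : Type*} [NormedField K] {p n : ℕ} {γt tb : K} {σ : K ≃+* K} {C : ℝ}
  {β : ℤ × ℤ → K}

theorem norm_basisSum_le {v : Fin (2 * n + 1) → K} (hC : 0 ≤ C) (hv : ∀ j, ‖v j‖ ≤ C)
    (u : ℤ × ℤ) : ‖basisSum n v u‖ ≤ C := by
  by_cases hu : ∃ j : Fin (2 * n + 1), u = eps n j
  · obtain ⟨j, rfl⟩ := hu
    rw [basisSum_apply_eps]
    exact hv j
  · rw [basisSum_apply_of_ne v fun j hj => hu ⟨j, hj⟩, norm_zero]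
    exact hC

theorem WtBound.norm_le_of_le_wt {k j : ℕ} (hβ : WtBound n γt k C β) (hC : 0 ≤ C)
    (hγ : ‖γt‖ ≤ 1) {w : ℤ × ℤ} (hw : j ≤ wt n w) : ‖β w‖ ≤ C * ‖γt‖ ^ (k * j) :=
  (hβ w).trans (mul_le_mul_of_nonneg_left
    (pow_le_pow_of_le_one (norm_nonneg _) hγ (Nat.mul_le_mul_left _ hw)) hC)

theorem norm_tsum_sub_sum_range_le {E : Type*} [NormedAddCommGroup E] [IsUltrametricDist E]
    [CompleteSpace E] {f : ℕ → E} {r : ℝ} (h0 : 0 ≤ r) (h1 : r < 1)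
    (hf : ∀ m, ‖f m‖ ≤ C * r ^ m) (M : ℕ) :
    ‖∑' m, f m - ∑ m ∈ Finset.range M, f m‖ ≤ C * r ^ M := by
  have hC : 0 ≤ C := by simpa using (norm_nonneg _).trans (hf 0)
  have hsum : Summable f :=
    Summable.of_norm_bounded ((summable_geometric_of_lt_one h0 h1).mul_left C) hf
  rw [← hsum.sum_add_tsum_nat_add M, add_sub_cancel_left]
  exact IsUltrametricDist.norm_tsum_le_of_forall_le fun m => (hf _).trans
    (mul_le_mul_of_nonneg_left (pow_le_pow_of_le_one h0 h1.le (Nat.le_add_left M m)) hC)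

/-- One step of the reduction modulo the images of `D_x` and `D_y`: up to the images of `η 0` and
`η 1`, the series `β` is a combination of basis monomials plus a smaller series `β'`. -/
structure ReductionStep (p n : ℕ) (γt tb : K) (σ : K ≃+* K) (β β' : ℤ × ℤ → K)
    (v : Fin (2 * n + 1) → K) (η : Fin 2 → ℤ × ℤ → K) : Prop where
  eq_add : β = basisSum n v + ∑ l, diffOp p n γt tb σ l (η l) + β'
  wtBound_cofactor : ∀ C, WtBound n γt 2 C β → ∀ l, WtBound n γt 2 (C * ‖γt‖ ^ n) (η l)
  wtBound_two : ∀ C, WtBound n γt 2 C β → WtBound n γt 2 (C * ‖γt‖ ^ n) β'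
  wtBound : ∀ k D, k + 1 ≤ p → WtBound n γt (k + 1) D β → WtBound n γt (k + 1) D β'
  norm_le_of_wt_le : ∀ D, WtBound n γt p D β → ∀ u, wt n u ≤ 2 * n →
    ‖β' u‖ ≤ D * ‖γt‖ ^ (p * wt n u + (p - 1))
  norm_coeff_sub_le : ∀ (j : Fin (2 * n + 1)) (E : ℝ), 0 ≤ E →
    (∀ w, (j : ℕ) ≤ wt n w → w ≠ eps n j → ‖β w‖ ≤ E) → ‖v j - β (eps n j)‖ ≤ E

variable {B : ℕ → ℤ × ℤ → K} {V : ℕ → Fin (2 * n + 1) → K} {H : ℕ → Fin 2 → ℤ × ℤ → K}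

theorem wtBound_two_of_reductionStep
    (hs : ∀ m, ReductionStep p n γt tb σ (B m) (B (m + 1)) (V m) (H m))
    (hB : WtBound n γt 2 C (B 0)) (m : ℕ) : WtBound n γt 2 (C * (‖γt‖ ^ n) ^ m) (B m) := by
  induction m with
  | zero => simpa using hB
  | succ m ih =>
    rw [pow_succ, ← mul_assoc]
    exact (hs m).wtBound_two _ ih

theorem wtBound_of_reductionStep
    (hs : ∀ m, ReductionStep p n γt tb σ (B m) (B (m + 1)) (V m) (H m)) {k : ℕ} (hk : k + 1 ≤ p)
    (hB : WtBound n γt (k + 1) C (B 0)) (m : ℕ) : WtBound n γt (k + 1) C (B m) := by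
  induction m with
  | zero => exact hB
  | succ m ih => exact (hs m).wtBound k C hk ih

theorem wtBound_cofactor_of_reductionStep
    (hs : ∀ m, ReductionStep p n γt tb σ (B m) (B (m + 1)) (V m) (H m))
    (hd : LeadingData n γt tb) (hB : WtBound n γt 2 C (B 0)) (m : ℕ) (l : Fin 2) :
    WtBound n γt 2 (C * (‖γt‖ ^ n) ^ m) (H m l) := by
  have hm := wtBound_two_of_reductionStep hs hB m
  exact ((hs m).wtBound_cofactor _ hm l).mono (mul_le_of_le_one_right (hm.nonneg hd.norm_pos)
    (pow_le_one₀ (norm_nonneg _) hd.norm_lt_one.le))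

variable [IsUltrametricDist K]

namespace ReductionStep

variable {β' β'' : ℤ × ℤ → K} {v v' : Fin (2 * n + 1) → K} {η η' : Fin 2 → ℤ × ℤ → K}

theorem norm_coeff_le_of_forall (hs : ReductionStep p n γt tb σ β β' v η)
    {j : Fin (2 * n + 1)} {E : ℝ} (hβ : ∀ w, (j : ℕ) ≤ wt n w → ‖β w‖ ≤ E) : ‖v j‖ ≤ E := by
  have hj := hβ (eps n j) (wt_eps n j).ge
  rw [← sub_add_cancel (v j) (β (eps n j))]
  exact norm_add_le_of_norm_le
    (hs.norm_coeff_sub_le j E ((norm_nonneg _).trans hj) fun w hw _ => hβ w hw) hj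

theorem norm_coeff_le (hs : ReductionStep p n γt tb σ β β' v η) (hd : LeadingData n γt tb)
    {k : ℕ} (hβ : WtBound n γt k C β) (j : Fin (2 * n + 1)) : ‖v j‖ ≤ C * ‖γt‖ ^ (k * (j : ℕ)) :=
  hs.norm_coeff_le_of_forall fun _ => hβ.norm_le_of_le_wt (hβ.nonneg hd.norm_pos) hd.norm_lt_one.le

/-- Hence the first step determines the coefficients to leading order. -/
theorem norm_coeff_next_le (hs : ReductionStep p n γt tb σ β β' v η)
    (hs' : ReductionStep p n γt tb σ β' β'' v' η') (h : OperatorData p n γt tb σ)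
    (hβ : WtBound n γt p C β) (hβ' : WtBound n γt p C β') (j : Fin (2 * n + 1)) :
    ‖v' j‖ ≤ C * ‖γt‖ ^ (p * (j : ℕ) + (p - 1)) := by
  have hC := hβ.nonneg h.norm_pos
  refine hs'.norm_coeff_le_of_forall fun w hw => ?_
  by_cases hw2 : wt n w ≤ 2 * n
  · refine (hs.norm_le_of_wt_le C hβ w hw2).trans (mul_le_mul_of_nonneg_left
      (pow_le_pow_of_le_one (norm_nonneg _) h.norm_lt_one.le ?_) hC)
    gcongr
  · refine (hβ'.norm_le_of_le_wt hC h.norm_lt_one.le (j := j + 1) (by omega)).trans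
      (mul_le_mul_of_nonneg_left (pow_le_pow_of_le_one (norm_nonneg _) h.norm_lt_one.le ?_) hC)
    rw [mul_add, mul_one]
    omega

end ReductionStep

theorem norm_tsum_coeff_sub_le_of_reductionStep
    (hs : ∀ m, ReductionStep p n γt tb σ (B m) (B (m + 1)) (V m) (H m))
    (h : OperatorData p n γt tb σ) (hB : ∀ m, WtBound n γt p C (B m)) {j : Fin (2 * n + 1)}
    (hsum : Summable fun m => V m j) {E : ℝ} (hE : C * ‖γt‖ ^ (p * (j : ℕ) + (p - 1)) ≤ E)
    (hBE : ∀ w, wt n w = j → w ≠ eps n j → ‖B 0 w‖ ≤ E) :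
    ‖∑' m, V m j - B 0 (eps n j)‖ ≤ E := by
  have hC := (hB 0).nonneg h.norm_pos
  rw [hsum.tsum_eq_zero_add, add_sub_right_comm]
  refine norm_add_le_of_norm_le ((hs 0).norm_coeff_sub_le j E (le_trans (by positivity) hE)
    fun w hw hne => ?_) (IsUltrametricDist.norm_tsum_le_of_forall_le fun m =>
      ((hs m).norm_coeff_next_le (hs (m + 1)) h (hB m) (hB (m + 1)) j).trans hE)
  rcases hw.eq_or_lt with hw | hw
  · exact hBE w hw.symm hne
  · refine ((hB 0).norm_le_of_le_wt hC h.norm_lt_one.le (Nat.succ_le_of_lt hw)).trans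
      (le_trans (mul_le_mul_of_nonneg_left
        (pow_le_pow_of_le_one (norm_nonneg _) h.norm_lt_one.le ?_) hC) hE)
    rw [Nat.mul_succ]
    omega

variable [CompleteSpace K]

theorem eq_partialSum_of_reductionStep
    (hs : ∀ m, ReductionStep p n γt tb σ (B m) (B (m + 1)) (V m) (H m))
    (h : OperatorData p n γt tb σ) (hH : ∀ m l u, ‖H m l u‖ ≤ C) (M : ℕ) :
    B 0 = basisSum n (∑ m ∈ Finset.range M, V m)
      + ∑ l, diffOp p n γt tb σ l (∑ m ∈ Finset.range M, H m l) + B M := by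
  induction M with
  | zero =>
    have h0 : ∀ l, diffOp p n γt tb σ l 0 = 0 := fun l => by
      funext u
      simp [diffOp]
    simp [h0]
  | succ M ih =>
    have hsum : ∀ l u, ‖(∑ m ∈ Finset.range M, H m l) u‖ ≤ C := fun l u => by
      rw [Finset.sum_apply]
      exact IsUltrametricDist.norm_sum_le_of_forall_le_of_nonneg
        ((norm_nonneg _).trans (hH 0 l u)) fun m _ => hH m l u
    simp only [Finset.sum_range_succ _ M, map_add, h.diffOp_add (hsum _) (hH M _),
      Finset.sum_add_distrib]
    conv_lhs => rw [ih, (hs M).eq_add]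
    abel

theorem eq_tsum_of_reductionStep
    (hs : ∀ m, ReductionStep p n γt tb σ (B m) (B (m + 1)) (V m) (H m))
    (h : OperatorData p n γt tb σ) {r : ℝ} (h0 : 0 ≤ r) (h1 : r < 1)
    (hB : ∀ m u, ‖B m u‖ ≤ C * r ^ m) (hV : ∀ m j, ‖V m j‖ ≤ C * r ^ m)
    (hH : ∀ m l u, ‖H m l u‖ ≤ C * r ^ m) :
    B 0 = basisSum n (fun j => ∑' m, V m j)
      + ∑ l, diffOp p n γt tb σ l fun u => ∑' m, H m l u := by
  have hC : 0 ≤ C := by simpa using (norm_nonneg _).trans (hB 0 0)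
  have hHC : ∀ m l u, ‖H m l u‖ ≤ C := fun m l u =>
    (hH m l u).trans (mul_le_of_le_one_right hC (pow_le_one₀ h0 h1.le))
  have hsumC : ∀ M l u, ‖(∑ m ∈ Finset.range M, H m l) u‖ ≤ C := fun M l u => by
    rw [Finset.sum_apply]
    exact IsUltrametricDist.norm_sum_le_of_forall_le_of_nonneg hC fun m _ => hHC m l u
  have htsumC : ∀ l u, ‖∑' m, H m l u‖ ≤ C := fun l u =>
    IsUltrametricDist.norm_tsum_le_of_forall_le fun m => hHC m l u
  have hlim : Tendsto (fun M : ℕ => C * r ^ M) atTop (𝓝 0) := by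
    simpa using (tendsto_pow_atTop_nhds_zero_of_lt_one h0 h1).const_mul C
  funext u
  rw [← sub_eq_zero, ← norm_le_zero_iff]
  refine ge_of_tendsto hlim (Eventually.of_forall fun M => ?_)
  have hCM : 0 ≤ C * r ^ M := by positivity
  have hrest : B 0 - (basisSum n (fun j => ∑' m, V m j)
        + ∑ l, diffOp p n γt tb σ l fun u => ∑' m, H m l u)
      = B M - basisSum n ((fun j => ∑' m, V m j) - ∑ m ∈ Finset.range M, V m)
        - ∑ l, diffOp p n γt tb σ l ((fun u => ∑' m, H m l u) - ∑ m ∈ Finset.range M, H m l) := by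
    simp only [map_sub, h.diffOp_sub (htsumC _) (hsumC M _), Finset.sum_sub_distrib]
    conv_lhs => rw [eq_partialSum_of_reductionStep hs h hHC M]
    abel
  rw [← Pi.sub_apply, hrest, Pi.sub_apply, Pi.sub_apply, Finset.sum_apply]
  refine norm_sub_le_of_norm_le (norm_sub_le_of_norm_le (hB M u) ?_) ?_
  · refine norm_basisSum_le hCM (fun j => ?_) u
    rw [Pi.sub_apply, Finset.sum_apply]
    exact norm_tsum_sub_sum_range_le h0 h1 (fun m => hV m j) M
  · refine IsUltrametricDist.norm_sum_le_of_forall_le_of_nonneg hCM fun l _ =>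
      h.norm_diffOp_le (fun w => ?_) l u
    rw [Pi.sub_apply, Finset.sum_apply]
    exact norm_tsum_sub_sum_range_le h0 h1 (fun m => hH m l w) M

namespace OperatorData

theorem exists_reductionStep (h : OperatorData p n γt tb σ) (hβ : WtBound n γt 2 C β) :
    ∃ β' v η, ReductionStep p n γt tb σ β β' v η := by
  have hγ := h.norm_pos
  have hp : p - 1 + 1 = p := Nat.sub_add_cancel (by have := h.three_le; omega)
  obtain ⟨v, η, heq, hη, hv⟩ := exists_leading_reduction h.toLeadingData hβ
  have hη2 : ∀ D, WtBound n γt 2 D β → ∀ l, WtBound n γt 2 (D * ‖γt‖ ^ n) (η l) :=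
    fun D hD => by simpa using hη 1 D hD
  have hηC : ∀ l u, ‖η l u‖ ≤ C * ‖γt‖ ^ n := fun l =>
    (hη2 C hβ l).norm_le h.norm_lt_one.le ((hη2 C hβ l).nonneg hγ)
  refine ⟨-(tailOp p n γt tb σ 0 (η 0) + tailOp p n γt tb σ 1 (η 1)), v, η, ?_, hη2,
    fun D hD => ?_, fun k D hk hD => ?_, fun D hD u hu => ?_, hv⟩
  · simp only [Fin.sum_univ_two, h.diffOp_eq_lead_add_tailOp (hηC _)] at heq ⊢
    rw [heq]
    abel
  · have htail := fun l => h.tailOp_wtBound_two (hD.nonneg hγ) (hη2 D hD l) l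
    exact ((htail 0).add (htail 1)).neg
  · have htail := fun l => h.tailOp_wtBound hk (hD.nonneg hγ) (hη k D hD l) l
    exact ((htail 0).add (htail 1)).neg
  · have hηp : ∀ l, WtBound n γt p (D * ‖γt‖ ^ ((p - 1) * n)) (η l) := by
      simpa only [hp] using hη (p - 1) D (by rwa [hp])
    have htail := fun l => h.norm_tailOp_le_of_wt_le (hD.nonneg hγ) (hηp l) hu l
    rw [Pi.neg_apply, norm_neg]
    exact norm_add_le_of_norm_le (htail 0) (htail 1)

theorem exists_reductionSequence (h : OperatorData p n γt tb σ) (hβ : WtBound n γt 2 C β) :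
    ∃ (B : ℕ → ℤ × ℤ → K) (V : ℕ → Fin (2 * n + 1) → K) (H : ℕ → Fin 2 → ℤ × ℤ → K),
      B 0 = β ∧ ∀ m, ReductionStep p n γt tb σ (B m) (B (m + 1)) (V m) (H m) := by
  have hstep : ∀ β : {β // ∃ C, WtBound n γt 2 C β},
      ∃ (β' : {β // ∃ C, WtBound n γt 2 C β}) (v : _) (η : _),
        ReductionStep p n γt tb σ β.1 β'.1 v η := fun β => by
    obtain ⟨D, hD⟩ := β.2
    obtain ⟨β', v, η, hs⟩ := h.exists_reductionStep hD
    exact ⟨⟨β', _, hs.wtBound_two D hD⟩, v, η, hs⟩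
  choose R V H hR using hstep
  refine ⟨fun m => (R^[m] ⟨β, C, hβ⟩).1, fun m => V (R^[m] ⟨β, C, hβ⟩),
    fun m => H (R^[m] ⟨β, C, hβ⟩), rfl, fun m => ?_⟩
  simp only [Function.iterate_succ_apply']
  exact hR _

theorem exists_reduction (h : OperatorData p n γt tb σ) (hβ : WtBound n γt 2 C β) :
    ∃ (v : Fin (2 * n + 1) → K) (z : Fin 2 → ℤ × ℤ → K),
      β = basisSum n v + ∑ l, diffOp p n γt tb σ l (z l) ∧
      (∀ l, WtBound n γt 2 C (z l)) ∧
      (∀ k D, k + 1 ≤ p → WtBound n γt (k + 1) D β →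
        ∀ j, ‖v j‖ ≤ D * ‖γt‖ ^ ((k + 1) * (j : ℕ))) ∧
      ∀ D, WtBound n γt p D β → ∀ (j : Fin (2 * n + 1)) (E : ℝ),
        D * ‖γt‖ ^ (p * (j : ℕ) + (p - 1)) ≤ E →
        (∀ w, wt n w = j → w ≠ eps n j → ‖β w‖ ≤ E) → ‖v j - β (eps n j)‖ ≤ E := by
  obtain ⟨B, V, H, rfl, hs⟩ := h.exists_reductionSequence hβ
  have h1 := h.norm_lt_one.le
  have hC := hβ.nonneg h.norm_pos
  have hr0 : 0 ≤ ‖γt‖ ^ n := by positivity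
  have hr1 : ‖γt‖ ^ n < 1 :=
    pow_lt_one₀ (norm_nonneg _) h.norm_lt_one (by have := h.two_le; omega)
  have hB := wtBound_two_of_reductionStep hs hβ
  have hH := wtBound_cofactor_of_reductionStep hs h.toLeadingData hβ
  have hV : ∀ m j, ‖V m j‖ ≤ C * (‖γt‖ ^ n) ^ m := fun m j =>
    ((hs m).norm_coeff_le h.toLeadingData (hB m) j).trans
      (mul_le_of_le_one_right (by positivity) (pow_le_one₀ (norm_nonneg _) h1))
  refine ⟨fun j => ∑' m, V m j, fun l u => ∑' m, H m l u,
    eq_tsum_of_reductionStep hs h hr0 hr1 (fun m => (hB m).norm_le h1 (by positivity)) hV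
      fun m l => (hH m l).norm_le h1 (by positivity),
    fun l u => IsUltrametricDist.norm_tsum_le_of_forall_le fun m =>
      (hH m l).mono (mul_le_of_le_one_right hC (pow_le_one₀ hr0 hr1.le)) u,
    fun k D hk hD j => IsUltrametricDist.norm_tsum_le_of_forall_le fun m =>
      (hs m).norm_coeff_le h.toLeadingData (wtBound_of_reductionStep hs hk hD m) j,
    fun D hD j E hE hβE => norm_tsum_coeff_sub_le_of_reductionStep hs h ?_ ?_ hE hβE⟩
  · obtain ⟨k, rfl⟩ : ∃ k, p = k + 1 := ⟨p - 1, by have := h.three_le; omega⟩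
    exact wtBound_of_reductionStep hs le_rfl hD
  · exact Summable.of_norm_bounded ((summable_geometric_of_lt_one hr0 hr1).mul_left C)
      fun m => hV m j

end OperatorData

end Reduction

/-! ### Independence of the basis in cohomology -/

section Independence

variable {K : Type*} [NormedField K] {p n : ℕ} {γt tb : K} {σ : K ≃+* K} {C : ℝ}
  {ζ ζ' : ℤ × ℤ → K}

theorem exists_wtBound_of_finite (n : ℕ) (hγ : 0 < ‖γt‖) (k : ℕ) {η : ℤ × ℤ → K}
    (hη : {u | η u ≠ 0}.Finite) : ∃ C, WtBound n γt k C η := by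
  refine ⟨∑ u ∈ hη.toFinset, ‖η u‖ / ‖γt‖ ^ (k * wt n u), fun u => ?_⟩
  by_cases hu : η u = 0
  · rw [hu, norm_zero]
    positivity
  · rw [← div_le_iff₀ (by positivity)]
    exact Finset.single_le_sum (f := fun u => ‖η u‖ / ‖γt‖ ^ (k * wt n u))
      (fun w _ => by positivity) (by simpa using hu)

theorem exists_wtBound_basisSum (hγ : 0 < ‖γt‖) (k : ℕ) (v : Fin (2 * n + 1) → K) :
    ∃ C, WtBound n γt k C (basisSum n v) := by
  refine exists_wtBound_of_finite n hγ k
    ((Set.finite_range fun j : Fin (2 * n + 1) => eps n j).subset fun u hu => ?_)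
  by_contra h
  exact hu (basisSum_apply_of_ne v fun j hj => h ⟨j, hj.symm⟩)

theorem exists_forall_wtBound {ι : Type*} [Finite ι] {k : ℕ} {η : ι → ℤ × ℤ → K}
    (hη : ∀ l, ∃ C, WtBound n γt k C (η l)) : ∃ C, ∀ l, WtBound n γt k C (η l) := by
  choose C hC using hη
  obtain ⟨M, hM⟩ := Set.finite_range C |>.bddAbove
  exact ⟨M, fun l => (hC l).mono (hM ⟨l, rfl⟩)⟩

theorem zpow_nwt (γt : K) (u : ℤ × ℤ) : γt ^ nwt n u = γt ^ wt n u := by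
  rw [← coe_wt, zpow_natCast]

theorem wtBound_of_mem_C0 (hζ : ζ ∈ C0 n γt) : WtBound n γt 1 1 ζ := by
  obtain ⟨ξ, h1, -, h3⟩ := hζ
  intro u
  rw [h3, zpow_nwt, norm_mul, norm_pow, one_mul (wt n u)]
  exact mul_le_mul_of_nonneg_right (h1 u) (by positivity)

theorem mem_C0_of_wtBound (hn : 1 ≤ n) (h0 : 0 < ‖γt‖) (h1 : ‖γt‖ < 1)
    (hζ : WtBound n γt 2 1 ζ) : ζ ∈ C0 n γt := by
  have hγ : γt ≠ 0 := norm_pos_iff.1 h0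
  have hle : ∀ u, ‖ζ u / γt ^ wt n u‖ ≤ ‖γt‖ ^ wt n u := fun u => by
    rw [norm_div, norm_pow, div_le_iff₀ (by positivity), ← pow_add, ← two_mul]
    simpa using hζ u
  refine ⟨fun u => ζ u / γt ^ wt n u, fun u => (hle u).trans (pow_le_one₀ h0.le h1.le),
    squeeze_zero_norm hle (tendsto_pow_wt hn h0.le h1), fun u => ?_⟩
  rw [zpow_nwt, div_mul_cancel₀ _ (pow_ne_zero _ hγ)]

theorem exists_truncation (hγ : 0 < ‖γt‖) (hζ : ζ ∈ C0 n γt) (k : ℕ) {ε : ℝ} (hε : 0 < ε) :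
    ∃ a, (∃ C, WtBound n γt k C a) ∧ WtBound n γt 1 ε (ζ - a) := by
  classical
  obtain ⟨ξ, -, h2, h3⟩ := hζ
  have hfin : {u | ¬ ‖ξ u‖ < ε}.Finite := by
    simpa using eventually_cofinite.1 (h2.eventually (Metric.ball_mem_nhds (0 : K) hε))
  refine ⟨fun u => if ‖ξ u‖ < ε then 0 else ζ u,
    exists_wtBound_of_finite n hγ k (hfin.subset fun u hu hlt => hu (if_pos hlt)), fun u => ?_⟩
  rw [Pi.sub_apply, one_mul]
  split_ifs with h
  · rw [sub_zero, h3, zpow_nwt, norm_mul, norm_pow]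
    exact mul_le_mul_of_nonneg_right h.le (by positivity)
  · rw [sub_self, norm_zero]
    positivity

theorem sum_smul_mono (v : Fin (2 * n + 1) → K) :
    ∑ j : Fin (2 * n + 1), v j • mono n γt (eps n j)
      = basisSum n fun j => v j * γt ^ (j : ℕ) := by
  funext u
  simp only [basisSum_apply, Finset.sum_apply, Pi.smul_apply, mono, Pi.single_apply, smul_eq_mul,
    mul_ite, mul_zero, mul_one]
  refine Finset.sum_congr rfl fun j _ => ?_
  rw [zpow_nwt, wt_eps]

theorem eqInH2_iff {β β' : ℤ × ℤ → K} : EqInH2 p n γt tb σ β β' ↔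
    ∃ ζ : Fin 2 → ℤ × ℤ → K, (∀ l, ζ l ∈ C0 n γt) ∧
      β - β' = ∑ l, diffOp p n γt tb σ l (ζ l) := by
  rw [EqInH2, Dx_eq_diffOp, Dy_eq_diffOp]
  constructor
  · rintro ⟨ζx, hx, ζy, hy, heq⟩
    exact ⟨![ζx, ζy], Fin.forall_fin_two.2 ⟨hx, hy⟩, by simpa [Fin.sum_univ_two] using heq⟩
  · rintro ⟨ζ, hζ, heq⟩
    exact ⟨ζ 0, hζ 0, ζ 1, hζ 1, by rwa [Fin.sum_univ_two] at heq⟩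

variable [IsUltrametricDist K]

theorem sub_mem_C0 (hζ : ζ ∈ C0 n γt) (hζ' : ζ' ∈ C0 n γt) : ζ - ζ' ∈ C0 n γt := by
  obtain ⟨ξ, h1, h2, h3⟩ := hζ
  obtain ⟨ξ', h1', h2', h3'⟩ := hζ'
  refine ⟨ξ - ξ', fun u => norm_sub_le_of_norm_le (h1 u) (h1' u), ?_, fun u => ?_⟩
  · have := h2.sub h2'
    rwa [sub_zero] at this
  · rw [Pi.sub_apply, Pi.sub_apply, h3, h3', sub_mul]

theorem OperatorData.exists_wtBound_diffOp (h : OperatorData p n γt tb σ) {η : ℤ × ℤ → K}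
    (hη : WtBound n γt 2 C η) (l : Fin 2) : ∃ D, WtBound n γt 2 D (diffOp p n γt tb σ l η) := by
  have hγ := h.norm_pos
  have hC := hη.nonneg hγ
  refine ⟨C / ‖γt‖ ^ n, h.diffOp_wtBound (k := 1) (by have := h.three_le; omega) (by positivity)
    ?_ l⟩
  rwa [one_mul, div_mul_cancel₀ _ (by positivity)]

variable [CompleteSpace K]

namespace OperatorData

variable {v : Fin (2 * n + 1) → K} {η : Fin 2 → ℤ × ℤ → K}

/-- By exactness of the complex of leading parts, the cofactors of a vanishing class agree up to a
Koszul syzygy with cofactors that are smaller by `‖γ̃‖ ^ n`. -/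
theorem exists_wtBound_sub_lead (h : OperatorData p n γt tb σ)
    (hη : ∀ l, WtBound n γt 2 C (η l))
    (heq : basisSum n v = ∑ l, diffOp p n γt tb σ l (η l)) :
    ∃ c, WtBound n γt 2 (C * ‖γt‖ ^ n) c ∧
      WtBound n γt 2 (C * ‖γt‖ ^ n) (η 0 - lead n (γt ^ n) tb 1 c) ∧
      WtBound n γt 2 (C * ‖γt‖ ^ n) (η 1 + lead n (γt ^ n) tb 0 c) := by
  have hd := h.toLeadingData
  have hγ := h.norm_pos
  have hC := (hη 0).nonneg hγ
  have htail : ∀ l, WtBound n γt 2 C (tailOp p n γt tb σ l (η l)) := fun l => by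
    have hdiv : C / ‖γt‖ ^ n * ‖γt‖ ^ n = C := div_mul_cancel₀ _ (by positivity)
    simpa only [hdiv] using h.tailOp_wtBound_two (C := C / ‖γt‖ ^ n) (by positivity)
      (by simpa only [hdiv] using hη l) l
  have htails := ((htail 0).add (htail 1)).neg
  obtain ⟨w, ξ, hw, hξ, -⟩ := exists_leading_reduction hd htails
  have hξC : ∀ l, WtBound n γt 2 (C * ‖γt‖ ^ n) (ξ l) := by simpa using hξ 1 C htails
  have hsubC : ∀ l, WtBound n γt 2 C (η l - ξ l) := fun l => (hη l).sub
    ((hξC l).mono (mul_le_of_le_one_right hC (pow_le_one₀ hγ.le h.norm_lt_one.le)))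
  have hsum : basisSum n (v + w) = ∑ l, lead n (γt ^ n) tb l (η l - ξ l) := by
    have hηle := fun l => (hη l).norm_le h.norm_lt_one.le hC
    simp only [Fin.sum_univ_two, h.diffOp_eq_lead_add_tailOp (hηle _), map_sub, map_add]
      at heq hw ⊢
    rw [heq, eq_sub_of_add_eq hw.symm]
    abel
  have hvw : v + w = 0 := hd.eq_zero_of_basisSum_eq_sum_lead two_ne_zero hsubC hsum
  rw [hvw, map_zero] at hsum
  obtain ⟨c, hc, h0, h1⟩ := hd.exists_of_sum_lead_eq_zero hsubC hsum.symm
  refine ⟨c, hc, ?_, ?_⟩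
  · rw [← h0, sub_sub_cancel]
    exact hξC 0
  · rw [← neg_neg (lead n (γt ^ n) tb 0 c), ← h1, ← sub_eq_add_neg, sub_sub_cancel]
    exact hξC 1

theorem exists_smaller_cofactors (h : OperatorData p n γt tb σ)
    (hη : ∀ l, WtBound n γt 2 C (η l))
    (heq : basisSum n v = ∑ l, diffOp p n γt tb σ l (η l)) :
    ∃ η' : Fin 2 → ℤ × ℤ → K, (∀ l, WtBound n γt 2 (C * ‖γt‖ ^ n) (η' l)) ∧
      basisSum n v = ∑ l, diffOp p n γt tb σ l (η' l) := by
  have h1 := h.norm_lt_one.le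
  have hC := (hη 0).nonneg h.norm_pos
  obtain ⟨c, hc, hc0, hc1⟩ := h.exists_wtBound_sub_lead hη heq
  have hηle := fun l => (hη l).norm_le h1 hC
  have hcle : ∀ u, ‖c u‖ ≤ C :=
    (hc.mono (mul_le_of_le_one_right hC (pow_le_one₀ (norm_nonneg _) h1))).norm_le h1 hC
  have hdc := fun l => h.norm_diffOp_le hcle l
  have htail := h.tailOp_wtBound_two hC hc
  refine ⟨![η 0 - diffOp p n γt tb σ 1 c, η 1 + diffOp p n γt tb σ 0 c],
    Fin.forall_fin_two.2 ⟨?_, ?_⟩, ?_⟩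
  · rw [Matrix.cons_val_zero, h.diffOp_eq_lead_add_tailOp hcle, ← sub_sub]
    exact hc0.sub (htail 1)
  · rw [Matrix.cons_val_one, Matrix.cons_val_fin_one, h.diffOp_eq_lead_add_tailOp hcle, ← add_assoc]
    exact hc1.add (htail 0)
  · simp only [Fin.sum_univ_two, Matrix.cons_val_zero, Matrix.cons_val_one] at heq ⊢
    rw [h.diffOp_sub (hηle 0) (hdc 1), h.diffOp_add (hηle 1) (hdc 0), h.diffOp_comm hcle 0 1, heq]
    abel

theorem eq_zero_of_basisSum_eq_of_wtBound (h : OperatorData p n γt tb σ)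
    (hη : ∀ l, WtBound n γt 2 C (η l))
    (heq : basisSum n v = ∑ l, diffOp p n γt tb σ l (η l)) : v = 0 := by
  have hγ := h.norm_pos
  have hC := (hη 0).nonneg hγ
  have hiter : ∀ m : ℕ, ∃ η' : Fin 2 → ℤ × ℤ → K,
      (∀ l, WtBound n γt 2 (C * (‖γt‖ ^ n) ^ m) (η' l)) ∧
      basisSum n v = ∑ l, diffOp p n γt tb σ l (η' l) := fun m => by
    induction m with
    | zero => exact ⟨η, by simpa using hη, heq⟩
    | succ m ih =>
      obtain ⟨η', hη', heq'⟩ := ih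
      simpa only [pow_succ, mul_assoc] using h.exists_smaller_cofactors hη' heq'
  have hlim : Tendsto (fun m : ℕ => C * (‖γt‖ ^ n) ^ m) atTop (𝓝 0) := by
    simpa using (tendsto_pow_atTop_nhds_zero_of_lt_one (by positivity)
      (pow_lt_one₀ hγ.le h.norm_lt_one (by have := h.two_le; omega))).const_mul C
  funext j
  rw [Pi.zero_apply, ← norm_le_zero_iff]
  refine ge_of_tendsto hlim (Eventually.of_forall fun m => ?_)
  obtain ⟨η', hη', heq'⟩ := hiter m
  have hCm : 0 ≤ C * (‖γt‖ ^ n) ^ m := by positivity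
  rw [← basisSum_apply_eps v j, heq', Finset.sum_apply]
  exact IsUltrametricDist.norm_sum_le_of_forall_le_of_nonneg hCm fun l _ =>
    h.norm_diffOp_le ((hη' l).norm_le h.norm_lt_one.le hCm) l _

theorem exists_truncation_of_basisSum_eq (h : OperatorData p n γt tb σ)
    {ζ : Fin 2 → ℤ × ℤ → K} (hζ : ∀ l, ζ l ∈ C0 n γt)
    (heq : basisSum n v = ∑ l, diffOp p n γt tb σ l (ζ l)) {ε : ℝ} (hε : 0 < ε) :
    ∃ (a : Fin 2 → ℤ × ℤ → K) (δ : ℤ × ℤ → K) (C : ℝ),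
      (∀ l, WtBound n γt 2 C (a l)) ∧ WtBound n γt 2 C δ ∧ WtBound n γt 1 ε δ ∧
      basisSum n v = ∑ l, diffOp p n γt tb σ l (a l) + δ := by
  have hγ := h.norm_pos
  have h1 := h.norm_lt_one.le
  choose a haC haε using fun l => exists_truncation hγ (hζ l) 2 hε
  obtain ⟨A, hA⟩ := exists_forall_wtBound haC
  obtain ⟨D, hD⟩ := exists_forall_wtBound fun l => h.exists_wtBound_diffOp (hA l) l
  obtain ⟨V, hV⟩ := exists_wtBound_basisSum (n := n) hγ 2 v
  have hsub : ∀ l, diffOp p n γt tb σ l (ζ l - a l)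
      = diffOp p n γt tb σ l (ζ l) - diffOp p n γt tb σ l (a l) := fun l =>
    h.diffOp_sub (C := max 1 A)
      (fun u => ((wtBound_of_mem_C0 (hζ l)).norm_le h1 zero_le_one u).trans (le_max_left _ _))
      (fun u => ((hA l).norm_le h1 ((hA l).nonneg hγ) u).trans (le_max_right _ _)) l
  have hδ : ∑ l, diffOp p n γt tb σ l (ζ l - a l)
      = basisSum n v - ∑ l, diffOp p n γt tb σ l (a l) := by
    rw [heq, ← Finset.sum_sub_distrib]
    exact Finset.sum_congr rfl fun l _ => hsub l
  have hsmall : ∀ l, WtBound n γt 1 ε (diffOp p n γt tb σ l (ζ l - a l)) := fun l =>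
    h.diffOp_wtBound (k := 0) (by have := h.three_le; omega) hε.le (by simpa using haε l) l
  refine ⟨a, ∑ l, diffOp p n γt tb σ l (ζ l - a l), max A (max V D),
    fun l => (hA l).mono (le_max_left _ _), ?_, ?_, by rw [hδ, add_sub_cancel]⟩
  · rw [hδ, Fin.sum_univ_two]
    have hDM : D ≤ max A (max V D) := (le_max_right _ _).trans (le_max_right _ _)
    exact (hV.mono ((le_max_left _ _).trans (le_max_right _ _))).sub
      (((hD 0).mono hDM).add ((hD 1).mono hDM))
  · rw [Fin.sum_univ_two]
    exact (hsmall 0).add (hsmall 1)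

theorem eq_zero_of_basisSum_eq (h : OperatorData p n γt tb σ) {ζ : Fin 2 → ℤ × ℤ → K}
    (hζ : ∀ l, ζ l ∈ C0 n γt) (heq : basisSum n v = ∑ l, diffOp p n γt tb σ l (ζ l)) :
    v = 0 := by
  have h1 := h.norm_lt_one.le
  funext j
  refine norm_le_zero_iff.1 (le_of_forall_pos_le_add fun ε hε => ?_)
  obtain ⟨a, δ, C, ha, hδC, hδε, hva⟩ := h.exists_truncation_of_basisSum_eq hζ heq hε
  have hC := hδC.nonneg h.norm_pos
  obtain ⟨w, z, hδw, hz, hw, -⟩ := h.exists_reduction hδC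
  have hvw : basisSum n (v - w) = ∑ l, diffOp p n γt tb σ l (a l + z l) := by
    simp only [h.diffOp_add ((ha _).norm_le h1 hC) ((hz _).norm_le h1 hC), map_sub,
      Finset.sum_add_distrib]
    rw [hva, eq_sub_of_add_eq hδw.symm]
    abel
  rw [sub_eq_zero.1 (h.eq_zero_of_basisSum_eq_of_wtBound (fun l => (ha l).add (hz l)) hvw),
    zero_add]
  exact (hw 0 ε (by have := h.three_le; omega) (by simpa using hδε) j).trans
    (mul_le_of_le_one_right hε.le (pow_le_one₀ (norm_nonneg _) h1))

theorem isFrobeniusMatrix_unique (h : OperatorData p n γt tb σ)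
    {A A' : Matrix (Fin (2 * n + 1)) (Fin (2 * n + 1)) K}
    (hA : IsFrobeniusMatrix p n γt tb σ A) (hA' : IsFrobeniusMatrix p n γt tb σ A') :
    A' = A := by
  ext j i
  obtain ⟨ζ, hζ, e⟩ := eqInH2_iff.1 (hA.2 i)
  obtain ⟨ζ', hζ', e'⟩ := eqInH2_iff.1 (hA'.2 i)
  have hnorm : ∀ {ζ : ℤ × ℤ → K}, ζ ∈ C0 n γt → ∀ u, ‖ζ u‖ ≤ 1 := fun hζ =>
    (wtBound_of_mem_C0 hζ).norm_le h.norm_lt_one.le zero_le_one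
  have heq : basisSum n ((fun j => A' j i * γt ^ (j : ℕ)) - fun j => A j i * γt ^ (j : ℕ))
      = ∑ l, diffOp p n γt tb σ l (ζ l - ζ' l) := by
    simp only [h.diffOp_sub (hnorm (hζ _)) (hnorm (hζ' _)), Finset.sum_sub_distrib, map_sub,
      ← sum_smul_mono, ← e, ← e']
    abel
  have h0 := congrFun (h.eq_zero_of_basisSum_eq (fun l => sub_mem_C0 (hζ l) (hζ' l)) heq) j
  rw [Pi.sub_apply, Pi.zero_apply, ← sub_mul] at h0
  exact sub_eq_zero.1 ((mul_eq_zero.1 h0).resolve_right (pow_ne_zero _ h.gt_ne_zero))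

end OperatorData

end Independence

/-! ### The permutation `g` -/

theorem eps_fst_eq_zero_iff {n i : ℕ} : (eps n i).1 = 0 ↔ i = 0 := by
  unfold eps
  split_ifs with h <;> simp only <;> omega

theorem eps_fst_le {n i : ℕ} (hi : i ≤ 2 * n) : (eps n i).1 ≤ n := by
  unfold eps
  split_ifs with h <;> simp only <;> omega

theorem eps_snd_le_one (n i : ℕ) : (eps n i).2 ≤ 1 := by
  unfold eps
  split_ifs <;> simp

theorem eps_of_eq_add {n G : ℕ} {r s : ℤ} (hr : 0 < r) (hrn : r ≤ n) (hs : s = 0 ∨ s = 1)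
    (hG : (G : ℤ) = r + n * s) : eps n G = (r, s) := by
  rcases hs with rfl | rfl
  · rw [eps, if_pos (by omega), hG, mul_zero, add_zero]
  · rw [eps, if_neg (by omega), hG, mul_one, add_sub_cancel_right]

theorem mul_ceil_neg_div (n : ℕ) (a : ℤ) :
    (n : ℤ) * ⌈(-(a : ℚ)) / (n : ℚ)⌉ = a % n - a := by
  rw [neg_div, Int.ceil_neg, Rat.floor_intCast_div_natCast]
  linarith [Int.emod_add_mul_ediv a n]

theorem alphaCoef_eq_emod (p n : ℕ) (i j : ℤ) : alphaCoef p n i j = (i - p * j) % n := by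
  have h := mul_ceil_neg_div n (i - p * j)
  rw [← Int.cast_neg, neg_sub] at h
  rw [alphaCoef, h]
  ring

theorem g_of_dvd {p n i : ℕ} (hi : i ≤ 2 * n) (hd : n ∣ i) : g p n i = i := by
  obtain ⟨c, rfl⟩ := hd
  refine if_pos ?_
  rcases n.eq_zero_or_pos with rfl | hn
  · simp
  · have hc : c ≤ 2 := by nlinarith
    interval_cases c <;> simp [mul_comm]

theorem g_of_not_dvd {p n i : ℕ} (hi : i ≤ 2 * n) (hd : ¬ n ∣ i) :
    g p n i = (varpi p n * (eps n i).1) % n + n * (eps n i).2 := by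
  have hspec : ¬ (i = 0 ∨ i = n ∨ i = 2 * n) := by
    rintro (rfl | rfl | rfl) <;> simp at hd
  have hceil := mul_ceil_neg_div n (varpi p n * i)
  push_cast at hceil
  rw [g, if_neg hspec, eps]
  rcases lt_or_ge i n with hlt | hge
  · rw [if_pos hlt, if_pos hlt.le, hceil]
    simp
  · rw [if_neg hge.not_gt, if_neg (by omega), add_assoc, hceil, mul_sub, mul_comm _ (n : ℤ),
      Int.sub_mul_emod_self_left]
    dsimp only
    ring

theorem dvd_mul_varpi_emod_sub {p n : ℕ} (hn : 2 ≤ n) (hpn : p.Coprime n) (r : ℤ) :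
    (n : ℤ) ∣ p * ((varpi p n * r) % n) - r := by
  have hϖ : (n : ℤ) ∣ p * varpi p n - 1 := by
    exact_mod_cast Nat.modEq_iff_dvd.1 (varpi_spec hn hpn).2.2.symm
  have hr : (n : ℤ) ∣ varpi p n * r - (varpi p n * r) % n := Int.dvd_self_sub_emod
  have hsub : (p : ℤ) * ((varpi p n * r) % n) - r
      = (p * varpi p n - 1) * r - p * (varpi p n * r - (varpi p n * r) % n) := by ring
  exact hsub ▸ (hϖ.mul_right r).sub (hr.mul_left p)

/-- `IsFrobeniusTarget p n i G` describes `G = g(i)` through the exponents of `ε_i` and `ε_G`: both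
monomials have the same degree in `y`, and their degrees `r` and `s` in `x` satisfy
`p s ≡ r` modulo `n`. As `0` and `n` are congruent, the last field is needed to determine `s`. -/
structure IsFrobeniusTarget (p n i G : ℕ) : Prop where
  le : G ≤ 2 * n
  snd_eq : (eps n G).2 = (eps n i).2
  dvd : (n : ℤ) ∣ p * (eps n G).1 - (eps n i).1
  fst_eq_zero_iff : (eps n G).1 = 0 ↔ (eps n i).1 = 0

theorem exists_isFrobeniusTarget {p n i : ℕ} (hn : 2 ≤ n) (hpn : p.Coprime n) (hi : i ≤ 2 * n) :
    ∃ G : ℕ, (G : ℤ) = g p n i ∧ IsFrobeniusTarget p n i G := by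
  have hfst : (n : ℤ) ∣ (eps n i).1 ↔ n ∣ i := by
    rw [← Int.natCast_dvd_natCast, ← eps_fst_add n i, Int.dvd_add_left (dvd_mul_right _ _)]
  have hs : (eps n i).2 = 0 ∨ (eps n i).2 = 1 := by
    have := eps_snd_nonneg n i
    have := eps_snd_le_one n i
    omega
  by_cases hd : n ∣ i
  · exact ⟨i, (g_of_dvd hi hd).symm, hi, rfl,
      ((hfst.2 hd).mul_left _).sub (hfst.2 hd), Iff.rfl⟩
  have hdvd := dvd_mul_varpi_emod_sub hn hpn (eps n i).1
  set ρ := (varpi p n * (eps n i).1) % (n : ℤ) with hρ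
  have hn0 : (0 : ℤ) < n := by omega
  have hρn : ρ < n := Int.emod_lt_of_pos _ hn0
  have hρ0 : 0 < ρ := by
    refine lt_of_le_of_ne (Int.emod_nonneg _ hn0.ne') fun h0 => hd (hfst.1 ?_)
    rwa [← h0, mul_zero, zero_sub, dvd_neg] at hdvd
  have hg : g p n i = ρ + n * (eps n i).2 := g_of_not_dvd hi hd
  obtain ⟨G, hG⟩ := Int.eq_ofNat_of_zero_le (a := g p n i) (by rcases hs with h | h <;> lia)
  have hepsG : eps n G = (ρ, (eps n i).2) := eps_of_eq_add hρ0 hρn.le hs (by rw [← hg, hG])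
  refine ⟨G, hG.symm, by rcases hs with h | h <;> lia, by rw [hepsG], by rw [hepsG]; exact hdvd, ?_⟩
  rw [hepsG]
  exact iff_of_false hρ0.ne' fun h0 => hd (hfst.1 (h0 ▸ dvd_zero _))

theorem p_mul_wt_le {p n i : ℕ} {w : ℤ × ℤ} {k l m : ℕ}
    (h1 : (n : ℤ) * l - k = p * w.1 - (eps n i).1) (h2 : (m : ℤ) - k = p * w.2 - (eps n i).2) :
    p * wt n w ≤ i + n * (k + l + m) := by
  have hw : p • w = eps n i + l • vertex n 0 + m • vertex n 1 + k • vertex n 2 := by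
    ext <;> simp [vertex] <;> linarith
  calc p * wt n w = wt n (p • w) := (wt_nsmul n p w).symm
    _ ≤ wt n (eps n i) + wt n (l • vertex n 0) + wt n (m • vertex n 1) + wt n (k • vertex n 2) := by
        rw [hw]
        exact (wt_add_le _ _ _).trans <| by
          gcongr
          exact (wt_add_le _ _ _).trans <| by
            gcongr
            exact wt_add_le _ _ _
    _ = i + n * (k + l + m) := by
        simp only [wt_nsmul, wt_vertex, wt_eps]
        ring

theorem le_of_dvd_sub {n x y : ℤ} (h : n ∣ x - y) (hx : 0 < x) (hy : y ≤ n) : y ≤ x := by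
  by_contra! hlt
  have := Int.le_of_dvd (sub_pos.2 hlt) ((dvd_sub_comm).1 h)
  omega

theorem IsFrobeniusTarget.fst_le {p n i G : ℕ} (hG : IsFrobeniusTarget p n i G)
    (hpn : p.Coprime n) (hp : 0 < p) (hi : 0 < (eps n i).1) {l : ℕ} {x : ℤ}
    (hx : p * x = (eps n i).1 + n * l) : (eps n G).1 ≤ x := by
  have hx0 : 0 < x := by
    refine pos_of_mul_pos_right (a := (p : ℤ)) ?_ (by positivity)
    rw [hx]
    positivity
  refine le_of_dvd_sub (n := n) ?_ hx0 (eps_fst_le hG.le)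
  refine (Nat.isCoprime_iff_coprime.2 hpn.symm).dvd_of_dvd_mul_left ?_
  have hsub : (p : ℤ) * (x - (eps n G).1) = n * l - (p * (eps n G).1 - (eps n i).1) := by
    rw [mul_sub, hx]
    ring
  exact hsub ▸ (dvd_mul_right _ _).sub hG.dvd

section LeadingMonomial

variable {p n i G : ℕ} {w : ℤ × ℤ} {k l m : ℕ}

theorem IsFrobeniusTarget.eq_eps_of_nonneg (hG : IsFrobeniusTarget p n i G) (hpn : p.Coprime n)
    (hp : 1 < p) (hi : 0 < (eps n i).1) (h1 : (n : ℤ) * l - k = p * w.1 - (eps n i).1)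
    (h2 : (m : ℤ) - k = p * w.2 - (eps n i).2)
    (heq : p * (w.1 + n * w.2) = i + n * (k + l + m)) (hw : w.1 + n * w.2 ≤ G) :
    w = eps n G := by
  have hi0 := eps_fst_add n i
  have hG0 := eps_fst_add n G
  have hk : (k : ℤ) = 0 := by
    have : (2 * (n : ℤ) + 1) * k = 0 := by linear_combination -heq - h1 - n * h2 + hi0
    exact (mul_eq_zero.1 this).resolve_left (by positivity)
  have hfst : (eps n G).1 ≤ w.1 := hG.fst_le hpn (by omega) hi (l := l) (by linarith)
  have hsnd : (eps n G).2 ≤ w.2 := by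
    have := eps_snd_le_one n i
    rw [hG.snd_eq]
    by_contra! hlt
    nlinarith
  have hn : 0 < n := by
    by_contra! hn
    have := eps_fst_le hG.le
    have := (eps_fst_nonneg n G).lt_of_ne' (hG.fst_eq_zero_iff.not.2 hi.ne')
    omega
  have hsnd' : w.2 = (eps n G).2 := by
    refine le_antisymm ?_ hsnd
    by_contra! hlt
    nlinarith
  refine Prod.ext ?_ hsnd'
  rw [hsnd'] at hw
  linarith

theorem IsFrobeniusTarget.eq_eps_of_snd_nonpos (hG : IsFrobeniusTarget p n i G)
    (hpn : p.Coprime n) (hp : 1 < p) (hn : 0 < n) (hi : 0 < (eps n i).1)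
    (h1 : (n : ℤ) * l - k = p * w.1 - (eps n i).1)
    (h2 : (m : ℤ) - k = p * w.2 - (eps n i).2)
    (heq : p * (w.1 - (n + 1) * w.2) = i + n * (k + l + m)) (hw : w.1 - (n + 1) * w.2 ≤ G)
    (hw0 : w.2 ≤ 0) : w = eps n G := by
  have hi0 := eps_fst_add n i
  have hG0 := eps_fst_add n G
  have hm : (eps n i).2 + m = 0 := by
    have : (2 * (n : ℤ) + 1) * ((eps n i).2 + m) = 0 := by
      linear_combination -heq - h1 + (n + 1) * h2 + hi0
    exact (mul_eq_zero.1 this).resolve_left (by positivity)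
  have hsnd : (eps n i).2 = 0 := by
    have := eps_snd_nonneg n i
    omega
  have hfst : (eps n G).1 ≤ w.1 - w.2 := hG.fst_le hpn (by omega) hi (l := l) (by linarith)
  have hw2 : w.2 = 0 := by
    rw [hG.snd_eq, hsnd] at hG0
    nlinarith
  rw [hG.snd_eq, hsnd] at hG0
  refine Prod.ext ?_ (by rw [hw2, hG.snd_eq, hsnd])
  rw [hw2] at hfst hw
  linarith

theorem IsFrobeniusTarget.eq_eps_of_p_mul_wt_eq (hG : IsFrobeniusTarget p n i G)
    (hpn : p.Coprime n) (hp : 1 < p) (hn : 0 < n) (h1 : (n : ℤ) * l - k = p * w.1 - (eps n i).1)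
    (h2 : (m : ℤ) - k = p * w.2 - (eps n i).2) (heq : p * wt n w = i + n * (k + l + m))
    (hw : wt n w ≤ G) : w = eps n G := by
  have hi0 := eps_fst_add n i
  rcases (eps_fst_nonneg n i).eq_or_lt with hi | hi
  · have hG0 : G = 0 := eps_fst_eq_zero_iff.1 (hG.fst_eq_zero_iff.2 hi.symm)
    obtain ⟨hw1, hw2⟩ := abs_le_wt hn w
    simp only [show wt n w = 0 by omega, Nat.cast_zero, abs_nonpos_iff] at hw1 hw2
    exact Prod.ext (by simp [hw1, hG0, eps]) (by simp [hw2, hG0, eps])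
  zify at heq hw
  rcases wt_cases n w with ⟨h, -, -⟩ | ⟨h, -, -⟩ | ⟨h, hw0, -⟩ <;> rw [h] at heq hw
  · exact hG.eq_eps_of_nonneg hpn hp hi h1 h2 heq hw
  · have : (2 * (n : ℤ) + 1) * ((eps n i).1 + n * l) = 0 := by
      linear_combination -heq + 2 * n * h1 - n * h2 + hi0
    have : 0 < (2 * (n : ℤ) + 1) * ((eps n i).1 + n * l) := by positivity
    omega
  · exact hG.eq_eps_of_snd_nonpos hpn hp hn hi h1 h2 heq hw hw0

end LeadingMonomial

theorem eq_eps_of_wt_lt {n j : ℕ} {w : ℤ × ℤ} (hw : wt n w = j) (hj : j < n) : w = eps n j := by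
  obtain ⟨h1, h2, h3⟩ := le_wt n w
  rw [hw] at h1 h2 h3
  have hdiff : w.2 ≤ 2 * w.1 := by
    by_contra! hlt
    nlinarith
  have hsnd_le : w.2 ≤ 0 := by
    by_contra! hlt
    nlinarith
  have hfst : 0 ≤ w.1 := by
    by_contra! hlt
    nlinarith
  have hsnd : w.2 = 0 := by
    refine le_antisymm hsnd_le ?_
    by_contra! hlt
    nlinarith
  have hj' : (j : ℤ) = w.1 := by
    rw [← hw, wt_of_nonneg hfst hsnd.ge, hsnd, mul_zero, add_zero]
  rw [eps, if_pos hj.le, hj']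
  exact Prod.ext rfl hsnd

section Exponents

variable {p n i : ℕ}

theorem exists_lt_mul_eq {x : ℤ} (hd : (n : ℤ) ∣ x) (h0 : 0 ≤ x) (hlt : x < n * p) :
    ∃ l < p, (n : ℤ) * l = x := by
  obtain ⟨c, rfl⟩ := hd
  have hn : (0 : ℤ) < n := by
    refine (Nat.cast_nonneg n).lt_of_ne fun hn => ?_
    rw [← hn] at hlt
    simp at hlt
  lift c to ℕ using nonneg_of_mul_nonneg_right h0 hn
  exact ⟨c, by exact_mod_cast lt_of_mul_lt_mul_left hlt hn.le, rfl⟩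

theorem IsFrobeniusTarget.exists_exponents {G : ℕ} (hG : IsFrobeniusTarget p n i G) (hn : 0 < n)
    (hnp : n < p) (hi : i ≤ 2 * n) : ∃ l < p, ∃ m < p, (n : ℤ) * l = p * (eps n G).1 - (eps n i).1 ∧
      (m : ℤ) = p * (eps n G).2 - (eps n i).2 ∧ p * G = i + n * (l + m) := by
  have hi0 := eps_fst_add n i
  have hG0 := eps_fst_add n G
  have hfst_i := eps_fst_le hi
  have hfst_G := eps_fst_le hG.le
  obtain ⟨l, hl, hl'⟩ := exists_lt_mul_eq (p := p) hG.dvd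
    (by
      rcases (eps_fst_nonneg n G).eq_or_lt with h0 | h0
      · rw [← h0, hG.fst_eq_zero_iff.1 h0.symm, mul_zero, sub_zero]
      · nlinarith)
    (by
      rcases (eps_fst_nonneg n i).eq_or_lt with h0 | h0
      · rw [← h0, hG.fst_eq_zero_iff.2 h0.symm, mul_zero, sub_zero]
        exact_mod_cast Nat.mul_pos hn (hn.trans hnp)
      · nlinarith)
  obtain ⟨m, hm, hm'⟩ : ∃ m < p, (m : ℤ) = p * (eps n G).2 - (eps n i).2 := by
    have := eps_snd_nonneg n i
    have := eps_snd_le_one n i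
    rw [hG.snd_eq]
    obtain h | h : (eps n i).2 = 0 ∨ (eps n i).2 = 1 := by omega
    · exact ⟨0, by omega, by simp [h]⟩
    · exact ⟨p - 1, by omega, by rw [h]; omega⟩
  refine ⟨l, hl, m, hm, hl', hm', ?_⟩
  zify
  linear_combination -p * hG0 + hi0 - hl' - n * hm'

theorem alphaCoef_nonneg (p : ℕ) {n : ℕ} (hn : n ≠ 0) (i j : ℤ) : 0 ≤ alphaCoef p n i j := by
  rw [alphaCoef_eq_emod]
  exact Int.emod_nonneg _ (by exact_mod_cast hn)

theorem alphaCoef_lt (p : ℕ) {n : ℕ} (hn : 0 < n) (i j : ℤ) : alphaCoef p n i j < n := by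
  rw [alphaCoef_eq_emod]
  exact Int.emod_lt_of_pos _ (by exact_mod_cast hn)

theorem exists_exponents_of_alphaCoef {j α : ℕ} (hn : 0 < n) (hnp : n < p) (hi : i ≤ n) (hj : j < n)
    (hij : ¬ (i = n ∧ j = 0)) (hα : (α : ℤ) = alphaCoef p n i j) :
    ∃ l < p, (n : ℤ) * l - α = p * j - i := by
  have hn' : (0 : ℤ) < n := by exact_mod_cast hn
  have hαn : (α : ℤ) < n := hα ▸ alphaCoef_lt p hn i j
  rw [alphaCoef_eq_emod] at hα
  have hd : (n : ℤ) ∣ p * j - i + α := by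
    have h := (Int.dvd_self_sub_emod (x := (i - p * j : ℤ)) (m := n)).neg_right
    rwa [← hα, show -((i - p * j : ℤ) - α) = p * j - i + α by ring] at h
  obtain ⟨l, hl, hl'⟩ := exists_lt_mul_eq (p := p) hd
    (by
      rcases j.eq_zero_or_pos with rfl | hj0
      · rw [hα, Nat.cast_zero, mul_zero, sub_zero, Int.emod_eq_of_lt (by positivity) (by omega)]
        simp
      · nlinarith)
    (by nlinarith)
  exact ⟨l, hl, by rw [hl']; ring⟩

theorem alphaCoef_le_of_mul_sub_eq {j k l : ℕ} (h : (n : ℤ) * l - k = p * j - i) :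
    alphaCoef p n i j ≤ k := by
  rw [alphaCoef_eq_emod, show (i - p * j : ℤ) = k + n * (-l) by linarith,
    Int.add_mul_emod_self_left]
  exact_mod_cast Nat.mod_le k n

theorem add_add_lt_of_ne {k l m k' l' m' : ℕ} (hn : 0 < n) (h1 : (n : ℤ) * l' - k' = n * l - k)
    (h2 : (m' : ℤ) - k' = m - k) (hk : k ≤ k') (hne : (k', l', m') ≠ (k, l, m)) :
    k + l + m < k' + l' + m' := by
  have hll : (l : ℤ) ≤ l' := by
    refine le_of_mul_le_mul_left (a := (n : ℤ)) ?_ (by exact_mod_cast hn)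
    omega
  refine lt_of_le_of_ne (by omega) fun heq => hne ?_
  rw [Prod.mk.injEq, Prod.mk.injEq]
  omega

end Exponents

/-! ### The Frobenius matrix -/

section FrobeniusMatrix

variable {K : Type*} [NormedField K]

/-- The hypotheses on the constants under which the Frobenius matrix is computed: those on the
operators `D_x` and `D_y`, and estimates for the coefficients of `Θ_∞`. -/
structure FrobeniusData (p n : ℕ) (γt tb : K) (σ : K ≃+* K) : Prop
    extends OperatorData p n γt tb σ where
  coprime : Nat.Coprime p n
  norm_theta_le : ∀ k, ‖thetaCoeff p (γt ^ n) k‖ ≤ ‖γt‖ ^ (n * k)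
  norm_theta_eq : ∀ k < p, ‖thetaCoeff p (γt ^ n) k‖ = ‖γt‖ ^ (n * k)
  norm_symm : ∀ x, ‖σ.symm x‖ = ‖x‖

/-- The coefficient of `(tb/(xy))^k (x^n)^l y^m` in the product
`Θ_∞(x^n) Θ_∞(y) Θ_∞(tb/(xy))`, where `s = (k,l,m)`. -/
def thetaTerm (p n : ℕ) (γt tb : K) (s : ℕ × ℕ × ℕ) : K :=
  thetaCoeff p (γt ^ n) s.1 * tb ^ s.1 * thetaCoeff p (γt ^ n) s.2.1 * thetaCoeff p (γt ^ n) s.2.2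

theorem Bcoeff_eq_tsum (p n : ℕ) (γt tb : K) (u : ℤ × ℤ) :
    Bcoeff p n γt tb u = ∑' s : ℕ × ℕ × ℕ,
      if (n : ℤ) * s.2.1 - s.1 = u.1 ∧ (s.2.2 : ℤ) - s.1 = u.2 then thetaTerm p n γt tb s else 0 :=
  rfl

theorem summable_pow_mul_add_add {r : ℝ} (h0 : 0 ≤ r) (h1 : r < 1) {n : ℕ} (hn : n ≠ 0) :
    Summable fun s : ℕ × ℕ × ℕ => r ^ (n * (s.1 + s.2.1 + s.2.2)) := by
  have hgeom : Summable fun k : ℕ => (r ^ n) ^ k :=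
    summable_geometric_of_lt_one (by positivity) (pow_lt_one₀ h0 h1 hn)
  have hnonneg : 0 ≤ fun k : ℕ => (r ^ n) ^ k := fun k => by positivity
  refine (hgeom.mul_of_nonneg (hgeom.mul_of_nonneg hgeom hnonneg hnonneg) hnonneg
    fun s => mul_nonneg (hnonneg _) (hnonneg _)).congr fun s => ?_
  ring

theorem alpha1_mono_eps (p n : ℕ) (γt tb : K) (σ : K ≃+* K) (i : ℕ) (w : ℤ × ℤ) :
    alpha1 p n γt tb σ (mono n γt (eps n i)) w
      = σ.symm (Bcoeff p n γt tb (p * w.1 - (eps n i).1, p * w.2 - (eps n i).2) * γt ^ i) := by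
  rw [alpha1, psi, mulF, tsum_eq_single (eps n i)]
  · rw [mono, Pi.single_eq_same, zpow_nwt, wt_eps]
    rfl
  · intro v hv
    rw [mono, Pi.single_eq_of_ne hv, mul_zero]

namespace FrobeniusData

variable {p n : ℕ} {γt tb : K} {σ : K ≃+* K}

theorem norm_thetaTerm_le (h : FrobeniusData p n γt tb σ) (s : ℕ × ℕ × ℕ) :
    ‖thetaTerm p n γt tb s‖ ≤ ‖γt‖ ^ (n * (s.1 + s.2.1 + s.2.2)) := by
  have h1 := h.norm_theta_le s.1
  have h2 := h.norm_theta_le s.2.1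
  have h3 := h.norm_theta_le s.2.2
  rw [thetaTerm, norm_mul, norm_mul, norm_mul, norm_pow, h.norm_t, one_pow, mul_one, mul_add,
    mul_add, pow_add, pow_add]
  gcongr

theorem norm_thetaTerm_eq (h : FrobeniusData p n γt tb σ) {k l m : ℕ} (hk : k < p) (hl : l < p)
    (hm : m < p) : ‖thetaTerm p n γt tb (k, l, m)‖ = ‖γt‖ ^ (n * (k + l + m)) := by
  rw [thetaTerm, norm_mul, norm_mul, norm_mul, norm_pow, h.norm_t, one_pow, mul_one,
    h.norm_theta_eq k hk, h.norm_theta_eq l hl, h.norm_theta_eq m hm, mul_add, mul_add, pow_add,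
    pow_add]

theorem summable_Bcoeff [CompleteSpace K] (h : FrobeniusData p n γt tb σ) (u : ℤ × ℤ) :
    Summable fun s : ℕ × ℕ × ℕ =>
      if (n : ℤ) * s.2.1 - s.1 = u.1 ∧ (s.2.2 : ℤ) - s.1 = u.2 then thetaTerm p n γt tb s
      else 0 := by
  refine Summable.of_norm_bounded (summable_pow_mul_add_add (norm_nonneg γt) h.norm_lt_one
    (n := n) (by have := h.two_le; omega)) fun s => ?_
  split_ifs
  · exact h.norm_thetaTerm_le s
  · rw [norm_zero]
    positivity

theorem norm_alpha1_mono_eps (h : FrobeniusData p n γt tb σ) (i : ℕ) (w : ℤ × ℤ) :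
    ‖alpha1 p n γt tb σ (mono n γt (eps n i)) w‖
      = ‖Bcoeff p n γt tb (p * w.1 - (eps n i).1, p * w.2 - (eps n i).2)‖ * ‖γt‖ ^ i := by
  rw [alpha1_mono_eps, h.norm_symm, norm_mul, norm_pow]

theorem norm_le_pow_of_norm_mul_pow_le (h : FrobeniusData p n γt tb σ) {x : K} {j e : ℕ}
    (hx : ‖x * γt ^ j‖ ≤ ‖γt‖ ^ (p * j + e)) : ‖x‖ ≤ ‖γt‖ ^ ((p - 1) * j + e) := by
  have hp : p = p - 1 + 1 := by have := h.three_le; omega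
  rw [hp, add_one_mul, add_right_comm, pow_add, norm_mul, norm_pow] at hx
  exact le_of_mul_le_mul_right hx (pow_pos h.norm_pos j)

theorem norm_eq_pow_of_norm_mul_pow_eq (h : FrobeniusData p n γt tb σ) {x : K} {j e : ℕ}
    (hx : ‖x * γt ^ j‖ = ‖γt‖ ^ (p * j + e)) : ‖x‖ = ‖γt‖ ^ ((p - 1) * j + e) := by
  have hp : p = p - 1 + 1 := by have := h.three_le; omega
  rw [hp, add_one_mul, add_right_comm, pow_add, norm_mul, norm_pow] at hx
  exact mul_right_cancel₀ (pow_pos h.norm_pos j).ne' hx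

variable [IsUltrametricDist K]

theorem norm_Bcoeff_le (h : FrobeniusData p n γt tb σ) {u : ℤ × ℤ} {e : ℕ}
    (he : ∀ k l m : ℕ, (n : ℤ) * l - k = u.1 → (m : ℤ) - k = u.2 → e ≤ n * (k + l + m)) :
    ‖Bcoeff p n γt tb u‖ ≤ ‖γt‖ ^ e := by
  rw [Bcoeff_eq_tsum]
  refine IsUltrametricDist.norm_tsum_le_of_forall_le_of_nonneg (by positivity) fun s => ?_
  split_ifs with hs
  · exact (h.norm_thetaTerm_le s).trans
      (pow_le_pow_of_le_one (norm_nonneg _) h.norm_lt_one.le (he _ _ _ hs.1 hs.2))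
  · rw [norm_zero]
    positivity

theorem norm_alpha1_mono_eps_le (h : FrobeniusData p n γt tb σ) {i e : ℕ} {w : ℤ × ℤ}
    (he : ∀ k l m : ℕ, (n : ℤ) * l - k = p * w.1 - (eps n i).1 →
      (m : ℤ) - k = p * w.2 - (eps n i).2 → e ≤ i + n * (k + l + m)) :
    ‖alpha1 p n γt tb σ (mono n γt (eps n i)) w‖ ≤ ‖γt‖ ^ e := by
  have hB : ‖Bcoeff p n γt tb (p * w.1 - (eps n i).1, p * w.2 - (eps n i).2)‖ ≤ ‖γt‖ ^ (e - i) :=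
    h.norm_Bcoeff_le fun k l m h1 h2 => by
      have := he k l m h1 h2
      omega
  calc ‖alpha1 p n γt tb σ (mono n γt (eps n i)) w‖
      ≤ ‖γt‖ ^ (e - i) * ‖γt‖ ^ i := by
        rw [h.norm_alpha1_mono_eps]
        gcongr
    _ = ‖γt‖ ^ (e - i + i) := (pow_add _ _ _).symm
    _ ≤ ‖γt‖ ^ e := pow_le_pow_of_le_one (norm_nonneg _) h.norm_lt_one.le (by omega)

theorem wtBound_alpha1_mono_eps (h : FrobeniusData p n γt tb σ) (i : ℕ) :
    WtBound n γt p 1 (alpha1 p n γt tb σ (mono n γt (eps n i))) := fun w => by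
  rw [one_mul]
  exact h.norm_alpha1_mono_eps_le fun k l m h1 h2 => p_mul_wt_le h1 h2

theorem norm_alpha1_mono_eps_le_succ (h : FrobeniusData p n γt tb σ) {i G j : ℕ} {w : ℤ × ℤ}
    (hG : IsFrobeniusTarget p n i G) (hj : j ≤ G) (hw : wt n w = j) (hne : w ≠ eps n G) :
    ‖alpha1 p n γt tb σ (mono n γt (eps n i)) w‖ ≤ ‖γt‖ ^ (p * j + 1) := by
  subst hw
  refine h.norm_alpha1_mono_eps_le fun k l m h1 h2 =>
    Nat.succ_le_of_lt ((p_mul_wt_le h1 h2).lt_of_ne fun heq => hne ?_)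
  exact hG.eq_eps_of_p_mul_wt_eq h.coprime (by have := h.three_le; omega)
    (by have := h.two_le; omega) h1 h2 heq hj

variable [CompleteSpace K]

/-- The exponents of the terms that contribute to the coefficient at `u` are
`(k + n s, l + s, m + n s)`, so the term with the least `k` dominates. -/
theorem norm_Bcoeff_eq (h : FrobeniusData p n γt tb σ) {u : ℤ × ℤ} {k l m : ℕ}
    (h1 : (n : ℤ) * l - k = u.1) (h2 : (m : ℤ) - k = u.2) (hk : k < p) (hl : l < p) (hm : m < p)
    (hmin : ∀ k' l' : ℕ, (n : ℤ) * l' - k' = u.1 → k ≤ k') :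
    ‖Bcoeff p n γt tb u‖ = ‖γt‖ ^ (n * (k + l + m)) := by
  have hn : 0 < n := by have := h.two_le; omega
  have hlead := h.norm_thetaTerm_eq hk hl hm
  rw [← hlead]
  refine norm_eq_of_norm_sub_lt ?_
  rw [Bcoeff_eq_tsum, (h.summable_Bcoeff u).tsum_eq_add_tsum_ite (k, l, m), if_pos ⟨h1, h2⟩,
    add_sub_cancel_left, hlead]
  refine lt_of_le_of_lt (b := ‖γt‖ ^ (n * (k + l + m) + 1)) ?_
    (pow_lt_pow_right_of_lt_one₀ h.norm_pos h.norm_lt_one (Nat.lt_succ_self _))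
  refine IsUltrametricDist.norm_tsum_le_of_forall_le_of_nonneg (by positivity) fun s => ?_
  split_ifs with hs hu
  · rw [norm_zero]
    positivity
  · refine (h.norm_thetaTerm_le s).trans
      (pow_le_pow_of_le_one (norm_nonneg _) h.norm_lt_one.le (Nat.mul_lt_mul_of_pos_left ?_ hn))
    exact add_add_lt_of_ne hn (hu.1.trans h1.symm) (hu.2.trans h2.symm) (hmin _ _ hu.1) hs
  · rw [norm_zero]
    positivity

theorem norm_alpha1_mono_eps_of_exponents (h : FrobeniusData p n γt tb σ) {i k l m : ℕ}
    {w : ℤ × ℤ} (h1 : (n : ℤ) * l - k = p * w.1 - (eps n i).1)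
    (h2 : (m : ℤ) - k = p * w.2 - (eps n i).2) (hk : k < p) (hl : l < p) (hm : m < p)
    (hmin : ∀ k' l' : ℕ, (n : ℤ) * l' - k' = p * w.1 - (eps n i).1 → k ≤ k') :
    ‖alpha1 p n γt tb σ (mono n γt (eps n i)) w‖ = ‖γt‖ ^ (i + n * (k + l + m)) := by
  rw [h.norm_alpha1_mono_eps, h.norm_Bcoeff_eq h1 h2 hk hl hm hmin, ← pow_add, add_comm]

theorem norm_alpha1_mono_eps_target (h : FrobeniusData p n γt tb σ) {i G : ℕ} (hi : i ≤ 2 * n)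
    (hG : IsFrobeniusTarget p n i G) :
    ‖alpha1 p n γt tb σ (mono n γt (eps n i)) (eps n G)‖ = ‖γt‖ ^ (p * G) := by
  obtain ⟨l, hl, m, hm, h1, h2, hsum⟩ :=
    hG.exists_exponents (by have := h.two_le; omega) h.lt hi
  rw [h.norm_alpha1_mono_eps_of_exponents (k := 0) (by simpa using h1) (by simpa using h2)
    (by have := h.three_le; omega) hl hm fun _ _ _ => Nat.zero_le _, zero_add, hsum]

theorem norm_alpha1_mono_eps_of_alphaCoef (h : FrobeniusData p n γt tb σ) {i j α : ℕ} (hi : i ≤ n)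
    (hj : j < n) (hij : ¬ (i = n ∧ j = 0)) (hα : (α : ℤ) = alphaCoef p n i j) :
    ‖alpha1 p n γt tb σ (mono n γt (eps n i)) (eps n j)‖
      = ‖γt‖ ^ (p * j + (2 * n + 1) * α) := by
  have hn : 0 < n := by have := h.two_le; omega
  have hαn : (α : ℤ) < n := hα ▸ alphaCoef_lt p hn i j
  have hαp : α < p := by have := h.lt; omega
  obtain ⟨l, hl, hl'⟩ := exists_exponents_of_alphaCoef hn h.lt hi hj hij hα
  have hi' : eps n i = ((i : ℤ), 0) := by rw [eps, if_pos hi]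
  have hj' : eps n j = ((j : ℤ), 0) := by rw [eps, if_pos hj.le]
  rw [h.norm_alpha1_mono_eps_of_exponents (k := α) (l := l) (m := α) (by rw [hi', hj']; exact hl')
    (by simp [hi', hj']) hαp hl hαp fun k' l' hkl => ?_]
  · congr 1
    zify
    linear_combination hl'
  · rw [hi', hj'] at hkl
    exact_mod_cast hα.trans_le (alphaCoef_le_of_mul_sub_eq hkl)

theorem exists_isFrobeniusMatrix (h : FrobeniusData p n γt tb σ) :
    ∃ A : Matrix (Fin (2 * n + 1)) (Fin (2 * n + 1)) K, IsFrobeniusMatrix p n γt tb σ A ∧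
      (∀ j i, ‖A j i * γt ^ (j : ℕ)‖ ≤ ‖γt‖ ^ (p * (j : ℕ))) ∧
      ∀ (j i : Fin (2 * n + 1)) (e : ℕ), e ≤ p * j + (p - 1) →
        (∀ w, wt n w = j → w ≠ eps n j →
          ‖alpha1 p n γt tb σ (mono n γt (eps n i)) w‖ ≤ ‖γt‖ ^ e) →
        ‖A j i * γt ^ (j : ℕ) - alpha1 p n γt tb σ (mono n γt (eps n i)) (eps n j)‖
          ≤ ‖γt‖ ^ e := by
  have hp : p - 1 + 1 = p := by have := h.three_le; omega
  have hγ := h.norm_pos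
  have hβ := h.wtBound_alpha1_mono_eps
  have hβ2 : ∀ i, WtBound n γt 2 1 (alpha1 p n γt tb σ (mono n γt (eps n i))) := fun i u =>
    (hβ i u).trans (mul_le_mul_of_nonneg_left (pow_le_pow_of_le_one hγ.le h.norm_lt_one.le
      (Nat.mul_le_mul_right _ (by have := h.three_le; omega))) zero_le_one)
  choose v z hvz hz hv hlead using fun i : Fin (2 * n + 1) =>
    h.toOperatorData.exists_reduction (hβ2 i)
  have hvp : ∀ i j, ‖v i j‖ ≤ ‖γt‖ ^ (p * (j : ℕ)) := fun i j => by
    simpa [hp] using hv i (p - 1) 1 hp.le (by rw [hp]; exact hβ i) j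
  have hcancel : ∀ i j : Fin (2 * n + 1), v i j / γt ^ (j : ℕ) * γt ^ (j : ℕ) = v i j :=
    fun i j => div_mul_cancel₀ _ (pow_ne_zero _ h.gt_ne_zero)
  refine ⟨fun j i => v i j / γt ^ (j : ℕ), ⟨fun j i => ?_, fun i => eqInH2_iff.2 ⟨z i, fun l =>
    mem_C0_of_wtBound (by have := h.two_le; omega) hγ h.norm_lt_one (hz i l), ?_⟩⟩,
    fun j i => ?_, fun j i e he hw => ?_⟩
  · refine (h.norm_le_pow_of_norm_mul_pow_le (j := j) (e := 0) ?_).trans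
      (pow_le_one₀ hγ.le h.norm_lt_one.le)
    rw [hcancel]
    exact hvp i j
  · rw [sum_smul_mono]
    simp only [hcancel]
    exact sub_eq_of_eq_add' (hvz i)
  · rw [hcancel]
    exact hvp i j
  · rw [hcancel]
    exact hlead i 1 (hβ i) j _
      (by rw [one_mul]; exact pow_le_pow_of_le_one hγ.le h.norm_lt_one.le he) hw

variable {A : Matrix (Fin (2 * n + 1)) (Fin (2 * n + 1)) K} {i j : Fin (2 * n + 1)}

theorem norm_matrix_le (h : FrobeniusData p n γt tb σ) (hA : IsFrobeniusMatrix p n γt tb σ A) :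
    ‖A j i‖ ≤ ‖γt‖ ^ ((p - 1) * (j : ℕ)) := by
  obtain ⟨A', hA', hle, -⟩ := h.exists_isFrobeniusMatrix
  rw [h.isFrobeniusMatrix_unique hA' hA]
  exact h.norm_le_pow_of_norm_mul_pow_le (e := 0) (hle j i)

theorem norm_matrix_mul_sub_le (h : FrobeniusData p n γt tb σ)
    (hA : IsFrobeniusMatrix p n γt tb σ A) {e : ℕ} (he : e ≤ p * j + (p - 1))
    (hw : ∀ w, wt n w = j → w ≠ eps n j →
      ‖alpha1 p n γt tb σ (mono n γt (eps n i)) w‖ ≤ ‖γt‖ ^ e) :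
    ‖A j i * γt ^ (j : ℕ) - alpha1 p n γt tb σ (mono n γt (eps n i)) (eps n j)‖ ≤ ‖γt‖ ^ e := by
  obtain ⟨A', hA', -, hsub⟩ := h.exists_isFrobeniusMatrix
  rw [h.isFrobeniusMatrix_unique hA' hA]
  exact hsub j i e he hw

theorem norm_matrix_le_of_lt_g (h : FrobeniusData p n γt tb σ)
    (hA : IsFrobeniusMatrix p n γt tb σ A) (hj : (j : ℤ) < g p n i) :
    ‖A j i‖ ≤ ‖γt‖ ^ ((p - 1) * (j : ℕ) + 1) := by
  obtain ⟨G, hGg, hG⟩ := exists_isFrobeniusTarget h.two_le h.coprime (Nat.lt_succ_iff.1 i.2)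
  have hjG : (j : ℕ) < G := by rw [← hGg] at hj; exact_mod_cast hj
  have hα : ∀ w, wt n w = j →
      ‖alpha1 p n γt tb σ (mono n γt (eps n i)) w‖ ≤ ‖γt‖ ^ (p * (j : ℕ) + 1) := fun w hw => by
    refine h.norm_alpha1_mono_eps_le_succ hG hjG.le hw ?_
    rintro rfl
    rw [wt_eps] at hw
    omega
  have hsub := h.norm_matrix_mul_sub_le hA (by have := h.three_le; omega) fun w hw _ => hα w hw
  have hadd := norm_add_le_of_norm_le hsub (hα _ (wt_eps n j))
  rw [sub_add_cancel] at hadd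
  exact h.norm_le_pow_of_norm_mul_pow_le hadd

theorem norm_matrix_eq_of_eq_g (h : FrobeniusData p n γt tb σ)
    (hA : IsFrobeniusMatrix p n γt tb σ A) (hj : (j : ℤ) = g p n i) :
    ‖A j i‖ = ‖γt‖ ^ ((p - 1) * (j : ℕ)) := by
  have hi := Nat.lt_succ_iff.1 i.2
  obtain ⟨G, hGg, hG⟩ := exists_isFrobeniusTarget h.two_le h.coprime hi
  obtain rfl : (j : ℕ) = G := by rw [← hGg] at hj; exact_mod_cast hj
  have hα := h.norm_alpha1_mono_eps_target hi hG
  have hsub := h.norm_matrix_mul_sub_le hA (e := p * j + 1) (by have := h.three_le; omega)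
    fun w hw hne => h.norm_alpha1_mono_eps_le_succ hG le_rfl hw hne
  refine h.norm_eq_pow_of_norm_mul_pow_eq (e := 0) ((norm_eq_of_norm_sub_lt ?_).trans hα)
  rw [hα]
  exact hsub.trans_lt
    (pow_lt_pow_right_of_lt_one₀ h.norm_pos h.norm_lt_one (Nat.lt_succ_self _))

theorem norm_matrix_eq_of_alphaCoef (h : FrobeniusData p n γt tb σ)
    (hA : IsFrobeniusMatrix p n γt tb σ A) (hp : 2 * n ^ 2 - n < (p : ℤ)) (hi : (i : ℕ) ≤ n)
    (hj : (j : ℕ) < n) (hij : ¬ ((i : ℕ) = n ∧ (j : ℕ) = 0)) {α : ℕ}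
    (hα : (α : ℤ) = alphaCoef p n i j) :
    ‖A j i‖ = ‖γt‖ ^ ((p - 1) * (j : ℕ) + (2 * n + 1) * α) := by
  have hlt : (2 * n + 1) * α < p - 1 := by
    have hαn : (α : ℤ) < n := hα ▸ alphaCoef_lt p (by omega) i j
    have := h.three_le
    zify [show 1 ≤ p by omega]
    nlinarith
  have hαlead := h.norm_alpha1_mono_eps_of_alphaCoef hi hj hij hα
  have hsub := h.norm_matrix_mul_sub_le (i := i) hA le_rfl
    fun w hw hne => absurd (eq_eps_of_wt_lt hw hj) hne
  refine h.norm_eq_pow_of_norm_mul_pow_eq ((norm_eq_of_norm_sub_lt ?_).trans hαlead)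
  rw [hαlead]
  exact hsub.trans_lt (pow_lt_pow_right_of_lt_one₀ h.norm_pos h.norm_lt_one (by omega))

end FrobeniusData

end FrobeniusMatrix

/-! ### The field `ℚ_q(ζ_p, γ̃)` -/

section Valuation

variable {K : Type*} [NormedField K] {p n : ℕ} {x y : K}

theorem norm_pow_eq_of_ordp_eq (hp : 1 < p)
    (h : ordp p x = ((1 / ((p : ℝ) - 1) : ℝ) : EReal)) : ‖x‖ ^ (p - 1) = (p : ℝ)⁻¹ := by
  have hp' : (1 : ℝ) < p := by exact_mod_cast hp
  have hx : x ≠ 0 := by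
    rintro rfl
    rw [ordp, if_pos rfl] at h
    exact EReal.top_ne_coe _ h
  rw [ordp, if_neg hx, EReal.coe_eq_coe_iff, neg_eq_iff_eq_neg] at h
  refine Real.logb_injOn_pos hp' (Set.mem_Ioi.2 (by positivity)) (Set.mem_Ioi.2 (by positivity)) ?_
  rw [Real.logb_pow, Real.logb_inv, Real.logb_self_eq_one hp', h, Nat.cast_sub hp.le, Nat.cast_one,
    mul_neg, mul_one_div_cancel (sub_pos.2 hp').ne']

theorem norm_pos_of_norm_pow_eq_inv (hp : p ≠ 0) {N : ℕ} (hN : N ≠ 0)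
    (hx : ‖x‖ ^ N = (p : ℝ)⁻¹) : 0 < ‖x‖ := by
  refine (norm_nonneg x).lt_of_ne fun h0 => ?_
  rw [← h0, zero_pow hN, eq_comm, inv_eq_zero] at hx
  exact hp (by exact_mod_cast hx)

theorem norm_lt_one_of_norm_pow_eq_inv (hp : 1 < p) {N : ℕ}
    (hx : ‖x‖ ^ N = (p : ℝ)⁻¹) : ‖x‖ < 1 := by
  refine lt_of_pow_lt_pow_left₀ N zero_le_one ?_
  rw [hx, one_pow]
  exact inv_lt_one_of_one_lt₀ (by exact_mod_cast hp)

theorem neg_logb_norm_pow (hp : 1 < p) (hn : 0 < n) (hx : ‖x‖ ^ (n * (p - 1)) = (p : ℝ)⁻¹)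
    (j e : ℕ) :
    -Real.logb p (‖x‖ ^ ((p - 1) * j + e)) = (j : ℝ) / n + e / (n * ((p : ℝ) - 1)) := by
  have hp' : (1 : ℝ) < p := by exact_mod_cast hp
  have hp1 : (p : ℝ) - 1 ≠ 0 := (sub_pos.2 hp').ne'
  have hn' : (n : ℝ) ≠ 0 := by exact_mod_cast hn.ne'
  have h := congrArg (Real.logb p) hx
  rw [Real.logb_pow, Real.logb_inv, Real.logb_self_eq_one hp'] at h
  push_cast [Nat.cast_sub hp.le] at h
  rw [Real.logb_pow, eq_div_of_mul_eq (mul_ne_zero hn' hp1) ((mul_comm _ _).trans h)]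
  push_cast [Nat.cast_sub hp.le]
  field_simp

theorem ordp_of_norm_eq_pow (hp : 1 < p) (hn : 0 < n) (hx : ‖x‖ ^ (n * (p - 1)) = (p : ℝ)⁻¹)
    {j e : ℕ} (hy : ‖y‖ = ‖x‖ ^ ((p - 1) * j + e)) :
    ordp p y = (((j : ℝ) / n + e / (n * ((p : ℝ) - 1)) : ℝ) : EReal) := by
  have hx0 : 0 < ‖x‖ :=
    norm_pos_of_norm_pow_eq_inv (by omega) (Nat.mul_ne_zero hn.ne' (Nat.sub_ne_zero_of_lt hp)) hx
  have hy0 : y ≠ 0 := by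
    rw [← norm_pos_iff, hy]
    positivity
  rw [ordp, if_neg hy0, hy, neg_logb_norm_pow hp hn hx]

theorem le_ordp_of_norm_le_pow (hp : 1 < p) (hn : 0 < n) (hx : ‖x‖ ^ (n * (p - 1)) = (p : ℝ)⁻¹)
    {j e : ℕ} (hy : ‖y‖ ≤ ‖x‖ ^ ((p - 1) * j + e)) :
    (((j : ℝ) / n + e / (n * ((p : ℝ) - 1)) : ℝ) : EReal) ≤ ordp p y := by
  rw [ordp]
  split_ifs with hy0
  · exact le_top
  · rw [EReal.coe_le_coe_iff, ← neg_logb_norm_pow hp hn hx]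
    exact neg_le_neg
      (Real.logb_le_logb_of_le (by exact_mod_cast hp) (norm_pos_iff.2 hy0) hy)

theorem antitone_pow_mul_pow (hp : 1 < p) {r : ℝ} (h0 : 0 ≤ r) (h1 : r ≤ 1)
    (hr : r ^ (p - 1) = (p : ℝ)⁻¹) : Antitone fun k : ℕ => r ^ p ^ k * (p : ℝ) ^ k := by
  refine antitone_nat_of_succ_le fun k => ?_
  have hp0 : (p : ℝ) ≠ 0 := by exact_mod_cast (by omega : p ≠ 0)
  have hexp : p ^ k + (p - 1) ≤ p ^ (k + 1) := by
    obtain ⟨s, rfl⟩ : ∃ s, p = s + 1 := ⟨p - 1, by omega⟩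
    have : 1 ≤ (s + 1) ^ k := Nat.one_le_pow _ _ (by omega)
    rw [pow_succ, Nat.add_sub_cancel]
    nlinarith
  calc r ^ p ^ (k + 1) * (p : ℝ) ^ (k + 1)
      ≤ r ^ (p ^ k + (p - 1)) * (p : ℝ) ^ (k + 1) :=
        mul_le_mul_of_nonneg_right (pow_le_pow_of_le_one h0 h1 hexp) (by positivity)
    _ = r ^ p ^ k * (p : ℝ) ^ k := by
        rw [pow_add, hr, pow_succ, mul_assoc, mul_comm ((p : ℝ) ^ k), inv_mul_cancel_left₀ hp0]

/-- As the series `∑ γ^(p^k)/p^k` vanishes, `γ_i` is minus the remainder after its `i`-th term. -/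
theorem norm_gammaSeq_le [IsUltrametricDist K] (hp : 1 < p) (hpK : ‖(p : K)‖ = (p : ℝ)⁻¹)
    (hx : ‖x‖ ^ (p - 1) = (p : ℝ)⁻¹) (hsum : HasSum (fun k : ℕ => x ^ p ^ k / (p : K) ^ k) 0)
    (i : ℕ) : ‖gammaSeq p x i * (p : K) ^ i‖ * ‖x‖ ^ (p - 1) ≤ ‖x‖ ^ p ^ (i + 1) := by
  have : (0 : ℝ) < p := by exact_mod_cast (by omega : 0 < p)
  have hanti := antitone_pow_mul_pow hp (norm_nonneg x) (norm_lt_one_of_norm_pow_eq_inv hp hx).le hx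
  have hrem : -gammaSeq p x i = ∑' k : ℕ, x ^ p ^ (k + (i + 1)) / (p : K) ^ (k + (i + 1)) := by
    rw [((hasSum_nat_add_iff' (i + 1)).2 hsum).tsum_eq, gammaSeq, zero_sub]
  have hle : ‖gammaSeq p x i‖ ≤ ‖x‖ ^ p ^ (i + 1) * (p : ℝ) ^ (i + 1) := by
    rw [← norm_neg, hrem]
    refine IsUltrametricDist.norm_tsum_le_of_forall_le_of_nonneg (by positivity) fun k => ?_
    rw [norm_div, norm_pow, norm_pow, hpK, inv_pow, div_inv_eq_mul]
    exact hanti (Nat.le_add_left (i + 1) k)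
  rwa [norm_mul, norm_pow, hpK, hx, mul_assoc, ← pow_succ, inv_pow, ← div_eq_mul_inv,
    div_le_iff₀ (by positivity)]

end Valuation

section PadicAlgebra

variable {p : ℕ} [Fact p.Prime] {K : Type*} [NormedField K] [NormedAlgebra ℚ_[p] K]

variable (p K) in
theorem norm_ratCast_eq (q : ℚ) : ‖(q : K)‖ = ‖(q : ℚ_[p])‖ := by
  rw [← norm_algebraMap' K (q : ℚ_[p]), map_ratCast]

variable (p K) in
theorem norm_natCast_eq (m : ℕ) : ‖(m : K)‖ = ‖(m : ℚ_[p])‖ := by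
  exact_mod_cast norm_ratCast_eq p K m

theorem norm_thetaCoeff_le (γ : K) (k : ℕ) : ‖thetaCoeff p γ k‖ ≤ ‖γ‖ ^ k := by
  rw [thetaCoeff, norm_mul, norm_pow, norm_ratCast_eq p K]
  exact mul_le_of_le_one_left (by positivity) (norm_coeff_artinHasse_le k)

theorem norm_thetaCoeff_of_lt (γ : K) {k : ℕ} (hk : k < p) : ‖thetaCoeff p γ k‖ = ‖γ‖ ^ k := by
  have hfac : ‖(k.factorial : ℚ_[p])‖ = 1 := by
    rw [Padic.norm_natCast_eq_one_iff]
    exact Nat.Prime.coprime_factorial_of_lt Fact.out hk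
  rw [thetaCoeff, norm_mul, norm_pow, norm_ratCast_eq p K, coeff_artinHasse_of_lt hk]
  push_cast
  rw [norm_div, norm_one, hfac, div_one, one_mul]

theorem frobeniusData_of_hasSum {n : ℕ} (hn : 2 ≤ n) (hpn : n < p) [IsUltrametricDist K]
    {γt tb : K} {σ : K ≃+* K} (hσ : ∀ x, ‖σ x‖ = ‖x‖) (htb : ‖tb‖ = 1)
    (hγt : ‖γt‖ ^ (n * (p - 1)) = (p : ℝ)⁻¹)
    (hsum : HasSum (fun k : ℕ => (γt ^ n) ^ p ^ k / (p : K) ^ k) 0) :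
    FrobeniusData p n γt tb σ where
  two_le := hn
  norm_pos := norm_pos_of_norm_pow_eq_inv (by omega)
    (Nat.mul_ne_zero (by omega) (Nat.sub_ne_zero_of_lt (by omega))) hγt
  norm_lt_one := norm_lt_one_of_norm_pow_eq_inv (by omega) hγt
  norm_natCast := by
    rw [norm_natCast_eq p, Padic.norm_natCast_eq_one_iff]
    exact Nat.coprime_of_lt_prime (by omega) hpn Fact.out
  norm_t := htb
  lt := hpn
  norm_iterate i := by
    induction i with
    | zero => exact htb
    | succ i ih => rw [Function.iterate_succ_apply', hσ, ih]
  norm_gammaSeq i := by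
    rw [pow_mul, pow_mul, ← norm_pow]
    exact norm_gammaSeq_le (by omega) (by rw [norm_natCast_eq p, Padic.norm_p])
      (by rw [norm_pow, ← pow_mul, hγt]) hsum i
  coprime := Nat.coprime_of_lt_prime (by omega) hpn Fact.out
  norm_theta_le k := by
    rw [pow_mul, ← norm_pow]
    exact norm_thetaCoeff_le _ k
  norm_theta_eq k hk := by
    rw [pow_mul, ← norm_pow]
    exact norm_thetaCoeff_of_lt _ hk
  norm_symm x := by rw [← hσ, σ.apply_symm_apply]

end PadicAlgebra

section Omega

theorem finite_setOf_pow_eq_self (F : Type*) [Field F] {m : ℕ} (hm : 1 < m) :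
    {z : F | z ^ m = z}.Finite := by
  refine (Polynomial.rootSet_finite (Polynomial.X ^ m - Polynomial.X : Polynomial F) F).subset
    fun z hz => ?_
  rw [Polynomial.mem_rootSet]
  exact ⟨FiniteField.X_pow_card_sub_X_ne_zero F hm, by simpa [sub_eq_zero] using hz⟩

theorem isIntegral_of_pow_eq_self {R A : Type*} [CommRing R] [Ring A] [Algebra R A] {m : ℕ}
    (hm : 1 < m) {z : A} (hz : z ^ m = z) : IsIntegral R z := by
  nontriviality R
  refine ⟨Polynomial.X ^ m - Polynomial.X, Polynomial.monic_X_pow_sub ?_, by simp [hz]⟩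
  rw [Polynomial.degree_X]
  exact_mod_cast hm

theorem norm_algEquiv {F L : Type*} [NontriviallyNormedField F] [CompleteSpace F]
    [IsUltrametricDist F] [NormedField L] [NormedAlgebra F L] [Algebra.IsAlgebraic F L]
    (σ : L ≃ₐ[F] L) (x : L) : ‖σ x‖ = ‖x‖ := by
  rw [NormedAlgebra.norm_eq_spectralNorm F, NormedAlgebra.norm_eq_spectralNorm F,
    ← spectralNorm_eq_of_equiv]

variable {p : ℕ} [Fact p.Prime] {ζ γ γt : ℂ_[p]}

theorem isIntegral_of_mem_adjoin (hζ : IsIntegral ℚ_[p] ζ)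
    (hγ : γ ∈ IntermediateField.adjoin ℚ_[p] {ζ}) : IsIntegral ℚ_[p] γ := by
  have := IntermediateField.isAlgebraic_adjoin_simple hζ
  exact (Algebra.IsIntegral.isIntegral (R := ℚ_[p])
    (⟨γ, hγ⟩ : IntermediateField.adjoin ℚ_[p] {ζ})).map (IntermediateField.adjoin ℚ_[p] {ζ}).val

theorem finiteDimensional_Omega {n a : ℕ} (hn : 0 < n) (ha : a ≠ 0) (hζ : IsPrimitiveRoot ζ p)
    (hγ : IsDworkRoot p ζ γ) (hγt : γt ^ n = γ) :
    FiniteDimensional ℚ_[p] (Omega p a ζ γt) := by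
  have hp : p.Prime := Fact.out
  have hq : 1 < p ^ a := Nat.one_lt_pow ha hp.one_lt
  have hζi : IsIntegral ℚ_[p] ζ := IsIntegral.of_pow hp.pos (hζ.pow_eq_one ▸ isIntegral_one)
  have hγi : IsIntegral ℚ_[p] γ := isIntegral_of_mem_adjoin hζi hγ.1
  have : Finite ({z | z ^ p ^ a = z} ∪ {ζ, γt} : Set ℂ_[p]) :=
    (finite_setOf_pow_eq_self ℂ_[p] hq).union (Set.toFinite _)
  refine IntermediateField.finiteDimensional_adjoin fun z hz => ?_
  rcases hz with hz | rfl | rfl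
  · exact isIntegral_of_pow_eq_self hq hz
  · exact hζi
  · exact IsIntegral.of_pow hn (hγt ▸ hγi)

theorem hasSum_gammaIn {n a : ℕ} (hγ : IsDworkRoot p ζ γ) (hγt : γt ^ n = γ) :
    HasSum (fun k : ℕ => (gammaIn p a ζ γt ^ n) ^ p ^ k / (p : Omega p a ζ γt) ^ k) 0 := by
  subst hγt
  exact (Topology.IsInducing.subtypeVal.hasSum_iff (g := (Omega p a ζ γt).subtype) _ _).1 hγ.2.1

theorem ordp_coe {E : IntermediateField ℚ_[p] ℂ_[p]} (x : E) : ordp p (x : ℂ_[p]) = ordp p x := by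
  rcases eq_or_ne x 0 with rfl | hx
  · simp only [ordp, ZeroMemClass.coe_zero, if_true]
  · rw [ordp, ordp, if_neg hx, if_neg (ZeroMemClass.coe_eq_zero.not.2 hx)]
    rfl

theorem ordp_gammaIn_pow {n a : ℕ} (hγ : IsDworkRoot p ζ γ) (hγt : γt ^ n = γ) :
    ordp p (gammaIn p a ζ γt ^ n) = ((1 / ((p : ℝ) - 1) : ℝ) : EReal) := by
  rw [← hγ.2.2, ← hγt, ← ordp_coe]
  rfl

end Omega

end Dwork

end

theorem theorem2p15_general (p n : ℕ) [Fact p.Prime] (hn : 2 ≤ n) (hpn : n < p) {K : Type*}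
    [NormedField K] [NormedAlgebra ℚ_[p] K] [CompleteSpace K] (γt tb : K)
    (hγ : HasSum (fun k : ℕ => (γt ^ n) ^ p ^ k / (p : K) ^ k) 0)
    (hord : Dwork.ordp p (γt ^ n) = ((1 / ((p : ℝ) - 1) : ℝ) : EReal))
    (σ : K ≃+* K) (hσ : ∀ x, ‖σ x‖ = ‖x‖) (htb : ‖tb‖ = 1) :
    ∃ A : Matrix (Fin (2 * n + 1)) (Fin (2 * n + 1)) K,
      Dwork.IsFrobeniusMatrix p n γt tb σ A ∧
      (∀ A', Dwork.IsFrobeniusMatrix p n γt tb σ A' → A' = A) ∧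
      (∀ i j : Fin (2 * n + 1), (((j : ℝ) / n : ℝ) : EReal) ≤ Dwork.ordp p (A j i)) ∧
      (∀ i j : Fin (2 * n + 1), (j : ℤ) < Dwork.g p n i →
        (((j : ℝ) / n : ℝ) : EReal) < Dwork.ordp p (A j i)) ∧
      (∀ i : Fin (2 * n + 1), ∃ j : Fin (2 * n + 1), (j : ℤ) = Dwork.g p n i ∧
        Dwork.ordp p (A j i) = (((Dwork.g p n i : ℝ) / n : ℝ) : EReal)) ∧
      (2 * n ^ 2 - n < (p : ℤ) → ∀ i j : Fin (2 * n + 1), (i : ℕ) ≤ n → (j : ℕ) ≤ n - 1 →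
        ¬ ((i : ℕ) = n ∧ (j : ℕ) = 0) →
        Dwork.ordp p (A j i) =
          (((j : ℝ) / n + (2 * n + 1) * (Dwork.alphaCoef p n i j : ℝ) / (n * ((p : ℝ) - 1)) : ℝ)
            : EReal)) := by
  have hp : 1 < p := by omega
  have hn0 : 0 < n := by omega
  have : IsUltrametricDist K := .of_normedAlgebra ℚ_[p]
  have hγt : ‖γt‖ ^ (n * (p - 1)) = (p : ℝ)⁻¹ := by
    rw [pow_mul, ← norm_pow, Dwork.norm_pow_eq_of_ordp_eq hp hord]
  have h := Dwork.frobeniusData_of_hasSum hn hpn hσ htb hγt hγ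
  obtain ⟨A, hA, -⟩ := h.exists_isFrobeniusMatrix
  refine ⟨A, hA, fun A' => h.isFrobeniusMatrix_unique hA, fun i j => ?_, fun i j hj => ?_,
    fun i => ?_, fun hp2 i j hi hj hij => ?_⟩
  · simpa using Dwork.le_ordp_of_norm_le_pow (e := 0) hp hn0 hγt (h.norm_matrix_le hA)
  · refine lt_of_lt_of_le ?_
      (Dwork.le_ordp_of_norm_le_pow hp hn0 hγt (h.norm_matrix_le_of_lt_g hA hj))
    have hp' : (0 : ℝ) < p - 1 := sub_pos.2 (by exact_mod_cast hp)
    exact EReal.coe_lt_coe_iff.2 (lt_add_of_pos_right _ (by positivity))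
  · obtain ⟨G, hG, hGi⟩ := Dwork.exists_isFrobeniusTarget hn h.coprime (Nat.lt_succ_iff.1 i.2)
    refine ⟨⟨G, Nat.lt_succ_iff.2 hGi.le⟩, hG, ?_⟩
    rw [← hG]
    simpa using Dwork.ordp_of_norm_eq_pow (e := 0) hp hn0 hγt (h.norm_matrix_eq_of_eq_g hA hG)
  · obtain ⟨α, hα⟩ := Int.eq_ofNat_of_zero_le (Dwork.alphaCoef_nonneg p hn0.ne' i j)
    rw [hα, Dwork.ordp_of_norm_eq_pow hp hn0 hγt
      (h.norm_matrix_eq_of_alphaCoef hA hp2 hi (by omega) hij hα.symm)]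
    push_cast
    rfl

theorem theorem2p15 (p n a : ℕ) [Fact p.Prime] (hn : 2 ≤ n) (ha : 1 ≤ a) (hpn : n < p)
    (ζ γ γt : ℂ_[p]) (hζ : IsPrimitiveRoot ζ p) (hγ : Dwork.IsDworkRoot p ζ γ)
    (hγt : γt ^ n = γ)
    (σ : Dwork.Omega p a ζ γt ≃ₐ[ℚ_[p]] Dwork.Omega p a ζ γt) (hσ : Dwork.IsFrobenius σ)
    (tb : Dwork.Omega p a ζ γt) (htb : tb ^ (p ^ a - 1) = 1) :
    ∃ A : Matrix (Fin (2 * n + 1)) (Fin (2 * n + 1)) (Dwork.Omega p a ζ γt),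
      -- `A` is the matrix of the coefficients `Ã(ε̃_j, ε̃_i)`, which are well defined
      Dwork.IsFrobeniusMatrix p n (Dwork.gammaIn p a ζ γt) tb σ.toRingEquiv A ∧
      (∀ A', Dwork.IsFrobeniusMatrix p n (Dwork.gammaIn p a ζ γt) tb σ.toRingEquiv A' → A' = A) ∧
      -- (a)
      (∀ i j : Fin (2 * n + 1), (((j : ℝ) / n : ℝ) : EReal) ≤ Dwork.ordp p (A j i)) ∧
      -- (b)
      (∀ i j : Fin (2 * n + 1), (j : ℤ) < Dwork.g p n i →
        (((j : ℝ) / n : ℝ) : EReal) < Dwork.ordp p (A j i)) ∧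
      (∀ i : Fin (2 * n + 1), ∃ j : Fin (2 * n + 1), (j : ℤ) = Dwork.g p n i ∧
        Dwork.ordp p (A j i) = (((Dwork.g p n i : ℝ) / n : ℝ) : EReal)) ∧
      -- (c)
      (2 * n ^ 2 - n < (p : ℤ) → ∀ i j : Fin (2 * n + 1), (i : ℕ) ≤ n → (j : ℕ) ≤ n - 1 →
        ¬ ((i : ℕ) = n ∧ (j : ℕ) = 0) →
        Dwork.ordp p (A j i) =
          (((j : ℝ) / n + (2 * n + 1) * (Dwork.alphaCoef p n i j : ℝ) / (n * ((p : ℝ) - 1)) : ℝ)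
            : EReal)) := by
  have hq : p ^ a - 1 ≠ 0 :=
    Nat.sub_ne_zero_of_lt (Nat.one_lt_pow (by omega) (Nat.Prime.one_lt Fact.out))
  have htb_norm : ‖tb‖ = 1 :=
    (pow_eq_one_iff_of_nonneg (norm_nonneg tb) hq).1 (by rw [← norm_pow, htb, norm_one])
  have hfd := Dwork.finiteDimensional_Omega (a := a) (by omega) (by omega) hζ hγ hγt
  have : CompleteSpace (Dwork.Omega p a ζ γt) := FiniteDimensional.complete ℚ_[p] _
  exact theorem2p15_general p n hn hpn _ tb (Dwork.hasSum_gammaIn hγ hγt)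
    (Dwork.ordp_gammaIn_pow hγ hγt) σ.toRingEquiv (Dwork.norm_algEquiv σ) htb_norm
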